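/- Fix $c\in(1,9/8)$. For $x\in\mathbb R^3$ put $|x|_c=(|x_1|^c+|x_2|^c+|x_3|^c)^{1/c}$, let $\mathbb S_c^2=\{x\in\mathbb R^3:|x|_c=1\}$, and let $\mathbb S^2$ be the Euclidean unit sphere. Let $\mu_c$ be the Borel measure on $\mathbb S_c^2$ given by polar coordinates with respect to $|\cdot|_c$, i.e. the unique one with $$\int_{\mathbb R^3}f(x)\,dx=\int_0^\infty r^2\int_{\mathbb S_c^2}f(ry)\,d\mu_c(y)\,dr\qquad\text{for all Borel } f\ge 0,$$ and let $\nu_c=\mu_c/\mu_c(\mathbb S_c^2)$. For an integer $\lambda\ge 1$ put $$\mathbf S_c^3(\lambda)=\{m\in\mathbb Z^3:\lfloor|m_1|^c\rfloor+\lfloor|m_2|^c\rfloor+\lfloor|m_3|^c\rfloor=\lambda\},\quad r_c(\lambda)=\#\mathbf S_c^3(\lambda),\quad \mathbf P_c^3(\lambda)=\{\lambda^{-1/c}m:m\in\mathbf S_c^3(\lambda)\}.$$ For $\xi\in\mathbb S^2$ and $a>0$ let $C_{a,\xi}=\{x\in\mathbb S_c^2:x\cdot\xi\ge a\}$ and $\mathbf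 C_{a,\xi}=\{x\in\mathbb R^3:100\ge x\cdot\xi\ge a\}$, and define the discrepancy $$D_c(\lambda,\xi)=\sup_{a>0}\Big|\#\big(\mathbf P_c^3(\lambda)\cap\mathbf C_{a,\xi}\big)-r_c(\lambda)\,\nu_c(C_{a,\xi})\Big|.$$ **Theorem 1.10.** For every $\varepsilon>0$ there is a constant $C>0$, depending only on $c$ and $\varepsilon$, such that $$D_c(\lambda,\xi)\le C\,\lambda^{\frac3c-1-\frac{9-8c}{5c}+\varepsilon}\qquad\text{for all integers }\lambda\ge 1\text{ and all }\xi\in\mathbb S^2.$$ -/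

import Mathlib

open MeasureTheory Set
open scoped ENNReal Pointwise

/-- The space `ℝ³` with the Euclidean inner product `x · ξ = inner ℝ x ξ`. -/
abbrev R3 : Type := EuclideanSpace ℝ (Fin 3)

/-- `|x|_c = (|x₁|^c + |x₂|^c + |x₃|^c)^(1/c)`. -/
noncomputable def cNorm (c : ℝ) (x : R3) : ℝ := (∑ i, |x i| ^ c) ^ (1 / c)

/-- The unit sphere `{x ∈ ℝ³ : |x|_c = 1}`. -/
def cSphere (c : ℝ) : Set R3 := {x | cNorm c x = 1}

/-- The measure `μ_c` on `cSphere c` arising from polar coordinates with respect to `|·|_c`: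
`μ_c(E) = 3 · vol {x : 0 < |x|_c ≤ 1, x / |x|_c ∈ E}`. Regarded as a measure on `ℝ³`, it is
concentrated on `cSphere c` and is characterized by the polar decomposition
`∫ f(x) dx = ∫₀^∞ r² ∫ f(r y) dμ_c(y) dr`; both facts are proved below. -/
noncomputable def muC (c : ℝ) : Measure R3 :=
  (3 : ℝ≥0∞) • ((volume.restrict {x : R3 | 0 < cNorm c x ∧ cNorm c x ≤ 1}).map
    (fun x => (cNorm c x)⁻¹ • x))

/-- The normalization `ν_c = μ_c / μ_c(cSphere c)`. -/
noncomputable def nuC (c : ℝ) : Measure R3 := (muC c (cSphere c))⁻¹ • muC c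

/-- The arithmetic sphere
`{m ∈ ℤ³ : ⌊|m₁|^c⌋ + ⌊|m₂|^c⌋ + ⌊|m₃|^c⌋ = lam}`. -/
def arithSphere (c : ℝ) (lam : ℕ) : Set (Fin 3 → ℤ) :=
  {m | ∑ i, ⌊|(m i : ℝ)| ^ c⌋ = (lam : ℤ)}

/-- The number of points of the arithmetic sphere (a finite set if `c > 0`). -/
noncomputable def rC (c : ℝ) (lam : ℕ) : ℕ := (arithSphere c lam).ncard

/-- The projected points `lam^(-1/c) m`, for `m` in the arithmetic sphere. -/
def projSphere (c : ℝ) (lam : ℕ) : Set R3 :=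
  (fun m : Fin 3 → ℤ =>
    ((lam : ℝ) ^ (-(1 / c))) • (WithLp.toLp 2 (fun i => (m i : ℝ)) : R3)) '' arithSphere c lam

/-- The cap `{x ∈ cSphere c : x · ξ ≥ a}`. -/
def sphCap (c a : ℝ) (ξ : R3) : Set R3 := {x | x ∈ cSphere c ∧ a ≤ inner ℝ x ξ}

/-- The solid cap `{x ∈ ℝ³ : 100 ≥ x · ξ ≥ a}`. -/
def solidCap (a : ℝ) (ξ : R3) : Set R3 := {x | a ≤ inner ℝ x ξ ∧ inner ℝ x ξ ≤ 100}

/-- `D_c(lam, ξ, a)`. -/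
noncomputable def discrAt (c : ℝ) (lam : ℕ) (ξ : R3) (a : ℝ) : ℝ :=
  ((projSphere c lam ∩ solidCap a ξ).ncard : ℝ) - (rC c lam : ℝ) * (nuC c).real (sphCap c a ξ)

/-- `D_c(lam, ξ) = sup_{a > 0} |D_c(lam, ξ, a)|`, a supremum in `[0, ∞]`. -/
noncomputable def discr (c : ℝ) (lam : ℕ) (ξ : R3) : ℝ≥0∞ :=
  ⨆ (a : ℝ) (_ : 0 < a), ENNReal.ofReal |discrAt c lam ξ a|

section Facts

theorem cNorm_smul {c : ℝ} (hc : 0 < c) {r : ℝ} (hr : 0 ≤ r) (x : R3) :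
    cNorm c (r • x) = r * cNorm c x := by
  have h : ∀ i, |(r • x) i| ^ c = r ^ c * |x i| ^ c := fun i => by
    rw [PiLp.smul_apply, smul_eq_mul, abs_mul, abs_of_nonneg hr,
      Real.mul_rpow hr (abs_nonneg _)]
  simp only [cNorm, h]
  rw [← Finset.mul_sum, Real.mul_rpow (by positivity) (Finset.sum_nonneg fun i _ => by positivity),
    ← Real.rpow_mul hr, mul_one_div_cancel hc.ne', Real.rpow_one]

theorem cNorm_nonneg (c : ℝ) (x : R3) : 0 ≤ cNorm c x :=
  Real.rpow_nonneg (Finset.sum_nonneg fun i _ => by positivity) _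

theorem cNorm_pos {c : ℝ} {x : R3} (hx : x ≠ 0) : 0 < cNorm c x := by
  refine Real.rpow_pos_of_pos ?_ _
  obtain ⟨i, hi⟩ : ∃ i, x i ≠ 0 := by
    by_contra! h
    exact hx (by ext i; simpa using h i)
  exact Finset.sum_pos' (fun i _ => by positivity)
    ⟨i, Finset.mem_univ i, Real.rpow_pos_of_pos (abs_pos.2 hi) _⟩

theorem measurable_cNorm (c : ℝ) : Measurable (cNorm c) := by
  unfold cNorm
  fun_prop

theorem muC_apply (c : ℝ) {E : Set R3} (hE : MeasurableSet E) :
    muC c E = 3 * volume {x : R3 | 0 < cNorm c x ∧ cNorm c x ≤ 1 ∧ (cNorm c x)⁻¹ • x ∈ E} := by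
  have hm := measurable_cNorm c
  have hs : MeasurableSet {x : R3 | 0 < cNorm c x ∧ cNorm c x ≤ 1} :=
    (measurableSet_lt measurable_const hm).inter (measurableSet_le hm measurable_const)
  rw [muC, Measure.smul_apply, Measure.map_apply (by fun_prop) hE, Measure.restrict_apply' hs,
    smul_eq_mul]
  congr 2
  ext x
  simp only [mem_inter_iff, mem_preimage, mem_ofPred_eq]
  tauto

theorem measurableSet_cSphere (c : ℝ) : MeasurableSet (cSphere c) :=
  measurableSet_eq_fun (measurable_cNorm c) measurable_const

theorem inv_cNorm_smul_mem {c : ℝ} (hc : 0 < c) {x : R3} (hx : 0 < cNorm c x) :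
    (cNorm c x)⁻¹ • x ∈ cSphere c := by
  rw [cSphere, mem_ofPred_eq, cNorm_smul hc (inv_nonneg.2 hx.le), inv_mul_cancel₀ hx.ne']

/-- `μ_c` is concentrated on `cSphere c`. -/
theorem muC_compl_cSphere {c : ℝ} (hc : 0 < c) : muC c (cSphere c)ᶜ = 0 := by
  rw [muC_apply c (measurableSet_cSphere c).compl]
  convert mul_zero _
  convert measure_empty (μ := (volume : Measure R3))
  ext x
  simp only [mem_ofPred_eq, mem_empty_iff_false, iff_false]
  exact fun h => h.2.2 (inv_cNorm_smul_mem hc h.1)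

theorem volume_cNorm_le {c : ℝ} (hc : 1 ≤ c) {r : ℝ} :
    volume {x : R3 | cNorm c x ≤ r} =
      ENNReal.ofReal r ^ 3 *
        ENNReal.ofReal ((2 * Real.Gamma (1 / c + 1)) ^ 3 / Real.Gamma (3 / c + 1)) := by
  have h := MeasureTheory.volume_sum_rpow_le (Fin 3) hc r
  simp only [Fintype.card_fin] at h
  push_cast at h
  rw [← h, ← (EuclideanSpace.volume_preserving_symm_measurableEquiv_toLp (Fin 3)).symm.measure_preimage_equiv]
  rfl


/-- The total mass of `μ_c` is `8 Γ(1/c)³ / (c² Γ(3/c))`. -/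
theorem muC_cSphere {c : ℝ} (hc : 1 ≤ c) :
    muC c (cSphere c) =
      ENNReal.ofReal (8 * Real.Gamma (1 / c) ^ 3 / (c ^ 2 * Real.Gamma (3 / c))) := by
  have hc0 : 0 < c := by linarith
  have h1 : {x : R3 | 0 < cNorm c x ∧ cNorm c x ≤ 1 ∧ (cNorm c x)⁻¹ • x ∈ cSphere c}
      = {x : R3 | cNorm c x ≤ 1} \ {0} := by
    ext x
    simp only [mem_ofPred_eq, mem_sdiff, mem_singleton_iff]
    constructor
    · rintro ⟨h, h', -⟩
      refine ⟨h', ?_⟩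
      rintro rfl
      have := cNorm_smul hc0 le_rfl (0 : R3)
      rw [zero_smul, zero_mul] at this
      exact h.ne' this
    · rintro ⟨h, h'⟩
      exact ⟨cNorm_pos h', h, inv_cNorm_smul_mem hc0 (cNorm_pos h')⟩
  rw [muC_apply c (measurableSet_cSphere c), h1, measure_sdiff_null (measure_singleton _),
    volume_cNorm_le hc, ENNReal.ofReal_one, one_pow, one_mul,
    Real.Gamma_add_one (by positivity), Real.Gamma_add_one (by positivity),
    show (3 : ℝ≥0∞) = ENNReal.ofReal 3 by simp, ← ENNReal.ofReal_mul (by norm_num)]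
  congr 1
  have : Real.Gamma (3 / c) ≠ 0 := (Real.Gamma_pos_of_pos (by positivity)).ne'
  field_simp
  ring

theorem muC_univ {c : ℝ} (hc : 0 < c) : muC c univ = muC c (cSphere c) := by
  rw [← measure_add_measure_compl (measurableSet_cSphere c), muC_compl_cSphere hc, add_zero]

theorem isFiniteMeasure_muC {c : ℝ} (hc : 1 ≤ c) : IsFiniteMeasure (muC c) :=
  ⟨by rw [muC_univ (by linarith), muC_cSphere hc]; exact ENNReal.ofReal_lt_top⟩

/-- `ν_c` is a probability measure. -/
theorem isProbabilityMeasure_nuC {c : ℝ} (hc : 1 ≤ c) : IsProbabilityMeasure (nuC c) := by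
  have hc0 : 0 < c := by linarith
  refine ⟨?_⟩
  rw [nuC, Measure.smul_apply, smul_eq_mul, muC_univ hc0]
  refine ENNReal.inv_mul_cancel ?_ ?_
  · rw [muC_cSphere hc]
    have h1 := Real.Gamma_pos_of_pos (show 0 < 1 / c by positivity)
    have h3 := Real.Gamma_pos_of_pos (show 0 < 3 / c by positivity)
    exact (ENNReal.ofReal_pos.2 (by positivity)).ne'
  · rw [muC_cSphere hc]
    exact ENNReal.ofReal_ne_top

/-- The measure `r² dr` on `(0, ∞)`. -/
noncomputable def radial : Measure ℝ :=
  (volume.restrict (Ioi (0 : ℝ))).withDensity (fun r => ENNReal.ofReal (r ^ 2))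

theorem radial_Iic (R : ℝ) (hR : 0 ≤ R) : radial (Iic R) = ENNReal.ofReal (R ^ 3 / 3) := by
  rw [radial, withDensity_apply _ measurableSet_Iic, Measure.restrict_restrict measurableSet_Iic,
    Iic_inter_Ioi, ← ofReal_integral_eq_lintegral_ofReal (intervalIntegral.intervalIntegrable_pow 2).1,
    ← intervalIntegral.integral_of_le hR]
  · norm_num
  · exact Filter.Eventually.of_forall fun r => by positivity

theorem map_polar {c : ℝ} (hc : 1 ≤ c) :
    radial.prod (muC c) =
      (volume : Measure R3).map (fun x => (cNorm c x, (cNorm c x)⁻¹ • x)) := by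
  have hc0 : 0 < c := by linarith
  have hm := measurable_cNorm c
  have := isFiniteMeasure_muC hc
  have hspan : radial.FiniteSpanningSetsIn (range Iic) :=
    { set := fun n => Iic (n : ℝ)
      set_mem := fun n => mem_range_self _
      finite := fun n => by
        rw [radial_Iic _ n.cast_nonneg]; exact ENNReal.ofReal_lt_top
      spanning := iUnion_eq_univ_iff.2 fun x => ⟨⌈x⌉₊, Nat.le_ceil x⟩ }
  refine Measure.prod_eq_generateFrom
    ((borel_eq_generateFrom_Iic ℝ).symm.trans BorelSpace.measurable_eq.symm)
    MeasurableSpace.generateFrom_measurableSet isPiSystem_Iic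
    MeasurableSpace.isPiSystem_measurableSet hspan (muC c).toFiniteSpanningSetsIn ?_
  rintro _ ⟨R, rfl⟩ E hE
  have hE : MeasurableSet E := hE
  rw [Measure.map_apply (by fun_prop) (measurableSet_Iic.prod hE)]
  have hnull : ∀ S : Set R3, volume S = volume (S \ {0}) := fun S =>
    (measure_sdiff_null (measure_singleton _)).symm
  rcases le_or_gt R 0 with hR | hR
  · have h1 : radial (Iic R) = 0 :=
      measure_mono_null (Iic_subset_Iic.2 hR) (by rw [radial_Iic 0 le_rfl]; simp)
    rw [h1, zero_mul, hnull]
    convert measure_empty (μ := (volume : Measure R3))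
    ext x
    simp only [mem_sdiff, mem_preimage, mem_prod, mem_Iic, mem_singleton_iff, mem_empty_iff_false,
      iff_false, not_and, not_not]
    intro h
    by_contra hx
    linarith [cNorm_pos (c := c) hx, h.1]
  · rw [hnull, muC_apply c hE, radial_Iic R hR.le]
    have h1 : (fun x : R3 => (cNorm c x, (cNorm c x)⁻¹ • x)) ⁻¹' Iic R ×ˢ E \ {0}
        = R • {x : R3 | 0 < cNorm c x ∧ cNorm c x ≤ 1 ∧ (cNorm c x)⁻¹ • x ∈ E} := by
      ext x
      rw [mem_smul_set_iff_inv_smul_mem₀ hR.ne']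
      simp only [mem_sdiff, mem_preimage, mem_prod, mem_Iic, mem_singleton_iff, mem_ofPred_eq]
      rw [cNorm_smul hc0 (inv_nonneg.2 hR.le), mul_inv, inv_inv, smul_smul,
        show R * (cNorm c x)⁻¹ * R⁻¹ = (cNorm c x)⁻¹ by field_simp,
        inv_mul_le_iff₀ hR, mul_one, mul_pos_iff_of_pos_left (inv_pos.2 hR)]
      have : ¬x = 0 ↔ 0 < cNorm c x := by
        refine ⟨cNorm_pos, ?_⟩
        rintro h rfl
        have h0 := cNorm_smul hc0 le_rfl (0 : R3)
        rw [zero_smul, zero_mul] at h0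
        exact h.ne' h0
      rw [this]
      tauto
    rw [h1, Measure.addHaar_smul_of_nonneg _ hR.le, finrank_euclideanSpace_fin, ← mul_assoc,
      show (3 : ℝ≥0∞) = ENNReal.ofReal 3 by simp, ← ENNReal.ofReal_mul (by positivity)]
    congr 2
    ring

/-- The polar decomposition of Lebesgue measure with respect to `|·|_c`. -/
theorem lintegral_polar {c : ℝ} (hc : 1 ≤ c) {f : R3 → ℝ≥0∞} (hf : Measurable f) :
    ∫⁻ x, f x = ∫⁻ r in Ioi (0 : ℝ), ENNReal.ofReal (r ^ 2) * ∫⁻ y, f (r • y) ∂(muC c) := by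
  have hc0 : 0 < c := by linarith
  have hm := measurable_cNorm c
  have := isFiniteMeasure_muC hc
  have hg : Measurable (fun p : ℝ × R3 => f (p.1 • p.2)) := by fun_prop
  have h1 : ∫⁻ x, f x = ∫⁻ p, f (p.1 • p.2)
      ∂((volume : Measure R3).map (fun x => (cNorm c x, (cNorm c x)⁻¹ • x))) := by
    rw [lintegral_map hg (by fun_prop)]
    refine lintegral_congr fun x => ?_
    by_cases hx : x = 0
    · simp [hx]
    · simp only
      rw [smul_inv_smul₀ (cNorm_pos hx).ne']
  rw [h1, ← map_polar hc, lintegral_prod _ hg.aemeasurable, radial,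
    lintegral_withDensity_eq_lintegral_mul _ (by fun_prop) hg.lintegral_prod_right']
  rfl

/-- `μ_c` is the only measure concentrated on `cSphere c` with the polar decomposition. -/
theorem eq_muC {c : ℝ} (hc : 1 ≤ c) (μ : Measure R3) (h0 : μ (cSphere c)ᶜ = 0)
    (h : ∀ f : R3 → ℝ≥0∞, Measurable f →
      ∫⁻ x, f x = ∫⁻ r in Ioi (0 : ℝ), ENNReal.ofReal (r ^ 2) * ∫⁻ y, f (r • y) ∂μ) :
    μ = muC c := by
  have hc0 : 0 < c := by linarith
  have hm := measurable_cNorm c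
  ext E hE
  set A : Set R3 := {x : R3 | 0 < cNorm c x ∧ cNorm c x ≤ 1 ∧ (cNorm c x)⁻¹ • x ∈ E} with hA
  have hAm : MeasurableSet A :=
    (measurableSet_lt measurable_const hm).inter ((measurableSet_le hm measurable_const).inter
      ((show Measurable fun x : R3 => (cNorm c x)⁻¹ • x by fun_prop) hE))
  have h1 := h (A.indicator 1) (measurable_one.indicator hAm)
  rw [lintegral_indicator_one hAm] at h1
  have h2 : ∀ r ∈ Ioi (0 : ℝ), ENNReal.ofReal (r ^ 2) * ∫⁻ y, A.indicator 1 (r • y) ∂μ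
      = (Iic 1).indicator (fun r => ENNReal.ofReal (r ^ 2) * μ E) r := by
    intro r hr
    have hr : 0 < r := hr
    have h3 : ∫⁻ y, A.indicator 1 (r • y) ∂μ = ∫⁻ y, E.indicator (fun _ => (Iic (1 : ℝ)).indicator 1 r) y ∂μ := by
      refine lintegral_congr_ae ?_
      have : ∀ᵐ y ∂μ, y ∈ cSphere c := h0
      filter_upwards [this] with y hy
      have hy : cNorm c y = 1 := hy
      have : r • y ∈ A ↔ r ≤ 1 ∧ y ∈ E := by
        simp only [hA, mem_ofPred_eq, cNorm_smul hc0 hr.le, hy, mul_one, smul_smul,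
          inv_mul_cancel₀ hr.ne', one_smul, hr, true_and]
      by_cases hr1 : r ≤ 1 <;> by_cases hyE : y ∈ E <;> simp [indicator, this, hr1, hyE]
    rw [h3, lintegral_indicator hE, setLIntegral_const]
    by_cases hr1 : r ≤ 1 <;> simp [indicator, hr1]
  rw [setLIntegral_congr_fun measurableSet_Ioi h2, lintegral_indicator measurableSet_Iic,
    lintegral_mul_const _ (by fun_prop)] at h1
  have h4 := radial_Iic 1 zero_le_one
  rw [radial, withDensity_apply _ measurableSet_Iic] at h4
  rw [h4] at h1
  rw [muC_apply c hE, ← hA, h1, ← mul_assoc, show (3 : ℝ≥0∞) = ENNReal.ofReal 3 by simp,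
    ← ENNReal.ofReal_mul (by norm_num)]
  norm_num

theorem finite_arithSphere {c : ℝ} (hc : 0 < c) (lam : ℕ) : (arithSphere c lam).Finite := by
  set B : ℤ := ⌈((lam : ℝ) + 1) ^ (1 / c)⌉
  refine (Set.finite_Icc (fun _ : Fin 3 => -B) (fun _ => B)).subset fun m hm => ?_
  have hm : ∑ i, ⌊|(m i : ℝ)| ^ c⌋ = (lam : ℤ) := hm
  have key : ∀ i, |m i| ≤ B := fun i => by
    have h1 : ⌊|(m i : ℝ)| ^ c⌋ ≤ (lam : ℤ) := hm ▸ Finset.single_le_sum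
      (f := fun i => ⌊|(m i : ℝ)| ^ c⌋) (fun j _ => Int.floor_nonneg.2 (by positivity))
      (Finset.mem_univ i)
    have h2 : |(m i : ℝ)| ^ c ≤ (lam : ℝ) + 1 :=
      (Int.lt_floor_add_one _).le.trans (by gcongr; exact_mod_cast h1)
    have h3 := Real.rpow_le_rpow (by positivity) h2 (show 0 ≤ 1 / c by positivity)
    rw [← Real.rpow_mul (abs_nonneg _), mul_one_div_cancel hc.ne', Real.rpow_one] at h3
    have h4 : ((|m i| : ℤ) : ℝ) ≤ (B : ℝ) := by
      rw [Int.cast_abs]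
      exact h3.trans (Int.le_ceil _)
    exact_mod_cast h4
  exact ⟨fun i => (abs_le.1 (key i)).1, fun i => (abs_le.1 (key i)).2⟩

end Facts

/-! Put `N = lam ^ (1 / c)`. The heart is `exists_card_spherePoints_approx`: for each `lam` there is
one number `X` such that, for every direction `ξ` and height `|a| ≤ 4`, the number of points of the
arithmetic sphere with `m · ξ ≥ a N` is `μ_c(cap) X` up to `O(N ^ ((6 + 3c)/5 + cε))`. At `a = -4`
the cap is the whole sphere, so `r_c(lam)` is approximated by the same `X`, which can then be
eliminated; no asymptotic formula for `r_c(lam)` is needed. The exponent is the claimed one because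
`3/c - 1 - (9 - 8c)/(5c) = (6 + 3c)/(5c)`.

The number `X` comes from averaging over `W ≈ N ^ (1/5)` consecutive spheres. Their union is a shell
whose lattice points are counted by volume with error `O(N ^ 2)`, that is `O(N ^ (9/5))` per sphere
(`card_shellPoints_le`, `le_card_shellPoints`). Polar coordinates turn the volume of a sector of the
shell into the measure of a cap, up to a small change of height; this is harmless because the
measure of a cap is Lipschitz in the height (`exists_muC_sphCap_le_add`). The Lipschitz bound
follows from a uniform bound for planar slices of a thin shell, where strong convexity of `|x| ^ c`
enters.

One sphere is compared with its neighbours by a circle method in which only differences occur. The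
sharp cutoff `m · ξ ≥ a N` is replaced by a ramp of width about `d N`, `d = N ^ (-(9 - 8c)/5)`,
whose cosine series reduces matters to linear phases. With a linear phase, the difference of the
counts for `lam + j` and `lam` is the integral of a product of three sums `floorSum` against
`e(-(lam + j)α) - e(-lam α)`. The last factor is small for `α` near an integer, and the sums are
small elsewhere, so one sum times this factor is always `O(N ^ ((1 + 3c)/5))`
(`exists_norm_floorSum_mul_le`). The other two sums are integrated by Parseval, which costs `O(N)`
(`integral_norm_floorSum_sq_le`).

The minor arc bound `exists_norm_sum_unitPhase_floor_le` writes `e(α⌊x⌋) = e(αx) e(-α{x})`,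
approximates the second factor by a combination of periodic tents, and expands the tents in Fourier
series. What remains are sums of `e(β n ^ c + η n)`, estimated by van der Corput's second derivative
test; the estimate is uniform in `η` because second differences do not see linear terms. -/

/-- The additive character `x ↦ exp (2πix)` of `ℝ`. -/
noncomputable def unitPhase (x : ℝ) : ℂ := Complex.exp (Complex.I * ((2 * Real.pi * x : ℝ) : ℂ))

theorem unitPhase_add (x y : ℝ) : unitPhase (x + y) = unitPhase x * unitPhase y := by
  rw [unitPhase, unitPhase, unitPhase, ← Complex.exp_add]
  congr 1
  push_cast
  ring

@[simp] theorem unitPhase_zero : unitPhase 0 = 1 := by simp [unitPhase]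

theorem unitPhase_intCast (n : ℤ) : unitPhase n = 1 := by
  rw [unitPhase, Complex.exp_eq_one_iff]
  exact ⟨n, by push_cast; ring⟩

@[simp] theorem norm_unitPhase (x : ℝ) : ‖unitPhase x‖ = 1 := by
  rw [unitPhase, mul_comm, Complex.norm_exp_ofReal_mul_I]

theorem unitPhase_neg (x : ℝ) : unitPhase (-x) = (starRingEnd ℂ) (unitPhase x) := by
  rw [unitPhase, unitPhase, ← Complex.exp_conj]
  congr 1
  rw [map_mul, Complex.conj_I, Complex.conj_ofReal]
  push_cast
  ring

theorem unitPhase_re (x : ℝ) : (unitPhase x).re = Real.cos (2 * Real.pi * x) := by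
  rw [unitPhase, mul_comm, Complex.exp_ofReal_mul_I_re]

theorem unitPhase_nat_mul (n : ℕ) (x : ℝ) : unitPhase (n * x) = unitPhase x ^ n := by
  rw [unitPhase, unitPhase, ← Complex.exp_nat_mul]
  congr 1
  push_cast
  ring

theorem continuous_unitPhase : Continuous unitPhase := by
  unfold unitPhase
  fun_prop

theorem unitPhase_eq_of_sub_int {x y : ℝ} (n : ℤ) (h : x - y = n) : unitPhase x = unitPhase y := by
  rw [show x = y + n by linarith, unitPhase_add, unitPhase_intCast, mul_one]

theorem norm_unitPhase_sub_one (x : ℝ) : ‖unitPhase x - 1‖ = 2 * |Real.sin (Real.pi * x)| := by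
  rw [unitPhase, Complex.norm_exp_I_mul_ofReal_sub_one, Real.norm_eq_abs, abs_mul, abs_two]
  congr 3
  ring

theorem norm_unitPhase_sub (x y : ℝ) :
    ‖unitPhase x - unitPhase y‖ = 2 * |Real.sin (Real.pi * (x - y))| := by
  rw [← norm_unitPhase_sub_one, show unitPhase x = unitPhase (x - y) * unitPhase y by
    rw [← unitPhase_add]; ring_nf, ← sub_one_mul, norm_mul, norm_unitPhase, mul_one]

theorem norm_unitPhase_sub_le (x y : ℝ) :
    ‖unitPhase x - unitPhase y‖ ≤ 2 * Real.pi * |x - y| := by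
  rw [norm_unitPhase_sub]
  have := Real.abs_sin_le_abs (x := Real.pi * (x - y))
  rw [abs_mul, abs_of_pos Real.pi_pos] at this
  linarith

theorem norm_unitPhase_sub_le_two (x y : ℝ) : ‖unitPhase x - unitPhase y‖ ≤ 2 := by
  refine (norm_sub_le _ _).trans ?_
  simp only [norm_unitPhase]
  norm_num

/-! ### Strong convexity of `|x| ^ c` -/

/-- Bernoulli's inequality for the exponent `c - 1 < 1`, applied to `x / y`, gives the bound with `y
^ (c - 2)`; since `c < 2`, this dominates `R ^ (c - 2)`. -/
theorem rpow_sub_rpow_ge {c x y : ℝ} (hc : 1 < c) (hc2 : c < 2) (hx : 0 ≤ x) (hxy : x ≤ y)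
    {R : ℝ} (hR : y ≤ R) :
    (c - 1) * R ^ (c - 2) * (y - x) ≤ y ^ (c - 1) - x ^ (c - 1) := by
  rcases hxy.eq_or_lt with rfl | h
  · simp
  have hy : 0 < y := hx.trans_lt h
  have h1 : (x / y) ^ (c - 1) ≤ 1 + (c - 1) * (x / y - 1) := by
    have := rpow_one_add_le_one_add_mul_self (s := x / y - 1) (p := c - 1)
      (by have : 0 ≤ x / y := by positivity
          linarith) (by linarith) (by linarith)
    simpa using this
  have h2 : y ^ (c - 1) = y ^ (c - 2) * y := by
    rw [← Real.rpow_add_one hy.ne']; ring_nf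
  have h3 : x ^ (c - 1) = (x / y) ^ (c - 1) * y ^ (c - 1) := by
    rw [← Real.mul_rpow (by positivity) hy.le, div_mul_cancel₀ _ hy.ne']
  have h4 : R ^ (c - 2) ≤ y ^ (c - 2) :=
    Real.rpow_le_rpow_of_nonpos hy hR (by linarith)
  have h5 : (c - 1) * R ^ (c - 2) * (y - x) ≤ (c - 1) * y ^ (c - 2) * (y - x) := by
    have : 0 ≤ y - x := by linarith
    have : 0 ≤ c - 1 := by linarith
    gcongr
  refine h5.trans ?_
  have h6 : (x / y) ^ (c - 1) * y ^ (c - 1) ≤ (1 + (c - 1) * (x / y - 1)) * y ^ (c - 1) := by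
    gcongr
  rw [h3]
  refine le_trans (le_of_eq ?_) (sub_le_sub_left h6 _)
  rw [h2]
  field_simp
  ring

theorem monotoneOn_deriv_abs_rpow_sub {c R : ℝ} (hc : 1 < c) (hc2 : c < 2) :
    MonotoneOn (fun x : ℝ => c * |x| ^ (c - 2) * x - c * (c - 1) * R ^ (c - 2) * x) (Icc (-R) R) := by
  have key : ∀ x : ℝ, 0 ≤ x → |x| ^ (c - 2) * x = x ^ (c - 1) := by
    intro x hx
    rcases hx.eq_or_lt with rfl | hx
    · rw [Real.zero_rpow (by linarith)]; simp
    · rw [abs_of_pos hx, ← Real.rpow_add_one hx.ne']; ring_nf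
  have hpos : ∀ x y : ℝ, 0 ≤ x → x ≤ y → y ≤ R →
      c * |x| ^ (c - 2) * x - c * (c - 1) * R ^ (c - 2) * x ≤
      c * |y| ^ (c - 2) * y - c * (c - 1) * R ^ (c - 2) * y := by
    intro x y hx hxy hy
    have := rpow_sub_rpow_ge hc hc2 hx hxy hy
    rw [mul_assoc, mul_assoc c (|y| ^ (c - 2)), key x hx, key y (hx.trans hxy)]
    nlinarith
  -- The function is odd, so the case of nonnegative arguments implies the others by reflection,
  -- passing through `0` when the signs differ.
  intro x hx y hy hxy
  rcases le_total 0 x with h | h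
  · exact hpos x y h hxy hy.2
  rcases le_total 0 y with h' | h'
  · have h1 := hpos 0 y le_rfl h' hy.2
    have h2 := hpos 0 (-x) le_rfl (by linarith) (by linarith [hx.1])
    simp only [abs_neg, mul_zero, sub_zero] at h1 h2
    simp only
    linarith
  · have h1 := hpos (-y) (-x) (by linarith) (by linarith) (by linarith [hx.1])
    simp only [abs_neg] at h1
    simp only
    linarith

theorem convexOn_abs_rpow_sub {c R : ℝ} (hc : 1 < c) (hc2 : c < 2) :
    ConvexOn ℝ (Icc (-R) R) (fun x : ℝ => |x| ^ c - c * (c - 1) / 2 * R ^ (c - 2) * x ^ 2) := by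
  have hd : ∀ x : ℝ, HasDerivAt (fun x : ℝ => |x| ^ c - c * (c - 1) / 2 * R ^ (c - 2) * x ^ 2)
      (c * |x| ^ (c - 2) * x - c * (c - 1) * R ^ (c - 2) * x) x := by
    intro x
    have h1 := (hasDerivAt_abs_rpow x hc).sub
      ((hasDerivAt_pow 2 x).const_mul (c * (c - 1) / 2 * R ^ (c - 2)))
    refine h1.congr_deriv ?_
    norm_num
    ring
  refine MonotoneOn.convexOn_of_deriv (convex_Icc _ _)
    (fun x _ => (hd x).continuousAt.continuousWithinAt)
    (fun x _ => (hd x).differentiableAt.differentiableWithinAt) ?_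
  rw [show deriv _ = _ from funext fun x => (hd x).deriv]
  exact (monotoneOn_deriv_abs_rpow_sub hc hc2).mono interior_subset

/-- Quantitative midpoint convexity of `|x| ^ c` on `[-R, R]`. -/
theorem abs_rpow_midpoint_le {c R : ℝ} (hc : 1 < c) (hc2 : c < 2) {a b : ℝ} (ha : |a| ≤ R)
    (hb : |b| ≤ R) :
    |(a + b) / 2| ^ c ≤ (|a| ^ c + |b| ^ c) / 2 - c * (c - 1) / 8 * R ^ (c - 2) * (a - b) ^ 2 := by
  have h := (convexOn_abs_rpow_sub (R := R) hc hc2).2 (abs_le.1 ha) (abs_le.1 hb)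
    (show (0 : ℝ) ≤ 1 / 2 by norm_num) (show (0 : ℝ) ≤ 1 / 2 by norm_num) (by norm_num)
  simp only [smul_eq_mul] at h
  rw [show 1 / 2 * a + 1 / 2 * b = (a + b) / 2 by ring] at h
  linarith

/-! ### The second derivative test for exponential sums -/

theorem norm_inv_unitPhase_sub_one_le {θ x : ℝ} (hθ : 0 < θ) {k : ℤ} (h1 : k + θ ≤ x)
    (h2 : x ≤ k + 1 - θ) : ‖(unitPhase x - 1)⁻¹‖ ≤ 1 / (4 * θ) := by
  rw [norm_inv, ← one_div]
  refine one_div_le_one_div_of_le (by positivity) ?_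
  rw [unitPhase_eq_of_sub_int (y := x - k) k (by ring), norm_unitPhase_sub_one]
  have hθ2 : θ ≤ 1 / 2 := by linarith
  have hpi := Real.pi_pos
  have h3 : 2 * θ ≤ Real.sin (Real.pi * (x - k)) := by
    have h4 : ∀ y : ℝ, θ ≤ y → y ≤ 1 / 2 → 2 * θ ≤ Real.sin (Real.pi * y) := by
      intro y hy hy2
      have := Real.mul_le_sin (x := Real.pi * y) (by nlinarith) (by nlinarith)
      rw [show 2 / Real.pi * (Real.pi * y) = 2 * y by field_simp] at this
      linarith
    rcases le_total (x - k) (1 / 2) with h | h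
    · exact h4 _ (by linarith) h
    · have := h4 (1 - (x - k)) (by linarith) (by linarith)
      rwa [mul_sub, mul_one, Real.sin_pi_sub] at this
  rw [abs_of_nonneg (by linarith)]
  linarith

/-- Since `1 / (e(x) - 1) = -1/2 - (i/2) cot (πx)`, these values lie on a vertical line and move
along it monotonically between consecutive integers. The norms of successive differences therefore
telescope. -/
theorem norm_inv_unitPhase_sub_inv {x y : ℝ} {k : ℤ} (h1 : (k : ℝ) < x) (hxy : x ≤ y)
    (h2 : y < k + 1) :
    ‖(unitPhase x - 1)⁻¹ - (unitPhase y - 1)⁻¹‖ =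
      (Real.cot (Real.pi * (x - k)) - Real.cot (Real.pi * (y - k))) / 2 := by
  have hpi := Real.pi_pos
  have hs : ∀ z : ℝ, (k : ℝ) < z → z < k + 1 → 0 < Real.sin (Real.pi * (z - k)) := fun z hz hz2 =>
    Real.sin_pos_of_pos_of_lt_pi (by apply mul_pos hpi; linarith) (by nlinarith)
  have hn : ∀ z : ℝ, (k : ℝ) < z → z < k + 1 → ‖unitPhase z - 1‖ = 2 * Real.sin (Real.pi * (z - k)) := by
    intro z hz hz2
    rw [unitPhase_eq_of_sub_int (y := z - k) k (by ring), norm_unitPhase_sub_one,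
      abs_of_pos (hs z hz hz2)]
  have hx := hs x h1 (by linarith)
  have hy := hs y (by linarith) h2
  have hx0 : unitPhase x - 1 ≠ 0 := by
    rw [← norm_ne_zero_iff, hn x h1 (by linarith)]; positivity
  have hy0 : unitPhase y - 1 ≠ 0 := by
    rw [← norm_ne_zero_iff, hn y (by linarith) h2]; positivity
  rw [inv_sub_inv hx0 hy0, norm_div, norm_mul, hn x h1 (by linarith), hn y (by linarith) h2,
    show unitPhase y - 1 - (unitPhase x - 1) = unitPhase y - unitPhase x by ring,
    norm_unitPhase_sub, Real.cot_eq_cos_div_sin, Real.cot_eq_cos_div_sin]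
  have h3 : 0 ≤ Real.sin (Real.pi * (y - x)) :=
    Real.sin_nonneg_of_nonneg_of_le_pi (mul_nonneg hpi.le (by linarith)) (by nlinarith)
  rw [abs_of_nonneg h3, show Real.pi * (y - x) = Real.pi * (y - k) - Real.pi * (x - k) by ring,
    Real.sin_sub]
  field_simp

/-- The Kusmin–Landau inequality. -/
theorem norm_sum_unitPhase_le_of_monotone (f : ℕ → ℝ) (L : ℕ) {θ : ℝ} (hθ : 0 < θ) (k : ℤ)
    (hmono : ∀ n < L, f (n + 1) - f n ≤ f (n + 2) - f (n + 1))
    (h1 : ∀ n ≤ L, k + θ ≤ f (n + 1) - f n) (h2 : ∀ n ≤ L, f (n + 1) - f n ≤ k + 1 - θ) :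
    ‖∑ n ∈ Finset.range (L + 1), unitPhase (f n)‖ ≤ 1 / θ := by
  set g : ℕ → ℝ := fun n => f (n + 1) - f n with hg
  -- These multipliers make `e(f n)` equal to `(e(f (n + 1)) - e(f n)) C n`, ready for summation by
  -- parts.
  set C : ℕ → ℂ := fun n => (unitPhase (g n) - 1)⁻¹ with hC
  have hCn : ∀ n ≤ L, ‖C n‖ ≤ 1 / (4 * θ) := fun n hn =>
    norm_inv_unitPhase_sub_one_le hθ (h1 n hn) (h2 n hn)
  have hstep : ∀ n ≤ L, unitPhase (f n) = (unitPhase (f (n + 1)) - unitPhase (f n)) * C n := by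
    intro n hn
    have h0 : unitPhase (g n) - 1 ≠ 0 := by
      intro h
      have hk := norm_inv_unitPhase_sub_inv (x := g n) (y := g n) (k := k)
        (by linarith [h1 n hn]) le_rfl (by linarith [h2 n hn])
      have hs : 0 < Real.sin (Real.pi * (g n - k)) :=
        Real.sin_pos_of_pos_of_lt_pi (mul_pos Real.pi_pos (by linarith [h1 n hn]))
          (by have := Real.pi_pos
              have := h2 n hn
              nlinarith)
      have := norm_unitPhase_sub_one (g n - k)
      rw [← unitPhase_eq_of_sub_int (x := g n) k (by ring), h, norm_zero,
        abs_of_pos hs] at this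
      linarith
    have : unitPhase (f (n + 1)) = unitPhase (g n) * unitPhase (f n) := by
      rw [← unitPhase_add, hg]; ring_nf
    rw [this, hC]
    field_simp
  -- Summation by parts: apart from the two boundary terms, the sum is bounded by the total
  -- variation of `C`, which telescopes as a difference of cotangents.
  have main : ∀ l ≤ L, ‖∑ n ∈ Finset.range (l + 1), unitPhase (f n)
      - unitPhase (f (l + 1)) * C l + unitPhase (f 0) * C 0‖ ≤
      (Real.cot (Real.pi * (g 0 - k)) - Real.cot (Real.pi * (g l - k))) / 2 := by
    intro l
    induction l with
    | zero =>
      intro _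
      have := hstep 0 (Nat.zero_le _)
      rw [Finset.sum_range_one]
      rw [zero_add] at this ⊢
      rw [show unitPhase (f 0) - unitPhase (f 1) * C 0 + unitPhase (f 0) * C 0 = 0 by
        linear_combination this]
      simp
    | succ l ih =>
      intro hl
      have h3 := ih (by omega)
      rw [Finset.sum_range_succ]
      have h4 := hstep (l + 1) hl
      rw [show ∑ n ∈ Finset.range (l + 1), unitPhase (f n) + unitPhase (f (l + 1))
          - unitPhase (f (l + 1 + 1)) * C (l + 1) + unitPhase (f 0) * C 0 =
          (∑ n ∈ Finset.range (l + 1), unitPhase (f n)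
            - unitPhase (f (l + 1)) * C l + unitPhase (f 0) * C 0)
          + unitPhase (f (l + 1)) * (C l - C (l + 1)) by linear_combination h4]
      refine (norm_add_le _ _).trans ?_
      rw [norm_mul, norm_unitPhase, one_mul]
      have h5 := norm_inv_unitPhase_sub_inv (x := g l) (y := g (l + 1)) (k := k)
        (by linarith [h1 l (by omega)]) (hmono l (by omega)) (by linarith [h2 (l + 1) hl])
      rw [show C l - C (l + 1) = (unitPhase (g l) - 1)⁻¹ - (unitPhase (g (l + 1)) - 1)⁻¹ from rfl, h5]
      linarith
  have h3 := main L le_rfl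
  have hmono' : ∀ l ≤ L, g 0 ≤ g l := by
    intro l
    induction l with
    | zero => intro _; exact le_rfl
    | succ l ih => intro hl; exact (ih (by omega)).trans (hmono l (by omega))
  -- Read backwards, the cotangent difference is `‖C 0 - C L‖`, so the bound at the end points is
  -- enough.
  have h4 := norm_inv_unitPhase_sub_inv (x := g 0) (y := g L) (k := k)
    (by linarith [h1 0 (Nat.zero_le _)]) (hmono' L le_rfl) (by linarith [h2 L le_rfl])
  rw [← h4] at h3
  have h5 : ‖C 0 - C L‖ ≤ 1 / (4 * θ) + 1 / (4 * θ) :=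
    (norm_sub_le _ _).trans (add_le_add (hCn 0 (Nat.zero_le _)) (hCn L le_rfl))
  have h6 : ∑ n ∈ Finset.range (L + 1), unitPhase (f n) = (∑ n ∈ Finset.range (L + 1), unitPhase (f n)
      - unitPhase (f (L + 1)) * C L + unitPhase (f 0) * C 0) +
      (unitPhase (f (L + 1)) * C L - unitPhase (f 0) * C 0) := by ring
  rw [h6]
  refine (norm_add_le _ _).trans ((add_le_add (h3.trans h5) (norm_sub_le _ _)).trans ?_)
  rw [norm_mul, norm_mul, norm_unitPhase, norm_unitPhase, one_mul, one_mul]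
  have := hCn 0 (Nat.zero_le _)
  have := hCn L le_rfl
  have : 1 / θ = 4 * (1 / (4 * θ)) := by field_simp
  linarith

theorem mul_sub_le_of_forall_add_le {g : ℕ → ℝ} {L : ℕ} {ρ : ℝ} (hg : ∀ n < L, g n + ρ ≤ g (n + 1))
    {m n : ℕ} (hmn : m ≤ n) (hn : n ≤ L) : ρ * ((n : ℝ) - m) ≤ g n - g m := by
  induction n, hmn using Nat.le_induction with
  | base => simp
  | succ n hmn ih =>
    have := ih (by omega)
    have := hg n (by omega)
    push_cast
    linarith

theorem card_le_of_forall_mem_Ico {g : ℕ → ℝ} {L : ℕ} {ρ : ℝ} (hρ : 0 < ρ)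
    (hg : ∀ n < L, g n + ρ ≤ g (n + 1)) {s : Finset ℕ} (hs : ∀ n ∈ s, n ≤ L) {x θ : ℝ}
    (hθ : 0 ≤ θ) (hx : ∀ n ∈ s, x ≤ g n ∧ g n ≤ x + θ) : (s.card : ℝ) ≤ θ / ρ + 1 := by
  rcases s.eq_empty_or_nonempty with rfl | hne
  · simp; positivity
  have ha := s.min'_mem hne
  have hb := s.max'_mem hne
  set a := s.min' hne
  set b := s.max' hne
  have hab : a ≤ b := s.min'_le _ hb
  have hsub : s ⊆ Finset.Icc a b := fun n hn => Finset.mem_Icc.2 ⟨s.min'_le _ hn, s.le_max' _ hn⟩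
  have hcard : (s.card : ℝ) ≤ (b : ℝ) - a + 1 := by
    have := Finset.card_le_card hsub
    rw [Nat.card_Icc] at this
    have h2 : s.card + a ≤ b + 1 := by omega
    have h3 : (s.card : ℝ) + a ≤ b + 1 := by exact_mod_cast h2
    linarith
  have := mul_sub_le_of_forall_add_le hg hab (hs b hb)
  have h4 : (b : ℝ) - a ≤ θ / ρ := by
    rw [le_div_iff₀ hρ]
    linarith [(hx b hb).2, (hx a ha).1]
  linarith

theorem norm_sum_unitPhase_le_card (s : Finset ℕ) (f : ℕ → ℝ) :
    ‖∑ n ∈ s, unitPhase (f n)‖ ≤ s.card := by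
  refine (norm_sum_le _ _).trans ?_
  simp

/-- The increments of `f` are monotone, so the indices form an interval of consecutive integers and
the Kusmin–Landau inequality applies after a shift. -/
theorem norm_sum_filter_middle_le {f : ℕ → ℝ} {L : ℕ} {ρ θ : ℝ} (hρ : 0 < ρ) (hθ : 0 < θ)
    (hg : ∀ n < L, (f (n + 1) - f n) + ρ ≤ f (n + 2) - f (n + 1)) (k : ℤ) {s : Finset ℕ}
    (hs : ∀ n, n ∈ s ↔ n < L ∧ k + θ ≤ f (n + 1) - f n ∧ f (n + 1) - f n ≤ k + 1 - θ) :
    ‖∑ n ∈ s, unitPhase (f n)‖ ≤ 1 / θ := by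
  rcases s.eq_empty_or_nonempty with rfl | hne
  · simp; positivity
  have ha := s.min'_mem hne
  have hb := s.max'_mem hne
  set a := s.min' hne with ha'
  set b := s.max' hne with hb'
  have hab : a ≤ b := s.min'_le _ hb
  have hmono : ∀ m n, m ≤ n → n ≤ L → f (m + 1) - f m ≤ f (n + 1) - f n := by
    intro m n hmn hn
    have := mul_sub_le_of_forall_add_le (g := fun n => f (n + 1) - f n) hg hmn hn
    have h2 : (m : ℝ) ≤ n := by exact_mod_cast hmn
    nlinarith
  have hIcc : ∀ n, a ≤ n → n ≤ b → n ∈ s := by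
    intro n h1 h2
    have hb2 := (hs b).1 hb
    have ha2 := (hs a).1 ha
    exact (hs n).2 ⟨by omega, ha2.2.1.trans (hmono a n h1 (by omega)),
      (hmono n b h2 (by omega)).trans hb2.2.2⟩
  have hsum : ∑ n ∈ s, unitPhase (f n) = ∑ i ∈ Finset.range (b - a + 1), unitPhase (f (a + i)) := by
    have : s = (Finset.range (b - a + 1)).map (addLeftEmbedding a) := by
      ext n
      simp only [Finset.mem_map, Finset.mem_range, addLeftEmbedding_apply]
      constructor
      · intro hn
        have h1 : a ≤ n := s.min'_le _ hn
        have h2 : n ≤ b := s.le_max' _ hn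
        exact ⟨n - a, by omega, by omega⟩
      · rintro ⟨i, hi, rfl⟩
        exact hIcc _ (by omega) (by omega)
    rw [this, Finset.sum_map]
    rfl
  have hbL := ((hs b).1 hb).1
  rw [hsum]
  refine norm_sum_unitPhase_le_of_monotone (fun i => f (a + i)) (b - a) hθ k ?_ ?_ ?_
  · intro n hn
    exact hmono (a + n) (a + n + 1) (by omega) (by omega)
  · intro n hn
    exact ((hs (a + n)).1 (hIcc _ (by omega) (by omega))).2.1
  · intro n hn
    exact ((hs (a + n)).1 (hIcc _ (by omega) (by omega))).2.2

/-- The indices whose increment lies within `θ` of `k` or of `k + 1` are few because increments are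
`ρ`-separated, and are counted trivially; the rest is the Kusmin–Landau range. -/
theorem norm_sum_filter_floor_le {f : ℕ → ℝ} {L : ℕ} {ρ θ : ℝ} (hρ : 0 < ρ) (hθ : 0 < θ)
    (hg : ∀ n < L, (f (n + 1) - f n) + ρ ≤ f (n + 2) - f (n + 1)) (k : ℤ) :
    ‖∑ n ∈ (Finset.range L).filter (fun n => ⌊f (n + 1) - f n⌋ = k), unitPhase (f n)‖ ≤
      2 * (θ / ρ + 1) + 1 / θ := by
  set s := (Finset.range L).filter (fun n => ⌊f (n + 1) - f n⌋ = k) with hs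
  have hmem : ∀ n, n ∈ s ↔ n < L ∧ (k : ℝ) ≤ f (n + 1) - f n ∧ f (n + 1) - f n < k + 1 := by
    intro n
    simp [hs, Int.floor_eq_iff]
  rw [← Finset.sum_filter_add_sum_filter_not s (fun n => f (n + 1) - f n ≤ k + θ),
    ← Finset.sum_filter_add_sum_filter_not (s.filter (fun n => ¬ f (n + 1) - f n ≤ k + θ))
      (fun n => k + 1 - θ ≤ f (n + 1) - f n)]
  have hg' : ∀ n < L, (fun n => f (n + 1) - f n) n + ρ ≤ (fun n => f (n + 1) - f n) (n + 1) := hg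
  have h1 : ‖∑ n ∈ s.filter (fun n => f (n + 1) - f n ≤ k + θ), unitPhase (f n)‖ ≤ θ / ρ + 1 := by
    refine (norm_sum_unitPhase_le_card _ _).trans
      (card_le_of_forall_mem_Ico hρ hg' (x := k) ?_ hθ.le ?_)
    · intro n hn
      exact ((hmem n).1 (Finset.mem_filter.1 hn).1).1.le
    · intro n hn
      exact ⟨((hmem n).1 (Finset.mem_filter.1 hn).1).2.1, (Finset.mem_filter.1 hn).2⟩
  have h2 : ‖∑ n ∈ (s.filter (fun n => ¬ f (n + 1) - f n ≤ k + θ)).filter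
      (fun n => k + 1 - θ ≤ f (n + 1) - f n), unitPhase (f n)‖ ≤ θ / ρ + 1 := by
    refine (norm_sum_unitPhase_le_card _ _).trans
      (card_le_of_forall_mem_Ico hρ hg' (x := k + 1 - θ) ?_ hθ.le ?_)
    · intro n hn
      exact ((hmem n).1 (Finset.mem_filter.1 (Finset.mem_filter.1 hn).1).1).1.le
    · intro n hn
      have := ((hmem n).1 (Finset.mem_filter.1 (Finset.mem_filter.1 hn).1).1).2.2
      exact ⟨(Finset.mem_filter.1 hn).2, by linarith⟩
  have h3 : ∀ k' : Finset ℕ, (∀ n, n ∈ k' ↔ n < L ∧ k + θ < f (n + 1) - f n ∧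
      f (n + 1) - f n < k + 1 - θ) → ‖∑ n ∈ k', unitPhase (f n)‖ ≤ 1 / θ := by
    intro k' hk'
    rcases k'.eq_empty_or_nonempty with rfl | hne
    · simp; positivity
    -- The smallest distance of an increment of this finite set to `k` or `k + 1` serves as `θ'`; it
    -- turns the strict inequalities into the closed ones of the middle range.
    have hmin : ∃ θ' : ℝ, θ ≤ θ' ∧ ∀ n, n ∈ k' ↔ n < L ∧ k + θ' ≤ f (n + 1) - f n ∧
        f (n + 1) - f n ≤ k + 1 - θ' := by
      set h : ℕ → ℝ := fun n => min (f (n + 1) - f n - k) (k + 1 - (f (n + 1) - f n)) with hh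
      have hne' := hne.image h
      refine ⟨(k'.image h).min' hne', ?_, ?_⟩
      · rw [Finset.le_min'_iff]
        intro y hy
        obtain ⟨n, hn, rfl⟩ := Finset.mem_image.1 hy
        have := (hk' n).1 hn
        exact le_min (by linarith) (by linarith)
      · intro n
        constructor
        · intro hn
          have := (k'.image h).min'_le _ (Finset.mem_image_of_mem h hn)
          have h4 := this.trans (min_le_left _ _)
          have h5 := this.trans (min_le_right _ _)
          exact ⟨((hk' n).1 hn).1, by linarith, by linarith⟩
        · rintro ⟨h4, h5, h6⟩
          obtain ⟨m, hm, hm'⟩ := Finset.mem_image.1 ((k'.image h).min'_mem hne')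
          have h7 := (hk' m).1 hm
          have h8 : θ < (k'.image h).min' hne' := by
            rw [← hm']
            exact lt_min (by linarith) (by linarith)
          exact (hk' n).2 ⟨h4, by linarith, by linarith⟩
    obtain ⟨θ', hθ', h4⟩ := hmin
    exact (norm_sum_filter_middle_le hρ (hθ.trans_le hθ') hg k h4).trans
      (one_div_le_one_div_of_le hθ hθ')
  have h4 := h3 ((s.filter (fun n => ¬ f (n + 1) - f n ≤ k + θ)).filter
      (fun n => ¬ k + 1 - θ ≤ f (n + 1) - f n)) (by
    intro n
    simp only [Finset.mem_filter, hmem, not_le]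
    constructor
    · rintro ⟨⟨⟨h1, h2, h3⟩, h4⟩, h5⟩
      exact ⟨h1, h4, h5⟩
    · rintro ⟨h1, h2, h3⟩
      exact ⟨⟨⟨h1, by linarith, by linarith⟩, h2⟩, h3⟩)
  refine (norm_add_le _ _).trans ((add_le_add h1 ((norm_add_le _ _).trans (add_le_add h2 h4))).trans ?_)
  linarith

/-- Van der Corput's second derivative test, in terms of second differences. -/
theorem norm_sum_unitPhase_le_of_second_difference {f : ℕ → ℝ} {L : ℕ} {ρ : ℝ} (hρ : 0 < ρ)
    (hρ1 : ρ ≤ 1) (hg : ∀ n < L, (f (n + 1) - f n) + ρ ≤ f (n + 2) - f (n + 1)) :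
    ‖∑ n ∈ Finset.range L, unitPhase (f n)‖ ≤
      6 / √ρ * ((f (L + 1) - f L) - (f 1 - f 0) + 2) := by
  have hmono : ∀ m n, m ≤ n → n ≤ L → f (m + 1) - f m ≤ f (n + 1) - f n := by
    intro m n hmn hn
    have := mul_sub_le_of_forall_add_le (g := fun n => f (n + 1) - f n) hg hmn hn
    have h2 : (m : ℝ) ≤ n := by exact_mod_cast hmn
    nlinarith
  set t : Finset ℤ := Finset.Icc ⌊f 1 - f 0⌋ ⌊f (L + 1) - f L⌋ with ht
  have hmaps : ∀ n ∈ Finset.range L, ⌊f (n + 1) - f n⌋ ∈ t := by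
    intro n hn
    have hn := Finset.mem_range.1 hn
    exact Finset.mem_Icc.2 ⟨Int.floor_le_floor (hmono 0 n (Nat.zero_le _) hn.le),
      Int.floor_le_floor (hmono n L hn.le le_rfl)⟩
  rw [← Finset.sum_fiberwise_of_maps_to hmaps]
  have hsq : 0 < √ρ := Real.sqrt_pos.2 hρ
  have hsq1 : √ρ ≤ 1 := Real.sqrt_le_one.2 hρ1
  have hfib : ∀ k ∈ t, ‖∑ n ∈ (Finset.range L).filter (fun n => ⌊f (n + 1) - f n⌋ = k),
      unitPhase (f n)‖ ≤ 6 / √ρ := by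
    intro k _
    -- The choice `θ = √ρ` balances `θ / ρ` against `1 / θ`.
    refine (norm_sum_filter_floor_le hρ hsq hg k).trans ?_
    have h1 : √ρ / ρ = 1 / √ρ := by
      rw [div_eq_div_iff hρ.ne' hsq.ne', Real.mul_self_sqrt hρ.le, one_mul]
    have h2 : 1 ≤ 1 / √ρ := by rw [le_div_iff₀ hsq]; linarith
    rw [h1, show 6 / √ρ = 6 * (1 / √ρ) by ring]
    linarith
  have hcard : (t.card : ℝ) ≤ (f (L + 1) - f L) - (f 1 - f 0) + 2 := by
    rw [ht, Int.card_Icc]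
    have h1 := Int.floor_le (f (L + 1) - f L)
    have h2 := Int.lt_floor_add_one (f 1 - f 0)
    have h3 := hmono 0 L (Nat.zero_le _) le_rfl
    have h4 : ⌊f 1 - f 0⌋ ≤ ⌊f (L + 1) - f L⌋ := Int.floor_le_floor h3
    have h5 : (((⌊f (L + 1) - f L⌋ + 1 - ⌊f 1 - f 0⌋).toNat : ℤ) : ℝ) =
        ((⌊f (L + 1) - f L⌋ + 1 - ⌊f 1 - f 0⌋ : ℤ) : ℝ) := by
      rw [Int.toNat_of_nonneg (by linarith)]
    rw [Int.cast_natCast] at h5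
    rw [h5]
    push_cast
    linarith
  refine (norm_sum_le_of_le t hfib).trans ?_
  rw [Finset.sum_const, nsmul_eq_mul, mul_comm]
  gcongr

/-- Sums of `e(β n ^ c + η n)`, uniformly in the linear phase. -/
theorem exists_norm_sum_unitPhase_rpow_le {c : ℝ} (hc : 1 < c) (hc2 : c < 2) :
    ∃ C : ℝ, 0 < C ∧ ∀ M : ℕ, 0 < M → ∀ β η : ℝ, β ≠ 0 →
      ‖∑ n ∈ Finset.range M, unitPhase (β * ((n : ℝ) + 1) ^ c + η * ((n : ℝ) + 1))‖ ≤
        C * (|β| ^ (1 / 2 : ℝ) * (M : ℝ) ^ (c / 2) + |β| ^ (-(1 / 2) : ℝ) * (M : ℝ) ^ (1 - c / 2)) := by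
  set κ : ℝ := c * (c - 1) / 12 with hκ
  have hκ0 : 0 < κ := by
    have : 0 < c - 1 := by linarith
    positivity
  set C : ℝ := 100 / √κ + √κ with hC
  have hC0 : 0 < C := by positivity
  refine ⟨C, hC0, ?_⟩
  have key : ∀ M : ℕ, 0 < M → ∀ β η : ℝ, 0 < β →
      ‖∑ n ∈ Finset.range M, unitPhase (β * ((n : ℝ) + 1) ^ c + η * ((n : ℝ) + 1))‖ ≤
        C * (β ^ (1 / 2 : ℝ) * (M : ℝ) ^ (c / 2) + β ^ (-(1 / 2) : ℝ) * (M : ℝ) ^ (1 - c / 2)) := by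
    intro M hM β η hβ
    have hM0 : (0 : ℝ) < M := by exact_mod_cast hM
    have hM1 : (1 : ℝ) ≤ M := by exact_mod_cast hM
    set ρ : ℝ := β * κ * (M : ℝ) ^ (c - 2) with hρ
    have hρ0 : 0 < ρ := by positivity
    have hsqρ : √ρ = √κ * β ^ (1 / 2 : ℝ) * (M : ℝ) ^ (c / 2 - 1) := by
      rw [hρ, Real.sqrt_mul (by positivity), Real.sqrt_mul hβ.le, Real.sqrt_eq_rpow β,
        Real.sqrt_eq_rpow ((M : ℝ) ^ (c - 2)), ← Real.rpow_mul hM0.le]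
      ring_nf
    -- `ρ` is a lower bound for the second differences of the phase. If it exceeds `1`, the first
    -- term of the claim already dominates the trivial bound `M`.
    rcases le_or_gt ρ 1 with h1 | h1
    · set f : ℕ → ℝ := fun n => β * ((n : ℝ) + 1) ^ c + η * ((n : ℝ) + 1) with hf
      have hR : (1 / 3 : ℝ) * (M : ℝ) ^ (c - 2) ≤ ((M : ℝ) + 2) ^ (c - 2) := by
        have h2 : (3 * (M : ℝ)) ^ (c - 2) ≤ ((M : ℝ) + 2) ^ (c - 2) :=
          Real.rpow_le_rpow_of_nonpos (by positivity) (by linarith) (by linarith)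
        rw [Real.mul_rpow (by norm_num) hM0.le] at h2
        have h3 : (3 : ℝ) ^ (-1 : ℝ) ≤ 3 ^ (c - 2) :=
          Real.rpow_le_rpow_of_exponent_le (by norm_num) (by linarith)
        rw [Real.rpow_neg_one] at h3
        refine le_trans ?_ h2
        gcongr
        linarith
      have hg : ∀ n < M, (f (n + 1) - f n) + ρ ≤ f (n + 2) - f (n + 1) := by
        intro n hn
        have hn' : (n : ℝ) + 1 ≤ M := by exact_mod_cast hn
        have hn0 : (0 : ℝ) ≤ n := n.cast_nonneg
        have h2 := abs_rpow_midpoint_le (R := (M : ℝ) + 2) (a := (n : ℝ) + 1) (b := (n : ℝ) + 3) hc hc2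
          (by rw [abs_of_nonneg (by linarith)]; linarith)
          (by rw [abs_of_nonneg (by linarith)]; linarith)
        rw [abs_of_nonneg (by linarith), abs_of_nonneg (by linarith), abs_of_nonneg (by linarith),
          show ((n : ℝ) + 1 + (n + 3)) / 2 = n + 2 by ring,
          show ((n : ℝ) + 1 - (n + 3)) ^ 2 = 4 by ring] at h2
        have h3 : ρ ≤ β * (c * (c - 1) * ((M : ℝ) + 2) ^ (c - 2)) := by
          have h4 : 0 ≤ β * (c * (c - 1)) := by
            have : 0 < c - 1 := by linarith
            positivity
          have h5 := mul_le_mul_of_nonneg_left hR h4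
          have h6 : 0 ≤ (M : ℝ) ^ (c - 2) := by positivity
          have h7 := mul_nonneg h4 h6
          rw [hρ, hκ]
          linarith
        have h4 := mul_le_mul_of_nonneg_left h2 hβ.le
        simp only [hf]
        push_cast
        rw [show (n : ℝ) + 1 + 1 = n + 2 by ring, show (n : ℝ) + 2 + 1 = n + 3 by ring]
        linarith
      have h2 := norm_sum_unitPhase_le_of_second_difference hρ0 h1 hg
      refine h2.trans ?_
      -- The increments vary by at most the size of the derivative, `β M ^ (c - 1)`, whatever the
      -- slope `η` is, since `η` cancels.
      have hvar : (f (M + 1) - f M) - (f 1 - f 0) ≤ 12 * (β * (M : ℝ) ^ (c - 1)) := by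
        have h3 : ((M : ℝ) + 2) ^ c - ((M : ℝ) + 1) ^ c ≤ c * ((M : ℝ) + 2) ^ (c - 1) := by
          have h4 := one_add_mul_self_le_rpow_one_add (s := -1 / ((M : ℝ) + 2)) (p := c)
            (by rw [le_div_iff₀ (by positivity)]; linarith) hc.le
          have h5 : ((M : ℝ) + 1) ^ c = (1 + -1 / ((M : ℝ) + 2)) ^ c * ((M : ℝ) + 2) ^ c := by
            rw [← Real.mul_rpow _ (by positivity)]
            · congr 1
              field_simp
              ring
            · rw [show 1 + -1 / ((M : ℝ) + 2) = (M + 1) / (M + 2) by field_simp; ring]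
              positivity
          have h6 : ((M : ℝ) + 2) ^ c = ((M : ℝ) + 2) ^ (c - 1) * (M + 2) := by
            rw [← Real.rpow_add_one (by positivity)]; ring_nf
          have h7 : (1 + c * (-1 / ((M : ℝ) + 2))) * ((M : ℝ) + 2) ^ c ≤ ((M : ℝ) + 1) ^ c := by
            rw [h5]; gcongr
          rw [h6] at h7 ⊢
          have h8 : (1 + c * (-1 / ((M : ℝ) + 2))) * (((M : ℝ) + 2) ^ (c - 1) * (M + 2)) =
              ((M : ℝ) + 2) ^ (c - 1) * (M + 2) - c * ((M : ℝ) + 2) ^ (c - 1) := by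
            field_simp
            ring
          linarith
        have h4 : ((M : ℝ) + 2) ^ (c - 1) ≤ 3 * (M : ℝ) ^ (c - 1) := by
          have h5 : ((M : ℝ) + 2) ^ (c - 1) ≤ (3 * (M : ℝ)) ^ (c - 1) :=
            Real.rpow_le_rpow (by positivity) (by linarith) (by linarith)
          rw [Real.mul_rpow (by norm_num) hM0.le] at h5
          have h6 : (3 : ℝ) ^ (c - 1) ≤ 3 ^ (1 : ℝ) :=
            Real.rpow_le_rpow_of_exponent_le (by norm_num) (by linarith)
          rw [Real.rpow_one] at h6
          refine h5.trans ?_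
          gcongr
        have h5 : (1 : ℝ) ≤ 2 ^ c := Real.one_le_rpow (by norm_num) (by linarith)
        have h6 : c * ((M : ℝ) + 2) ^ (c - 1) ≤ 2 * (3 * (M : ℝ) ^ (c - 1)) := by gcongr
        simp only [hf]
        push_cast
        rw [show (M : ℝ) + 1 + 1 = M + 2 by ring, zero_add, Real.one_rpow,
          show (1 : ℝ) + 1 = 2 by norm_num]
        have h7 := mul_le_mul_of_nonneg_left (h3.trans h6) hβ.le
        have h8 : 0 ≤ β * (M : ℝ) ^ (c - 1) := by positivity
        nlinarith [mul_le_mul_of_nonneg_left h5 hβ.le]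
      have hinv : 6 / √ρ = 6 / √κ * (β ^ (-(1 / 2) : ℝ) * (M : ℝ) ^ (1 - c / 2)) := by
        rw [hsqρ, Real.rpow_neg hβ.le, show 1 - c / 2 = -(c / 2 - 1) by ring, Real.rpow_neg hM0.le]
        field_simp
      have e1 : β ^ (-(1 / 2) : ℝ) * (M : ℝ) ^ (1 - c / 2) * (β * (M : ℝ) ^ (c - 1)) =
          β ^ (1 / 2 : ℝ) * (M : ℝ) ^ (c / 2) := by
        have a1 : β ^ (1 / 2 : ℝ) = β ^ (-(1 / 2) : ℝ) * β := by
          rw [← Real.rpow_add_one hβ.ne']; norm_num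
        have a2 : (M : ℝ) ^ (c / 2) = (M : ℝ) ^ (1 - c / 2) * (M : ℝ) ^ (c - 1) := by
          rw [← Real.rpow_add hM0]; ring_nf
        rw [a1, a2]; ring
      have hp : 0 ≤ β ^ (-(1 / 2) : ℝ) * (M : ℝ) ^ (1 - c / 2) := by positivity
      have hq : 0 ≤ β ^ (1 / 2 : ℝ) * (M : ℝ) ^ (c / 2) := by positivity
      calc 6 / √ρ * ((f (M + 1) - f M) - (f 1 - f 0) + 2)
          ≤ 6 / √ρ * (12 * (β * (M : ℝ) ^ (c - 1)) + 2) := by gcongr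
        _ = 72 / √κ * (β ^ (1 / 2 : ℝ) * (M : ℝ) ^ (c / 2)) +
            12 / √κ * (β ^ (-(1 / 2) : ℝ) * (M : ℝ) ^ (1 - c / 2)) := by
          rw [hinv, ← e1]; ring
        _ ≤ C * (β ^ (1 / 2 : ℝ) * (M : ℝ) ^ (c / 2)) +
            C * (β ^ (-(1 / 2) : ℝ) * (M : ℝ) ^ (1 - c / 2)) := by
          have b1 : 72 / √κ ≤ C := by
            have : 72 / √κ ≤ 100 / √κ := by gcongr; norm_num
            have : 0 ≤ √κ := by positivity
            linarith
          have b2 : 12 / √κ ≤ C := by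
            have : 12 / √κ ≤ 100 / √κ := by gcongr; norm_num
            have : 0 ≤ √κ := by positivity
            linarith
          gcongr
        _ = _ := by ring
    · have h2 : 1 < √ρ := by rwa [Real.lt_sqrt (by norm_num), one_pow]
      rw [hsqρ] at h2
      have h3 : (M : ℝ) ^ (c / 2) = (M : ℝ) ^ (c / 2 - 1) * M := by
        rw [← Real.rpow_add_one hM0.ne']; ring_nf
      have h4 : (M : ℝ) ≤ √κ * (β ^ (1 / 2 : ℝ) * (M : ℝ) ^ (c / 2)) := by
        rw [h3]
        nlinarith
      refine (norm_sum_unitPhase_le_card _ _).trans ?_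
      rw [Finset.card_range]
      refine h4.trans ?_
      have h5 : √κ ≤ C := by
        have : 0 ≤ 100 / √κ := by positivity
        linarith
      refine mul_le_mul h5 ?_ (by positivity) hC0.le
      have : 0 ≤ β ^ (-(1 / 2) : ℝ) * (M : ℝ) ^ (1 - c / 2) := by positivity
      linarith
  intro M hM β η hβ
  rcases hβ.lt_or_gt with h | h
  · have h1 := key M hM (-β) (-η) (by linarith)
    rw [abs_of_neg h]
    refine le_trans (le_of_eq ?_) h1
    rw [← RCLike.norm_conj, map_sum]
    refine congrArg _ (Finset.sum_congr rfl fun n _ => ?_)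
    rw [← unitPhase_neg]
    congr 1
    ring
  · rw [abs_of_pos h]
    exact key M hM β η h

/-! ### Fourier series of periodic tents -/

theorem hasSum_cos_div_sq {x : ℝ} (h0 : 0 ≤ x) (h1 : x ≤ 1) :
    HasSum (fun n : ℕ => Real.cos (2 * Real.pi * n * x) / (n : ℝ) ^ 2)
      (Real.pi ^ 2 * (x ^ 2 - x + 1 / 6)) := by
  convert! hasSum_one_div_nat_pow_mul_cos one_ne_zero (show x ∈ Icc (0 : ℝ) 1 from ⟨h0, h1⟩) using 1
  · ext n; ring
  · rw [show (Polynomial.map (algebraMap ℚ ℝ) (Polynomial.bernoulli (2 * 1))).eval x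
      = x ^ 2 - x + 1 / 6 by
        rw [Polynomial.bernoulli_def]
        simp [Finset.sum_range_succ, _root_.bernoulli_two, _root_.bernoulli_one]
        ring,
      show ((Nat.factorial (2 * 1) : ℕ) : ℝ) = 2 by norm_num [Nat.factorial]]
    ring

/-- The `1`-periodic tent function of height `1` and half-width `1 / K`. -/
noncomputable def periodicTent (K : ℕ) (x : ℝ) : ℝ := max 0 (1 - K * |x - round x|)

/-- The Fourier cosine coefficients of `periodicTent`. -/
noncomputable def tentCoeff (K n : ℕ) : ℝ :=
  K / Real.pi ^ 2 * ((1 - Real.cos (2 * Real.pi * (n / K))) / (n : ℝ) ^ 2)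

theorem periodicTent_nonneg (K : ℕ) (x : ℝ) : 0 ≤ periodicTent K x := le_max_left _ _

theorem tentCoeff_nonneg (K n : ℕ) : 0 ≤ tentCoeff K n := by
  have := Real.cos_le_one (2 * Real.pi * (n / K))
  have : 0 ≤ 1 - Real.cos (2 * Real.pi * (n / K)) := by linarith
  unfold tentCoeff
  positivity

theorem tentCoeff_le_inv_sq (K n : ℕ) : tentCoeff K n ≤ K / (n : ℝ) ^ 2 := by
  have h1 := Real.neg_one_le_cos (2 * Real.pi * (n / K))
  have h2 := Real.pi_gt_three
  have h3 : (1 - Real.cos (2 * Real.pi * (n / K))) ≤ Real.pi ^ 2 := by nlinarith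
  unfold tentCoeff
  calc _ ≤ K / Real.pi ^ 2 * (Real.pi ^ 2 / (n : ℝ) ^ 2) := by gcongr
    _ = _ := by have := Real.pi_pos; field_simp

theorem tentCoeff_le_inv {K n : ℕ} (hK : 0 < K) : tentCoeff K n ≤ 2 / K := by
  rcases Nat.eq_zero_or_pos n with rfl | hn
  · simp [tentCoeff]; positivity
  have hn : (0 : ℝ) < n := by exact_mod_cast hn
  have hK : (0 : ℝ) < K := by exact_mod_cast hK
  have h1 := Real.one_sub_sq_div_two_le_cos (x := 2 * Real.pi * (n / K))
  have hpi := Real.pi_pos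
  unfold tentCoeff
  calc _ ≤ K / Real.pi ^ 2 * (((2 * Real.pi * (n / K)) ^ 2 / 2) / (n : ℝ) ^ 2) := by
        gcongr; linarith
    _ = _ := by field_simp

theorem cos_two_pi_nat_mul_sub_int (n : ℕ) (x : ℝ) (k : ℤ) :
    Real.cos (2 * Real.pi * n * (x - k)) = Real.cos (2 * Real.pi * n * x) := by
  rw [show 2 * Real.pi * n * (x - k) = 2 * Real.pi * n * x - ((n * k : ℤ) : ℝ) * (2 * Real.pi) by
    push_cast; ring, Real.cos_sub_int_mul_two_pi]

/-- A tent is a second difference of the periodic Bernoulli polynomial `B₂`, whose cosine series is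
known. The mean `1 / K` stands apart on the right because `tentCoeff K 0 = 0` by the convention for
division by zero. -/
theorem hasSum_periodicTent {K : ℕ} (hK : 2 ≤ K) (x : ℝ) :
    HasSum (fun n : ℕ => tentCoeff K n * Real.cos (2 * Real.pi * n * x))
      (periodicTent K x - 1 / K) := by
  set y : ℝ := |x - round x| with hy
  have hy0 : 0 ≤ y := abs_nonneg _
  have hy2 : y ≤ 1 / 2 := abs_sub_round x
  have hcos : ∀ n : ℕ, Real.cos (2 * Real.pi * n * x) = Real.cos (2 * Real.pi * n * y) := by
    intro n
    rw [← cos_two_pi_nat_mul_sub_int n x (round x), ← Real.cos_abs, abs_mul,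
      abs_of_nonneg (by have := Real.pi_pos; positivity)]
  have hK0 : (2 : ℝ) ≤ K := by exact_mod_cast hK
  have hKi : (1 : ℝ) / K ≤ 1 / 2 := by gcongr
  have hKp : 0 < (1 : ℝ) / K := by positivity
  have hpi := Real.pi_pos
  have h1 := hasSum_cos_div_sq hy0 (by linarith)
  have h2 := hasSum_cos_div_sq (x := y + 1 / K) (by linarith) (by linarith)
  have h3 := hasSum_cos_div_sq (x := |y - 1 / K|) (abs_nonneg _)
    (abs_le.2 ⟨by linarith, by linarith⟩)
  have h4 := (h1.sub ((h2.add h3).div_const 2)).mul_left (K / Real.pi ^ 2)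
  convert! h4 using 1
  · ext n
    rw [hcos, tentCoeff]
    have h5 : Real.cos (2 * Real.pi * n * |y - 1 / K|) = Real.cos (2 * Real.pi * n * (y - 1 / K)) := by
      rw [← Real.cos_abs (2 * Real.pi * n * (y - 1 / K)), abs_mul,
        abs_of_nonneg (show 0 ≤ 2 * Real.pi * n by positivity)]
    rw [h5, mul_add (2 * Real.pi * n), mul_sub (2 * Real.pi * n), Real.cos_add, Real.cos_sub,
      show 2 * Real.pi * n * (1 / K) = 2 * Real.pi * (n / K) by ring]
    ring
  · rw [periodicTent, ← hy, sq_abs (y - 1 / K)]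
    clear_value y
    rcases le_total y (1 / K) with h | h
    · rw [abs_of_nonpos (by linarith), max_eq_right]
      · field_simp
        ring
      · rw [le_div_iff₀ (by positivity)] at h
        linarith
    · rw [abs_of_nonneg (by linarith), max_eq_left]
      · field_simp
        ring
      · rw [div_le_iff₀ (by positivity)] at h
        linarith

/-- The `K` translates form a partition of unity: summing over them kills every frequency not
divisible by `K`, and at multiples of `K` the coefficient `tentCoeff` vanishes. -/
theorem sum_periodicTent {K : ℕ} (hK : 2 ≤ K) (x : ℝ) :
    ∑ j ∈ Finset.range K, periodicTent K (x - j / K) = 1 := by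
  have hK0 : (0 : ℝ) < K := by positivity
  have h1 := hasSum_sum (s := Finset.range K) (fun j _ => hasSum_periodicTent hK (x - j / K))
  rw [Finset.sum_sub_distrib, Finset.sum_const, Finset.card_range, nsmul_eq_mul,
    mul_one_div_cancel hK0.ne'] at h1
  have h2 : (fun n : ℕ => ∑ j ∈ Finset.range K,
      tentCoeff K n * Real.cos (2 * Real.pi * n * (x - j / K))) = fun _ => 0 := by
    ext n
    rw [← Finset.mul_sum]
    have h3 : ∑ j ∈ Finset.range K, Real.cos (2 * Real.pi * n * (x - j / K)) =
        (unitPhase (n * x) * ∑ j ∈ Finset.range K, unitPhase (-(n / K)) ^ j).re := by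
      rw [Finset.mul_sum, Complex.re_sum]
      refine Finset.sum_congr rfl fun j _ => ?_
      rw [← unitPhase_nat_mul, ← unitPhase_add, unitPhase_re]
      congr 1
      ring
    rcases eq_or_ne (unitPhase (-(n / K : ℝ))) 1 with h | h
    · have h4 := congrArg Complex.re h
      rw [unitPhase_re, Complex.one_re, mul_neg, Real.cos_neg] at h4
      rw [tentCoeff, h4]
      simp
    · have h5 : unitPhase (-(n / K : ℝ)) ^ K = 1 := by
        rw [← unitPhase_nat_mul, show (K : ℝ) * -(n / K) = ((-n : ℤ) : ℝ) by
          push_cast; field_simp, unitPhase_intCast]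
      rw [h3, geom_sum_eq h, h5]
      simp
  rw [h2] at h1
  have := h1.unique hasSum_zero
  linarith

theorem periodicTent_sub_int (K : ℕ) (x : ℝ) (k : ℤ) :
    periodicTent K (x - k) = periodicTent K x := by
  rw [periodicTent, periodicTent, round_sub_intCast]
  congr 4
  push_cast
  ring

/-- On the support of a tent centred at `j / K` with `j ≠ 0`, the fractional part differs from `j /
K` by at most `1 / K`, which costs `2π / K`. The tent centred at `0` also sees fractional parts near
`1`, across the jump, so there only the trivial bound `2` is available. -/
theorem norm_unitPhase_fract_sub_le {K : ℕ} (hK : 2 ≤ K) {α : ℝ} (h0 : 0 ≤ α) (h1 : α ≤ 1) (x : ℝ) :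
    ‖unitPhase (-(α * Int.fract x)) - ∑ j ∈ Finset.range K,
      unitPhase (-(α * (j / K))) * (periodicTent K (x - j / K) : ℂ)‖ ≤
      7 / K + 2 * periodicTent K x := by
  have hK0 : (0 : ℝ) < K := by positivity
  have hpart := sum_periodicTent hK x
  have hterm : ∀ j ∈ Finset.range K, ‖(unitPhase (-(α * Int.fract x)) - unitPhase (-(α * (j / K)))) *
      (periodicTent K (x - j / K) : ℂ)‖ ≤
      7 / K * periodicTent K (x - j / K) + if j = 0 then 2 * periodicTent K x else 0 := by
    intro j hj
    have hjK : (j : ℝ) + 1 ≤ K := by exact_mod_cast Finset.mem_range.1 hj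
    have hτ := periodicTent_nonneg K (x - j / K)
    rw [norm_mul, Complex.norm_real, Real.norm_of_nonneg hτ]
    by_cases hj0 : j = 0
    · rw [if_pos hj0]
      have := norm_unitPhase_sub_le_two (-(α * Int.fract x)) (-(α * (j / K)))
      have h3 := mul_le_mul_of_nonneg_right this hτ
      have h4 : 0 ≤ 7 / K * periodicTent K (x - j / K) := by positivity
      subst hj0
      simp only [Nat.cast_zero, zero_div, sub_zero] at h3 h4 ⊢
      linarith
    · rw [if_neg hj0, add_zero]
      rcases hτ.eq_or_lt with h | h
      · rw [← h]; simp
      refine mul_le_mul_of_nonneg_right ?_ hτ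
      refine (norm_unitPhase_sub_le _ _).trans ?_
      set y := Int.fract x with hy
      have hy0 : 0 ≤ y := Int.fract_nonneg x
      have hy1 : y < 1 := Int.fract_lt_one x
      have h5 : periodicTent K (y - j / K) = periodicTent K (x - j / K) := by
        rw [← periodicTent_sub_int K (x - j / K) ⌊x⌋, hy, Int.fract]
        congr 1
        ring
      rw [← h5, periodicTent, lt_max_iff] at h
      have h6 := h.resolve_left (lt_irrefl _)
      set r : ℤ := round (y - j / K) with hr
      have h7 : |y - j / K - r| < 1 / K := by
        rw [lt_div_iff₀ hK0]
        linarith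
      have hj1 : (1 : ℝ) ≤ j := by exact_mod_cast Nat.one_le_iff_ne_zero.2 hj0
      have hj2 : (j : ℝ) / K + 1 / K ≤ 1 := by
        rw [← add_div, div_le_one hK0]; exact hjK
      have hj3 : (1 : ℝ) / K ≤ j / K := by gcongr
      have h8 := abs_lt.1 h7
      -- For `1 ≤ j ≤ K - 1` the support of the tent does not wrap around an integer.
      have hr0 : r = 0 := by
        have a1 : (r : ℝ) < 1 := by linarith
        have a2 : (-1 : ℝ) < r := by linarith
        have a3 : r < 1 := by exact_mod_cast a1
        have a4 : -1 < r := by exact_mod_cast a2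
        omega
      rw [hr0, Int.cast_zero, sub_zero] at h7
      rw [show -(α * y) - -(α * (j / K)) = -(α * (y - j / K)) by ring, abs_neg, abs_mul,
        abs_of_nonneg h0]
      have h9 : α * |y - j / K| ≤ 1 * (1 / K) := by gcongr
      have h10 := Real.pi_lt_d2
      have h11 := Real.pi_pos
      calc 2 * Real.pi * (α * |y - j / K|) ≤ 7 * (1 * (1 / K)) := by gcongr; linarith
        _ = 7 / K := by ring
  have hid : unitPhase (-(α * Int.fract x)) - ∑ j ∈ Finset.range K,
      unitPhase (-(α * (j / K))) * (periodicTent K (x - j / K) : ℂ) =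
      ∑ j ∈ Finset.range K, (unitPhase (-(α * Int.fract x)) - unitPhase (-(α * (j / K)))) *
      (periodicTent K (x - j / K) : ℂ) := by
    simp only [sub_mul, Finset.sum_sub_distrib]
    rw [← Finset.mul_sum, ← Complex.ofReal_sum, hpart]
    simp
  rw [hid]
  refine (norm_sum_le_of_le _ hterm).trans ?_
  rw [Finset.sum_add_distrib, ← Finset.mul_sum, hpart, Finset.sum_ite_eq' ,
    if_pos (Finset.mem_range.2 (by omega))]
  linarith

theorem unitPhase_add_unitPhase_neg (x : ℝ) :
    unitPhase x + unitPhase (-x) = 2 * (Real.cos (2 * Real.pi * x) : ℂ) := by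
  rw [unitPhase_neg, Complex.add_conj, unitPhase_re]
  push_cast
  ring

/-- Sums weighted by a tent function, in terms of exponential sums. -/
theorem norm_sum_mul_periodicTent_le {ι : Type*} (t : Finset ι) (w : ι → ℂ) (x : ι → ℝ) {K : ℕ}
    (hK : 2 ≤ K) (s : ℝ) {d : ℕ → ℝ} {D : ℝ} (hd : HasSum d D)
    (hbound : ∀ n : ℕ, tentCoeff K n / 2 * (‖∑ i ∈ t, w i * unitPhase (n * x i)‖ +
      ‖∑ i ∈ t, w i * unitPhase (-(n * x i))‖) ≤ d n) :
    ‖∑ i ∈ t, w i * (periodicTent K (x i - s) : ℂ)‖ ≤ ‖∑ i ∈ t, w i‖ / K + D := by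
  have h1 : ∀ i ∈ t, HasSum (fun n : ℕ => w i * ((tentCoeff K n *
      Real.cos (2 * Real.pi * n * (x i - s)) : ℝ) : ℂ)) (w i * ((periodicTent K (x i - s) - 1 / K : ℝ) : ℂ)) :=
    fun i _ => (Complex.hasSum_ofReal.2 (hasSum_periodicTent hK (x i - s))).mul_left (w i)
  have h2 := hasSum_sum h1
  have h3 : ∀ n : ℕ, ‖∑ i ∈ t, w i * ((tentCoeff K n *
      Real.cos (2 * Real.pi * n * (x i - s)) : ℝ) : ℂ)‖ ≤ d n := by
    intro n
    refine le_trans ?_ (hbound n)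
    have h4 : ∑ i ∈ t, w i * ((tentCoeff K n * Real.cos (2 * Real.pi * n * (x i - s)) : ℝ) : ℂ) =
        ((tentCoeff K n / 2 : ℝ) : ℂ) * (unitPhase (-(n * s)) * (∑ i ∈ t, w i * unitPhase (n * x i)) +
          unitPhase (n * s) * ∑ i ∈ t, w i * unitPhase (-(n * x i))) := by
      rw [Finset.mul_sum, Finset.mul_sum, ← Finset.sum_add_distrib, Finset.mul_sum]
      refine Finset.sum_congr rfl fun i _ => ?_
      have h5 := unitPhase_add_unitPhase_neg (n * (x i - s))
      rw [show (n : ℝ) * (x i - s) = n * x i + -(n * s) by ring, unitPhase_add, neg_add, neg_neg,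
        unitPhase_add] at h5
      rw [show 2 * Real.pi * n * (x i - s) = 2 * Real.pi * (n * x i + -(n * s)) by ring]
      push_cast at h5 ⊢
      linear_combination -(w i * (tentCoeff K n : ℂ) / 2) * h5
    have hnn : 0 ≤ tentCoeff K n / 2 := by have := tentCoeff_nonneg K n; positivity
    rw [h4, norm_mul, Complex.norm_real, Real.norm_of_nonneg hnn]
    refine mul_le_mul_of_nonneg_left ((norm_add_le _ _).trans ?_) hnn
    rw [norm_mul, norm_mul, norm_unitPhase, norm_unitPhase, one_mul, one_mul]
  have h4 := tsum_of_norm_bounded hd h3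
  rw [h2.tsum_eq] at h4
  have h5 : ∑ i ∈ t, w i * (periodicTent K (x i - s) : ℂ) =
      ∑ i ∈ t, w i * ((periodicTent K (x i - s) - 1 / K : ℝ) : ℂ) + (∑ i ∈ t, w i) / K := by
    rw [Finset.sum_div, ← Finset.sum_add_distrib]
    refine Finset.sum_congr rfl fun i _ => ?_
    push_cast
    ring
  rw [h5]
  refine (norm_add_le _ _).trans ?_
  rw [norm_div, Complex.norm_natCast]
  linarith

theorem le_rpow_mul_rpow_of_le {x a b θ : ℝ} (hx : 0 ≤ x) (ha : x ≤ a) (hb : x ≤ b) (h0 : 0 ≤ θ)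
    (h1 : θ ≤ 1) : x ≤ a ^ (1 - θ) * b ^ θ := by
  rcases hx.eq_or_lt with rfl | hx
  · positivity
  calc x = x ^ (1 - θ) * x ^ θ := by rw [← Real.rpow_add hx]; simp
    _ ≤ a ^ (1 - θ) * b ^ θ := by
      exact mul_le_mul (Real.rpow_le_rpow hx.le ha (by linarith)) (Real.rpow_le_rpow hx.le hb h0)
        (by positivity) (Real.rpow_nonneg (hx.le.trans ha) _)

/-- Interpolation between the bounds `2 / K` and `2K / n ^ 2` with weight `3/4 + s/2` on the second,
chosen so that the product with `√n` is summable in `n`. -/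
theorem tentCoeff_mul_sqrt_le {K n : ℕ} (hK : 0 < K) {s : ℝ} (hs0 : 0 ≤ s) (hs : s ≤ 1 / 2) :
    tentCoeff K n * (n : ℝ) ^ (1 / 2 : ℝ) ≤ 2 * (K : ℝ) ^ (1 / 2 + s) * (n : ℝ) ^ (-1 - s) := by
  rcases Nat.eq_zero_or_pos n with rfl | hn
  · simp [tentCoeff]
    positivity
  have hn0 : (0 : ℝ) < n := by exact_mod_cast hn
  have hK0 : (0 : ℝ) < K := by exact_mod_cast hK
  have h2 : tentCoeff K n ≤ 2 * (K / (n : ℝ) ^ 2) := by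
    have := tentCoeff_le_inv_sq K n
    have : 0 ≤ K / (n : ℝ) ^ 2 := by positivity
    linarith
  have h := le_rpow_mul_rpow_of_le (θ := 3 / 4 + s / 2) (tentCoeff_nonneg K n)
    (tentCoeff_le_inv (n := n) hK) h2 (by linarith) (by linarith)
  have e : (2 / (K : ℝ)) ^ (1 - (3 / 4 + s / 2)) * (2 * (K / (n : ℝ) ^ 2)) ^ (3 / 4 + s / 2) =
      2 * (K : ℝ) ^ (1 / 2 + s) * (n : ℝ) ^ (-3 / 2 - s) := by
    obtain ⟨θ, hθ⟩ : ∃ θ, θ = 3 / 4 + s / 2 := ⟨_, rfl⟩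
    rw [← hθ, show 1 / 2 + s = θ - (1 - θ) by rw [hθ]; ring,
      show -3 / 2 - s = -(((2 : ℕ) : ℝ) * θ) by rw [hθ]; push_cast; ring,
      Real.div_rpow (by norm_num) hK0.le, Real.mul_rpow (by norm_num) (by positivity),
      Real.div_rpow hK0.le (by positivity), ← Real.rpow_natCast, ← Real.rpow_mul hn0.le,
      Real.rpow_sub hK0 θ (1 - θ), Real.rpow_neg hn0.le]
    have a1 : (2 : ℝ) ^ (1 - θ) * 2 ^ θ = 2 := by
      rw [← Real.rpow_add (by norm_num)]; norm_num
    rw [div_mul_eq_mul_div, ← mul_assoc, a1]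
    field_simp
  rw [e] at h
  calc _ ≤ 2 * (K : ℝ) ^ (1 / 2 + s) * (n : ℝ) ^ (-3 / 2 - s) * (n : ℝ) ^ (1 / 2 : ℝ) := by gcongr
    _ = _ := by rw [mul_assoc, ← Real.rpow_add hn0]; ring_nf

/-- Van der Corput sums at frequency `n` grow like `√n`, and the tent series sums them to about `K ^
(1/2)`. The extra term `Y` allows the single frequency `n = 1` to be exceptional; this is needed
because the shifted phase `α - 1` may be close to `0`. -/
theorem norm_sum_mul_periodicTent_le_of_sqrt {ι : Type*} (t : Finset ι) (w : ι → ℂ) (x : ι → ℝ)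
    {K : ℕ} (hK : 2 ≤ K) (u : ℝ) {B Y s : ℝ} (hY : 0 ≤ Y) (hs0 : 0 < s) (hs : s ≤ 1 / 2)
    (h1 : ∀ n : ℕ, 0 < n → ‖∑ i ∈ t, w i * unitPhase (n * x i)‖ ≤
      B * (n : ℝ) ^ (1 / 2 : ℝ) + if n = 1 then Y else 0)
    (h2 : ∀ n : ℕ, 0 < n → ‖∑ i ∈ t, w i * unitPhase (-(n * x i))‖ ≤
      B * (n : ℝ) ^ (1 / 2 : ℝ) + if n = 1 then Y else 0) (hB : 0 ≤ B) :
    ‖∑ i ∈ t, w i * (periodicTent K (x i - u) : ℂ)‖ ≤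
      ‖∑ i ∈ t, w i‖ / K + (2 * B * (K : ℝ) ^ (1 / 2 + s) * (∑' n : ℕ, (n : ℝ) ^ (-1 - s)) + 2 * Y / K) := by
  have hK0 : 0 < K := by omega
  have hsum : Summable (fun n : ℕ => (n : ℝ) ^ (-1 - s)) := Real.summable_nat_rpow.2 (by linarith)
  have hd : HasSum (fun n : ℕ => 2 * B * (K : ℝ) ^ (1 / 2 + s) * (n : ℝ) ^ (-1 - s) +
      if n = 1 then 2 * Y / K else 0)
      (2 * B * (K : ℝ) ^ (1 / 2 + s) * (∑' n : ℕ, (n : ℝ) ^ (-1 - s)) + 2 * Y / K) :=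
    (hsum.hasSum.mul_left _).add (hasSum_ite_eq 1 _)
  refine norm_sum_mul_periodicTent_le t w x hK u hd fun n => ?_
  rcases Nat.eq_zero_or_pos n with rfl | hn
  · simp only [tentCoeff, Nat.cast_zero]
    simp
    positivity
  have ht := tentCoeff_nonneg K n
  have h3 := add_le_add (h1 n hn) (h2 n hn)
  have h4 := tentCoeff_mul_sqrt_le (n := n) hK0 hs0.le hs
  have h5 : tentCoeff K n * (if n = 1 then Y else 0) ≤ if n = 1 then 2 * Y / K else 0 := by
    split_ifs
    · have := mul_le_mul_of_nonneg_right (tentCoeff_le_inv (n := n) hK0) hY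
      calc _ ≤ _ := this
        _ = _ := by ring
    · simp
  have h6 := mul_le_mul_of_nonneg_left h3 (half_pos (show (0 : ℝ) < 2 by norm_num)).le
  calc tentCoeff K n / 2 * (‖∑ i ∈ t, w i * unitPhase (n * x i)‖ +
      ‖∑ i ∈ t, w i * unitPhase (-(n * x i))‖)
      ≤ tentCoeff K n / 2 * ((B * (n : ℝ) ^ (1 / 2 : ℝ) + if n = 1 then Y else 0) +
        (B * (n : ℝ) ^ (1 / 2 : ℝ) + if n = 1 then Y else 0)) := by gcongr
    _ = B * (tentCoeff K n * (n : ℝ) ^ (1 / 2 : ℝ)) + tentCoeff K n * (if n = 1 then Y else 0) := by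
      ring
    _ ≤ B * (2 * (K : ℝ) ^ (1 / 2 + s) * (n : ℝ) ^ (-1 - s)) + if n = 1 then 2 * Y / K else 0 := by
      gcongr
    _ = _ := by ring

/-! ### The minor arcs -/

set_option maxHeartbeats 1000000 in
/-- The minor arc bound for exponential sums over `⌊m ^ c⌋`. -/
theorem exists_norm_sum_unitPhase_floor_le {c : ℝ} (hc : 1 < c) (hc2 : c < 9 / 8) :
    ∃ C : ℝ, 0 < C ∧ ∀ M : ℕ, 0 < M → ∀ α η : ℝ, (M : ℝ) ^ (-(3 / 5) : ℝ) ≤ α →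
      α ≤ 1 - (M : ℝ) ^ (-(3 / 5) : ℝ) →
      ‖∑ n ∈ Finset.range M, unitPhase (α * (⌊((n : ℝ) + 1) ^ c⌋ : ℝ) + η * ((n : ℝ) + 1))‖ ≤
        C * (M : ℝ) ^ ((1 + 3 * c) / 5) := by
  obtain ⟨C₀, hC₀, hvdc⟩ := exists_norm_sum_unitPhase_rpow_le hc (by linarith)
  -- At `s = 0` the exponent of the tent error below exceeds its target by `-(c - 1)`; this value of
  -- `s` spends part of that room on convergence, and `s ≤ 1/2` because `c < 9/8`.
  set s : ℝ := 4 * (c - 1) with hs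
  set ζ : ℝ := ∑' n : ℕ, (n : ℝ) ^ (-1 - s) with hζ
  have hζ0 : 0 ≤ ζ := tsum_nonneg fun n => by positivity
  refine ⟨200 * C₀ * (1 + ζ) + 20, by positivity, ?_⟩
  intro M hM α η hα1 hα2
  have hM1 : (1 : ℝ) ≤ M := by exact_mod_cast hM
  have hM0 : (0 : ℝ) < M := by linarith
  -- With `K ≈ M ^ k` the discretisation error `M / K` is at most `M ^ ((1 + 3c)/5)`.
  set k : ℝ := (4 - 3 * c) / 5 with hk
  have hMk : 1 ≤ (M : ℝ) ^ k := Real.one_le_rpow hM1 (by rw [hk]; linarith)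
  set K : ℕ := ⌈(M : ℝ) ^ k⌉₊ + 1 with hKdef
  have hK1 : (M : ℝ) ^ k ≤ K := by
    have := Nat.le_ceil ((M : ℝ) ^ k)
    rw [hKdef]; push_cast; linarith
  have hK3 : (K : ℝ) ≤ 3 * (M : ℝ) ^ k := by
    have := Nat.ceil_lt_add_one (show 0 ≤ (M : ℝ) ^ k by positivity)
    rw [hKdef]; push_cast; linarith
  have hK2 : 2 ≤ K := by
    have : 0 < ⌈(M : ℝ) ^ k⌉₊ := Nat.ceil_pos.2 (by linarith)
    omega
  have hK0 : (0 : ℝ) < K := by linarith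
  set P : ℝ := (M : ℝ) ^ ((1 + 3 * c) / 5) with hP
  have hP0 : 0 < P := by positivity
  have hα0 : 0 < (M : ℝ) ^ (-(3 / 5) : ℝ) := by positivity
  set x : ℕ → ℝ := fun n => ((n : ℝ) + 1) ^ c with hx
  set t := Finset.range M with ht
  set Y : ℝ := 2 * C₀ * P with hY
  set B : ℝ := 3 * C₀ * (M : ℝ) ^ (c / 2) with hB
  have hbig : ∀ (β η : ℝ) (n : ℕ), 1 ≤ |β| → |β| ≤ 2 * n →
      ‖∑ i ∈ t, unitPhase (β * x i + η * ((i : ℝ) + 1))‖ ≤ B * (n : ℝ) ^ (1 / 2 : ℝ) := by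
    intro β η n h1 h2
    have hβ : β ≠ 0 := by rintro rfl; norm_num at h1
    refine (hvdc M hM β η hβ).trans ?_
    have hn1 : (1 : ℝ) ≤ n := by
      have h3 : (0 : ℝ) < n := by linarith
      have h4 : 0 < n := by exact_mod_cast h3
      exact_mod_cast h4
    have h3 : |β| ^ (1 / 2 : ℝ) ≤ 2 * (n : ℝ) ^ (1 / 2 : ℝ) := by
      have h4 : |β| ^ (1 / 2 : ℝ) ≤ (4 * (n : ℝ)) ^ (1 / 2 : ℝ) := by gcongr; linarith
      rw [Real.mul_rpow (by norm_num) (by positivity), ← Real.sqrt_eq_rpow 4,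
        show √(4 : ℝ) = 2 by rw [show (4 : ℝ) = 2 ^ 2 by norm_num]; exact Real.sqrt_sq (by norm_num)] at h4
      exact h4
    have h4 : |β| ^ (-(1 / 2) : ℝ) ≤ (n : ℝ) ^ (1 / 2 : ℝ) :=
      (Real.rpow_le_one_of_one_le_of_nonpos h1 (by norm_num)).trans
        (Real.one_le_rpow hn1 (by norm_num))
    have h5 : (M : ℝ) ^ (1 - c / 2) ≤ (M : ℝ) ^ (c / 2) :=
      Real.rpow_le_rpow_of_exponent_le hM1 (by linarith)
    calc _ ≤ C₀ * (2 * (n : ℝ) ^ (1 / 2 : ℝ) * (M : ℝ) ^ (c / 2) +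
          (n : ℝ) ^ (1 / 2 : ℝ) * (M : ℝ) ^ (c / 2)) := by gcongr
      _ = _ := by rw [hB]; ring
  have hsmall : ∀ (β η : ℝ), (M : ℝ) ^ (-(3 / 5) : ℝ) ≤ |β| → |β| ≤ 1 →
      ‖∑ i ∈ t, unitPhase (β * x i + η * ((i : ℝ) + 1))‖ ≤ Y := by
    intro β η h1 h2
    have hβ : β ≠ 0 := by rintro rfl; simp at h1; linarith
    refine (hvdc M hM β η hβ).trans ?_
    have h3 : |β| ^ (1 / 2 : ℝ) ≤ 1 := Real.rpow_le_one (abs_nonneg _) h2 (by norm_num)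
    have h4 : |β| ^ (-(1 / 2) : ℝ) ≤ (M : ℝ) ^ (3 / 10 : ℝ) := by
      have := Real.rpow_le_rpow_of_nonpos (z := -(1 / 2)) hα0 h1 (by norm_num)
      rw [← Real.rpow_mul hM0.le] at this
      norm_num at this ⊢
      exact this
    have h5 : (M : ℝ) ^ (c / 2) ≤ P := Real.rpow_le_rpow_of_exponent_le hM1 (by linarith)
    -- The threshold `M ^ (-3/5)` enters here: `3/10 + 1 - c/2 ≤ (1 + 3c)/5` holds exactly when `c ≥
    -- 1`.
    have h6 : (M : ℝ) ^ (3 / 10 : ℝ) * (M : ℝ) ^ (1 - c / 2) ≤ P := by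
      rw [← Real.rpow_add hM0]
      exact Real.rpow_le_rpow_of_exponent_le hM1 (by linarith)
    calc _ ≤ C₀ * (1 * P + (M : ℝ) ^ (3 / 10 : ℝ) * (M : ℝ) ^ (1 - c / 2)) := by gcongr
      _ ≤ C₀ * (1 * P + P) := by gcongr
      _ = _ := by rw [hY]; ring
  have hα1' : α ≤ 1 := by linarith
  have hα0' : 0 < α := by linarith
  have hY0 : 0 ≤ Y := by positivity
  have hB0 : 0 ≤ B := by positivity
  have hs0 : 0 < s := by rw [hs]; linarith
  have hs1 : s ≤ 1 / 2 := by rw [hs]; linarith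
  -- the combined size of the error terms
  have hKpow : K * (B * (K : ℝ) ^ (1 / 2 + s)) ≤ 27 * C₀ * P := by
    have e1 : (K : ℝ) * (K : ℝ) ^ (1 / 2 + s) = (K : ℝ) ^ (3 / 2 + s) := by
      rw [mul_comm, ← Real.rpow_add_one hK0.ne']; ring_nf
    have e2 : (K : ℝ) ^ (3 / 2 + s) ≤ 9 * (M : ℝ) ^ (k * (3 / 2 + s)) := by
      have h1 : (K : ℝ) ^ (3 / 2 + s) ≤ (3 * (M : ℝ) ^ k) ^ (3 / 2 + s) := by gcongr
      rw [Real.mul_rpow (by norm_num) (by positivity), ← Real.rpow_mul hM0.le] at h1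
      have h2 : (3 : ℝ) ^ (3 / 2 + s) ≤ 3 ^ (2 : ℝ) :=
        Real.rpow_le_rpow_of_exponent_le (by norm_num) (by linarith)
      rw [show (3 : ℝ) ^ (2 : ℝ) = 9 by norm_num] at h2
      refine h1.trans ?_
      gcongr
    have e3 : (M : ℝ) ^ (c / 2) * (M : ℝ) ^ (k * (3 / 2 + s)) ≤ P := by
      rw [← Real.rpow_add hM0]
      refine Real.rpow_le_rpow_of_exponent_le hM1 ?_
      rw [hk, hs]
      -- After clearing denominators the inequality is `(c - 1)(24c - 22) ≥ 0`.
      nlinarith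
    calc K * (B * (K : ℝ) ^ (1 / 2 + s)) = B * (K * (K : ℝ) ^ (1 / 2 + s)) := by ring
      _ ≤ B * (9 * (M : ℝ) ^ (k * (3 / 2 + s))) := by rw [e1]; gcongr
      _ = 27 * C₀ * ((M : ℝ) ^ (c / 2) * (M : ℝ) ^ (k * (3 / 2 + s))) := by rw [hB]; ring
      _ ≤ 27 * C₀ * P := by gcongr
  have hMK : M / K ≤ P := by
    rw [div_le_iff₀ hK0]
    calc (M : ℝ) = P * (M : ℝ) ^ k := by
          rw [hP, ← Real.rpow_add hM0, hk, ← Real.rpow_one M, ← Real.rpow_mul hM0.le]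
          ring_nf
      _ ≤ P * K := by gcongr
  -- sums weighted by tents, with the minor arc phase
  have htent : ∀ u : ℝ, ‖∑ i ∈ t, unitPhase (α * x i + η * ((i : ℝ) + 1)) *
      (periodicTent K (x i - u) : ℂ)‖ ≤
      Y / K + (2 * B * (K : ℝ) ^ (1 / 2 + s) * ζ + 2 * Y / K) := by
    intro u
    have h := norm_sum_mul_periodicTent_le_of_sqrt t
      (fun i => unitPhase (α * x i + η * ((i : ℝ) + 1))) x hK2 u (B := B) hY0 hs0 hs1 ?_ ?_ hB0
    · refine h.trans ?_
      have := hsmall α η (by rwa [abs_of_pos hα0']) (by rwa [abs_of_pos hα0'])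
      gcongr
    · intro n hn
      have hn1 : (1 : ℝ) ≤ n := by exact_mod_cast hn
      have h1 := hbig (α + n) η n (by rw [abs_of_pos (by linarith)]; linarith)
        (by rw [abs_of_pos (by linarith)]; linarith)
      have h2 : (0 : ℝ) ≤ if n = 1 then Y else 0 := by split_ifs <;> simp [hY0]
      refine le_trans (le_of_eq ?_) (h1.trans (le_add_of_nonneg_right h2))
      refine congrArg _ (Finset.sum_congr rfl fun i _ => ?_)
      rw [← unitPhase_add]; ring_nf
    · intro n hn
      have hn1 : (1 : ℝ) ≤ n := by exact_mod_cast hn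
      have e : ∑ i ∈ t, unitPhase (α * x i + η * ((i : ℝ) + 1)) * unitPhase (-(n * x i)) =
          ∑ i ∈ t, unitPhase ((α - n) * x i + η * ((i : ℝ) + 1)) := by
        refine Finset.sum_congr rfl fun i _ => ?_
        rw [← unitPhase_add]; ring_nf
      rw [e]
      -- For `n = 1` the frequency `α - 1` lies in the range of `hsmall`; for `n ≥ 2` one has `|α -
      -- n| ≥ 1`.
      split_ifs with h1
      · subst h1
        have h2 := hsmall (α - (1 : ℕ)) η (by
            rw [abs_of_neg (by push_cast; linarith)]; push_cast; linarith)
          (by rw [abs_of_neg (by push_cast; linarith)]; push_cast; linarith)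
        exact h2.trans (le_add_of_nonneg_left (by positivity))
      · have hn2 : (2 : ℝ) ≤ n := by
          have : 2 ≤ n := by omega
          exact_mod_cast this
        rw [add_zero]
        exact hbig (α - n) η n (by rw [abs_of_neg (by linarith)]; linarith)
          (by rw [abs_of_neg (by linarith)]; linarith)
  -- the number of fractional parts close to an integer
  have hcount : ∑ i ∈ t, periodicTent K (x i) ≤ M / K + 2 * B * (K : ℝ) ^ (1 / 2 + s) * ζ := by
    have h := norm_sum_mul_periodicTent_le_of_sqrt t (fun _ => (1 : ℂ)) x hK2 0 (B := B) le_rfl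
      hs0 hs1 ?_ ?_ hB0
    · simp only [one_mul, sub_zero, mul_zero, zero_div, add_zero] at h
      rw [← Complex.ofReal_sum, Complex.norm_real,
        Real.norm_of_nonneg (Finset.sum_nonneg fun i _ => periodicTent_nonneg _ _)] at h
      refine h.trans ?_
      simp [ht]
      rfl
    · intro n hn
      have hn1 : (1 : ℝ) ≤ n := by exact_mod_cast hn
      have h1 := hbig n 0 n (by rwa [abs_of_pos (by linarith)])
        (by rw [abs_of_pos (by linarith)]; linarith)
      simpa using h1
    · intro n hn
      have hn1 : (1 : ℝ) ≤ n := by exact_mod_cast hn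
      have h1 := hbig (-n) 0 n (by rwa [abs_neg, abs_of_pos (by linarith)])
        (by rw [abs_neg, abs_of_pos (by linarith)]; linarith)
      simpa using h1
  have hid : ∑ n ∈ t, unitPhase (α * (⌊((n : ℝ) + 1) ^ c⌋ : ℝ) + η * ((n : ℝ) + 1)) =
      ∑ i ∈ t, unitPhase (α * x i + η * ((i : ℝ) + 1)) * (unitPhase (-(α * Int.fract (x i))) -
        ∑ j ∈ Finset.range K, unitPhase (-(α * (j / K))) * (periodicTent K (x i - j / K) : ℂ)) +
      ∑ j ∈ Finset.range K, unitPhase (-(α * (j / K))) * ∑ i ∈ t,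
        unitPhase (α * x i + η * ((i : ℝ) + 1)) * (periodicTent K (x i - j / K) : ℂ) := by
    simp only [mul_sub, Finset.sum_sub_distrib, Finset.mul_sum]
    rw [Finset.sum_comm (s := Finset.range K)]
    have : ∀ i ∈ t, ∀ j ∈ Finset.range K, unitPhase (-(α * (j / K))) *
        (unitPhase (α * x i + η * ((i : ℝ) + 1)) * (periodicTent K (x i - j / K) : ℂ)) =
        unitPhase (α * x i + η * ((i : ℝ) + 1)) *
        (unitPhase (-(α * (j / K))) * (periodicTent K (x i - j / K) : ℂ)) := fun i _ j _ => by ring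
    rw [Finset.sum_congr rfl fun i hi => Finset.sum_congr rfl (this i hi), sub_add_cancel]
    refine Finset.sum_congr rfl fun i _ => ?_
    rw [← unitPhase_add]
    congr 1
    have := Int.self_sub_floor (x i)
    rw [← this]
    ring
  rw [hid]
  have hA : ‖∑ i ∈ t, unitPhase (α * x i + η * ((i : ℝ) + 1)) * (unitPhase (-(α * Int.fract (x i))) -
        ∑ j ∈ Finset.range K, unitPhase (-(α * (j / K))) * (periodicTent K (x i - j / K) : ℂ))‖ ≤
      7 * (M / K) + 2 * (M / K + 2 * B * (K : ℝ) ^ (1 / 2 + s) * ζ) := by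
    have h1 : ∀ i ∈ t, ‖unitPhase (α * x i + η * ((i : ℝ) + 1)) * (unitPhase (-(α * Int.fract (x i))) -
        ∑ j ∈ Finset.range K, unitPhase (-(α * (j / K))) * (periodicTent K (x i - j / K) : ℂ))‖ ≤
        7 / K + 2 * periodicTent K (x i) := by
      intro i _
      rw [norm_mul, norm_unitPhase, one_mul]
      exact norm_unitPhase_fract_sub_le hK2 hα0'.le hα1' (x i)
    refine (norm_sum_le_of_le t h1).trans ?_
    rw [Finset.sum_add_distrib, ← Finset.mul_sum, Finset.sum_const, ht, Finset.card_range,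
      nsmul_eq_mul]
    have : (M : ℝ) * (7 / K) = 7 * (M / K) := by ring
    rw [this]
    gcongr
  have hBound : ‖∑ j ∈ Finset.range K, unitPhase (-(α * (j / K))) * ∑ i ∈ t,
        unitPhase (α * x i + η * ((i : ℝ) + 1)) * (periodicTent K (x i - j / K) : ℂ)‖ ≤
      K * (Y / K + (2 * B * (K : ℝ) ^ (1 / 2 + s) * ζ + 2 * Y / K)) := by
    refine (norm_sum_le_of_le (n := fun _ => Y / K + (2 * B * (K : ℝ) ^ (1 / 2 + s) * ζ + 2 * Y / K))
      _ (fun j _ => ?_)).trans (le_of_eq ?_)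
    · rw [norm_mul, norm_unitPhase, one_mul]
      exact htent _
    · rw [Finset.sum_const, Finset.card_range, nsmul_eq_mul]
  refine (norm_add_le _ _).trans ((add_le_add hA hBound).trans ?_)
  have h1 : B * (K : ℝ) ^ (1 / 2 + s) ≤ 27 * C₀ * P := by
    refine le_trans ?_ hKpow
    refine le_mul_of_one_le_left (by positivity) ?_
    linarith
  have h2 : K * (Y / K + (2 * B * (K : ℝ) ^ (1 / 2 + s) * ζ + 2 * Y / K)) =
      3 * Y + 2 * (K * (B * (K : ℝ) ^ (1 / 2 + s))) * ζ := by
    field_simp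
    ring
  rw [h2]
  have h3 := mul_le_mul_of_nonneg_right h1 hζ0
  have h4 := mul_le_mul_of_nonneg_right hKpow hζ0
  have h5 : 0 ≤ C₀ * P * ζ := by positivity
  have h6 : 0 ≤ C₀ * P := by positivity
  rw [hY]
  nlinarith

/-! ### Exponential sums over `|m| ≤ M` -/

/-- The exponential sum `∑ e(α ⌊|m| ^ c⌋ + η m)` over `|m| ≤ M`. -/
noncomputable def floorSum (c : ℝ) (M : ℕ) (η α : ℝ) : ℂ :=
  ∑ m ∈ Finset.Icc (-(M : ℤ)) M, unitPhase (α * (⌊|(m : ℝ)| ^ c⌋ : ℝ) + η * m)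

theorem sum_Icc_neg_eq {E : Type*} [AddCommMonoid E] (f : ℤ → E) (M : ℕ) :
    ∑ m ∈ Finset.Icc (-(M : ℤ)) M, f m =
      f 0 + (∑ n ∈ Finset.range M, f (n + 1) + ∑ n ∈ Finset.range M, f (-(n + 1))) := by
  induction M with
  | zero => simp
  | succ M ih =>
    have : Finset.Icc (-((M + 1 : ℕ) : ℤ)) ((M + 1 : ℕ) : ℤ) =
        insert ((M : ℤ) + 1) (insert (-((M : ℤ) + 1)) (Finset.Icc (-(M : ℤ)) M)) := by
      ext m
      simp only [Finset.mem_insert, Finset.mem_Icc]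
      push_cast
      omega
    rw [this, Finset.sum_insert, Finset.sum_insert, ih, Finset.sum_range_succ, Finset.sum_range_succ]
    · abel
    · simp only [Finset.mem_Icc]; omega
    · simp only [Finset.mem_insert, Finset.mem_Icc]; omega

theorem norm_floorSum_le (c : ℝ) (M : ℕ) (η α : ℝ) :
    ‖floorSum c M η α‖ ≤ 1 +
      (‖∑ n ∈ Finset.range M, unitPhase (α * (⌊((n : ℝ) + 1) ^ c⌋ : ℝ) + η * ((n : ℝ) + 1))‖ +
      ‖∑ n ∈ Finset.range M, unitPhase (α * (⌊((n : ℝ) + 1) ^ c⌋ : ℝ) + (-η) * ((n : ℝ) + 1))‖) := by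
  rw [floorSum, sum_Icc_neg_eq]
  have h1 : ∀ n : ℕ, |(((n : ℤ) + 1 : ℤ) : ℝ)| = n + 1 := by
    intro n
    push_cast
    exact abs_of_nonneg (by positivity)
  have h2 : ∀ n : ℕ, |((-((n : ℤ) + 1) : ℤ) : ℝ)| = n + 1 := by
    intro n
    rw [Int.cast_neg, abs_neg, h1]
  refine (norm_add_le _ _).trans (add_le_add ?_ ((norm_add_le _ _).trans (le_of_eq ?_)))
  · rw [norm_unitPhase]
  · simp only [h1, h2]
    push_cast
    simp only [mul_neg, neg_mul]

theorem norm_floorSum_le_card (c : ℝ) (M : ℕ) (η α : ℝ) : ‖floorSum c M η α‖ ≤ 2 * M + 1 := by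
  refine (norm_sum_le _ _).trans ?_
  simp only [norm_unitPhase, Finset.sum_const, Int.card_Icc, nsmul_eq_mul, mul_one]
  have : ((M : ℤ) + 1 - -(M : ℤ)).toNat = 2 * M + 1 := by omega
  rw [this]
  push_cast
  exact le_rfl

/-- On the minor arcs the sum itself is small. Within `M ^ (-3/5)` of an integer the second factor
is `O(M ^ (1/5 - 3/5))`, and the trivial bound `O(M)` for the sum gives `O(M ^ (3/5))`. -/
theorem exists_norm_floorSum_mul_le {c : ℝ} (hc : 1 < c) (hc2 : c < 9 / 8) :
    ∃ C : ℝ, 0 < C ∧ ∀ M : ℕ, 0 < M → ∀ α η : ℝ, 0 ≤ α → α ≤ 1 → ∀ j : ℕ,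
      (j : ℝ) ≤ 2 * (M : ℝ) ^ (1 / 5 : ℝ) →
      ‖floorSum c M η α‖ * ‖unitPhase (j * α) - 1‖ ≤ C * (M : ℝ) ^ ((1 + 3 * c) / 5) := by
  obtain ⟨C, hC, h⟩ := exists_norm_sum_unitPhase_floor_le hc hc2
  refine ⟨4 * C + 44, by positivity, ?_⟩
  intro M hM α η h0 h1 j hj
  have hM1 : (1 : ℝ) ≤ M := by exact_mod_cast hM
  have hM0 : (0 : ℝ) < M := by linarith
  set P : ℝ := (M : ℝ) ^ ((1 + 3 * c) / 5) with hP
  have hP1 : 1 ≤ P := Real.one_le_rpow hM1 (by linarith)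
  have hmajor : ∀ β : ℝ, |β| ≤ (M : ℝ) ^ (-(3 / 5) : ℝ) →
      ‖floorSum c M η α‖ * ‖unitPhase (j * β) - 1‖ ≤ 44 * P := by
    intro β hβ
    have h2 := norm_unitPhase_sub_le (j * β) 0
    rw [unitPhase_zero, sub_zero, abs_mul, Nat.abs_cast] at h2
    have h3 : ‖unitPhase (j * β) - 1‖ ≤ 14 * ((M : ℝ) ^ (1 / 5 : ℝ) * (M : ℝ) ^ (-(3 / 5) : ℝ)) := by
      have hpi := Real.pi_lt_d2
      have hpi0 := Real.pi_pos
      calc _ ≤ _ := h2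
        _ ≤ 2 * 3.15 * ((2 * (M : ℝ) ^ (1 / 5 : ℝ)) * (M : ℝ) ^ (-(3 / 5) : ℝ)) := by gcongr
        _ ≤ _ := by
          have : 0 ≤ (M : ℝ) ^ (1 / 5 : ℝ) * (M : ℝ) ^ (-(3 / 5) : ℝ) := by positivity
          linarith
    have h4 : ‖floorSum c M η α‖ ≤ 3 * M := (norm_floorSum_le_card c M η α).trans (by linarith)
    calc _ ≤ 3 * M * (14 * ((M : ℝ) ^ (1 / 5 : ℝ) * (M : ℝ) ^ (-(3 / 5) : ℝ))) := by gcongr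
      _ = 42 * (M : ℝ) ^ (3 / 5 : ℝ) := by
        rw [show (3 / 5 : ℝ) = 1 + (1 / 5 + -(3 / 5)) by norm_num, Real.rpow_add hM0,
          Real.rpow_add hM0, Real.rpow_one]
        norm_num
        ring
      _ ≤ 42 * P := by
        gcongr
        exact Real.rpow_le_rpow_of_exponent_le hM1 (by linarith)
      _ ≤ 44 * P := by linarith
  rcases le_or_gt α ((M : ℝ) ^ (-(3 / 5) : ℝ)) with h2 | h2
  · refine (hmajor α (by rwa [abs_of_nonneg h0])).trans ?_
    have : 0 ≤ C * P := by positivity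
    linarith
  rcases le_or_gt α (1 - (M : ℝ) ^ (-(3 / 5) : ℝ)) with h3 | h3
  · have h4 : ‖unitPhase (j * α) - 1‖ ≤ 2 := by
      have := norm_unitPhase_sub_le_two (j * α) 0
      rwa [unitPhase_zero] at this
    have h5 : ‖floorSum c M η α‖ ≤ 1 + (C * P + C * P) :=
      (norm_floorSum_le c M η α).trans
        (add_le_add le_rfl (add_le_add (h M hM α η h2.le h3) (h M hM α (-η) h2.le h3)))
    calc _ ≤ (1 + (C * P + C * P)) * 2 := by gcongr
      _ ≤ _ := by nlinarith
  -- Near `α = 1` the second factor is unchanged when `α` is replaced by `α - 1`.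
  · have h4 := hmajor (α - 1) (by rw [abs_of_nonpos (by linarith)]; linarith)
    rw [show (j : ℝ) * (α - 1) = j * α + ((-j : ℤ) : ℝ) by push_cast; ring, unitPhase_add,
      unitPhase_intCast, mul_one] at h4
    refine h4.trans ?_
    have : 0 ≤ C * P := by positivity
    linarith

/-- For `c ≥ 1`, superadditivity gives `(m + 1) ^ c ≥ m ^ c + 1`, so the integer parts strictly
increase. -/
theorem floor_rpow_injOn {c : ℝ} (hc : 1 ≤ c) {m n : ℕ} (h : ⌊(m : ℝ) ^ c⌋ = ⌊(n : ℝ) ^ c⌋) :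
    m = n := by
  have key : ∀ m n : ℕ, m < n → ⌊(m : ℝ) ^ c⌋ < ⌊(n : ℝ) ^ c⌋ := by
    intro m n hmn
    have h1 : (m : ℝ) ^ c + 1 ≤ (n : ℝ) ^ c := by
      have h2 := Real.add_rpow_le_rpow_add (show (0 : ℝ) ≤ m by positivity) zero_le_one hc
      rw [Real.one_rpow] at h2
      refine h2.trans ?_
      gcongr
      exact_mod_cast hmn
    have h3 := Int.floor_le_floor h1
    rw [Int.floor_add_one] at h3
    omega
  rcases lt_trichotomy m n with h1 | h1 | h1
  · exact absurd h (key _ _ h1).ne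
  · exact h1
  · exact absurd h (key _ _ h1).ne'

theorem natAbs_eq_of_floor_abs_rpow_eq {c : ℝ} (hc : 1 ≤ c) {m n : ℤ}
    (h : ⌊|(m : ℝ)| ^ c⌋ = ⌊|(n : ℝ)| ^ c⌋) : m.natAbs = n.natAbs := by
  refine floor_rpow_injOn hc ?_
  rwa [Nat.cast_natAbs, Nat.cast_natAbs, Int.cast_abs, Int.cast_abs]

theorem integral_unitPhase_intCast_mul (k : ℤ) :
    ∫ α in (0 : ℝ)..1, unitPhase (k * α) = if k = 0 then 1 else 0 := by
  split_ifs with h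
  · simp [h]
  · have hk : (Complex.I * (2 * Real.pi * k)) ≠ 0 := by
      have : (k : ℂ) ≠ 0 := by exact_mod_cast h
      have := Complex.ofReal_ne_zero.2 Real.pi_ne_zero
      simp [Complex.I_ne_zero, *]
    have h1 : ∀ α : ℝ, unitPhase (k * α) = Complex.exp ((Complex.I * (2 * Real.pi * k)) * α) := by
      intro α
      rw [unitPhase]
      congr 1
      push_cast
      ring
    simp only [h1]
    rw [integral_exp_mul_complex hk]
    have h2 := unitPhase_intCast k
    rw [← mul_one (k : ℝ), h1] at h2
    rw [h2]
    simp

theorem continuous_floorSum (c : ℝ) (M : ℕ) (η : ℝ) : Continuous (floorSum c M η) := by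
  unfold floorSum
  refine continuous_finsetSum _ fun m _ => continuous_unitPhase.comp ?_
  fun_prop

/-- Parseval: only pairs with `⌊|m| ^ c⌋ = ⌊|n| ^ c⌋` survive, and these have `n = m` or `n = -m`.
-/
theorem integral_norm_floorSum_sq_le {c : ℝ} (hc : 1 ≤ c) (M : ℕ) (η : ℝ) :
    ∫ α in (0 : ℝ)..1, ‖floorSum c M η α‖ ^ 2 ≤ 2 * (2 * M + 1) := by
  set b := Finset.Icc (-(M : ℤ)) M with hb
  set v : ℤ → ℤ := fun m => ⌊|(m : ℝ)| ^ c⌋ with hv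
  have h1 : ∀ α : ℝ, ((‖floorSum c M η α‖ ^ 2 : ℝ) : ℂ) =
      ∑ m ∈ b, ∑ n ∈ b, unitPhase (η * m + -(η * n)) * unitPhase (((v m - v n : ℤ) : ℝ) * α) := by
    intro α
    rw [Complex.ofReal_pow, ← Complex.mul_conj', floorSum, map_sum, Finset.sum_mul_sum]
    refine Finset.sum_congr rfl fun m _ => Finset.sum_congr rfl fun n _ => ?_
    rw [← unitPhase_neg, ← unitPhase_add, ← unitPhase_add]
    congr 1
    push_cast
    ring
  have h2 : ((∫ α in (0 : ℝ)..1, ‖floorSum c M η α‖ ^ 2 : ℝ) : ℂ) =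
      ∑ m ∈ b, ∑ n ∈ b, unitPhase (η * m + -(η * n)) * (if v m - v n = 0 then 1 else 0) := by
    have hcont : ∀ k : ℤ, Continuous fun α : ℝ => unitPhase (k * α) := fun k =>
      continuous_unitPhase.comp (by fun_prop)
    rw [← intervalIntegral.integral_ofReal]
    simp only [h1]
    rw [intervalIntegral.integral_finsetSum]
    · refine Finset.sum_congr rfl fun m _ => ?_
      rw [intervalIntegral.integral_finsetSum]
      · refine Finset.sum_congr rfl fun n _ => ?_
        rw [intervalIntegral.integral_const_mul, integral_unitPhase_intCast_mul]
      · intro n _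
        exact ((hcont _).const_mul _).intervalIntegrable _ _
    · intro m _
      exact (continuous_finsetSum _ fun n _ => (hcont _).const_mul _).intervalIntegrable _ _
  have h3 : ∀ m ∈ b, ‖∑ n ∈ b, unitPhase (η * m + -(η * n)) * (if v m - v n = 0 then 1 else 0)‖ ≤ 2 := by
    intro m _
    have h4 : ∀ n ∈ b, ‖unitPhase (η * m + -(η * n)) * (if v m - v n = 0 then 1 else 0)‖ ≤
        if n ∈ ({m, -m} : Finset ℤ) then 1 else 0 := by
      intro n _
      rw [norm_mul, norm_unitPhase, one_mul]
      by_cases h : v m - v n = 0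
      · have h5 := natAbs_eq_of_floor_abs_rpow_eq hc (show v m = v n by omega)
        have h6 : n ∈ ({m, -m} : Finset ℤ) := by
          simp only [Finset.mem_insert, Finset.mem_singleton]
          omega
        simp [h, h6]
      · rw [if_neg h, norm_zero]
        split_ifs <;> norm_num
    refine (norm_sum_le_of_le b h4).trans ?_
    rw [← Finset.sum_filter, Finset.sum_const, nsmul_eq_mul, mul_one]
    have h5 : (b.filter (fun n => n ∈ ({m, -m} : Finset ℤ))).card ≤ 2 :=
      (Finset.card_le_card (fun n hn => (Finset.mem_filter.1 hn).2)).trans Finset.card_le_two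
    exact_mod_cast h5
  have h4 : ‖((∫ α in (0 : ℝ)..1, ‖floorSum c M η α‖ ^ 2 : ℝ) : ℂ)‖ ≤ 2 * (2 * M + 1) := by
    rw [h2]
    refine (norm_sum_le_of_le b h3).trans (le_of_eq ?_)
    rw [Finset.sum_const, hb, Int.card_Icc, nsmul_eq_mul,
      show ((M : ℤ) + 1 - -(M : ℤ)).toNat = 2 * M + 1 by omega]
    push_cast
    ring
  rw [Complex.norm_real] at h4
  exact (le_abs_self _).trans h4

/-! ### Weighted sums over arithmetic spheres -/

/-- The cube `{m ∈ ℤ³ : |m_i| ≤ M}`. -/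
noncomputable def intCube (M : ℕ) : Finset (Fin 3 → ℤ) := Fintype.piFinset fun _ => Finset.Icc (-(M : ℤ)) M

/-- The sum of `w` over the points of the arithmetic sphere in the cube of side `2M`. -/
noncomputable def sphereSum {E : Type*} [AddCommMonoid E] (c : ℝ) (M : ℕ) (w : (Fin 3 → ℤ) → E)
    (lam : ℤ) : E :=
  ∑ m ∈ (intCube M).filter (fun m => ∑ i, ⌊|(m i : ℝ)| ^ c⌋ = lam), w m

/-- The circle method identity: orthogonality of characters detects the equation of the sphere, and
a linear phase factors over the coordinates. -/
theorem sphereSum_unitPhase_eq_integral (c : ℝ) (M : ℕ) (η : Fin 3 → ℝ) (lam : ℤ) :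
    sphereSum c M (fun m => unitPhase (∑ i, η i * m i)) lam =
      ∫ α in (0 : ℝ)..1, (∏ i, floorSum c M (η i) α) * unitPhase (-(lam * α)) := by
  have h1 : ∀ α : ℝ, (∏ i, floorSum c M (η i) α) * unitPhase (-(lam * α)) =
      ∑ m ∈ intCube M, unitPhase (∑ i, η i * m i) *
        unitPhase (((∑ i, ⌊|(m i : ℝ)| ^ c⌋ - lam : ℤ) : ℝ) * α) := by
    intro α
    simp only [floorSum]
    rw [Finset.prod_univ_sum, Finset.sum_mul]
    refine Finset.sum_congr rfl fun m _ => ?_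
    simp only [Fin.prod_univ_three, Fin.sum_univ_three]
    rw [← unitPhase_add, ← unitPhase_add, ← unitPhase_add, ← unitPhase_add]
    congr 1
    push_cast
    ring
  simp only [h1]
  rw [intervalIntegral.integral_finsetSum]
  · rw [sphereSum, Finset.sum_filter]
    refine Finset.sum_congr rfl fun m _ => ?_
    rw [intervalIntegral.integral_const_mul, integral_unitPhase_intCast_mul]
    simp only [sub_eq_zero, mul_ite, mul_one, mul_zero]
  · intro m _
    exact ((continuous_unitPhase.comp (by fun_prop)).const_mul _).intervalIntegrable _ _

/-- Weighted counts on nearby arithmetic spheres are close to each other. -/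
theorem exists_norm_sphereSum_unitPhase_sub_le {c : ℝ} (hc : 1 < c) (hc2 : c < 9 / 8) :
    ∃ C : ℝ, 0 < C ∧ ∀ M : ℕ, 0 < M → ∀ (η : Fin 3 → ℝ) (lam : ℤ) (j : ℕ),
      (j : ℝ) ≤ 2 * (M : ℝ) ^ (1 / 5 : ℝ) →
      ‖sphereSum c M (fun m => unitPhase (∑ i, η i * m i)) (lam + j) -
        sphereSum c M (fun m => unitPhase (∑ i, η i * m i)) lam‖ ≤
        C * (M : ℝ) ^ ((6 + 3 * c) / 5) := by
  obtain ⟨C, hC, h⟩ := exists_norm_floorSum_mul_le hc hc2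
  refine ⟨6 * C, by positivity, ?_⟩
  intro M hM η lam j hj
  have hM1 : (1 : ℝ) ≤ M := by exact_mod_cast hM
  have hM0 : (0 : ℝ) < M := by linarith
  set P : ℝ := (M : ℝ) ^ ((1 + 3 * c) / 5) with hP
  have hcont : ∀ l : ℤ, IntervalIntegrable
      (fun α : ℝ => (∏ i, floorSum c M (η i) α) * unitPhase (-(l * α))) volume 0 1 := by
    intro l
    refine Continuous.intervalIntegrable (Continuous.mul ?_ (continuous_unitPhase.comp (by fun_prop))) _ _
    exact continuous_finsetProd _ fun i _ => continuous_floorSum c M (η i)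
  have hsq : ∀ i, IntervalIntegrable (fun α : ℝ => ‖floorSum c M (η i) α‖ ^ 2) volume 0 1 := fun i =>
    ((continuous_floorSum c M (η i)).norm.pow 2).intervalIntegrable _ _
  rw [sphereSum_unitPhase_eq_integral, sphereSum_unitPhase_eq_integral,
    ← intervalIntegral.integral_sub (hcont _) (hcont _)]
  -- One sum is paired with the difference of characters and bounded uniformly; the product of the
  -- other two is split into squares for the mean value estimate.
  have hb : ∀ α ∈ Ioc (0 : ℝ) 1, ‖(∏ i, floorSum c M (η i) α) * unitPhase (-(((lam + j : ℤ) : ℝ) * α)) -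
      (∏ i, floorSum c M (η i) α) * unitPhase (-(lam * α))‖ ≤
      C * P / 2 * (‖floorSum c M (η 1) α‖ ^ 2 + ‖floorSum c M (η 2) α‖ ^ 2) := by
    intro α hα
    rw [← mul_sub, norm_mul, norm_prod, Fin.prod_univ_three]
    have h1 : ‖unitPhase (-(((lam + j : ℤ) : ℝ) * α)) - unitPhase (-(lam * α))‖ =
        ‖unitPhase (j * α) - 1‖ := by
      rw [← unitPhase_zero, norm_unitPhase_sub, norm_unitPhase_sub, ← abs_neg, ← Real.sin_neg]
      congr 3
      push_cast
      ring
    rw [h1]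
    have h2 := h M hM α (η 0) hα.1.le hα.2 j hj
    have h3 : ‖floorSum c M (η 1) α‖ * ‖floorSum c M (η 2) α‖ ≤
        (‖floorSum c M (η 1) α‖ ^ 2 + ‖floorSum c M (η 2) α‖ ^ 2) / 2 := by
      nlinarith [sq_nonneg (‖floorSum c M (η 1) α‖ - ‖floorSum c M (η 2) α‖)]
    calc _ = (‖floorSum c M (η 0) α‖ * ‖unitPhase (j * α) - 1‖) *
          (‖floorSum c M (η 1) α‖ * ‖floorSum c M (η 2) α‖) := by ring
      _ ≤ (C * P) * ((‖floorSum c M (η 1) α‖ ^ 2 + ‖floorSum c M (η 2) α‖ ^ 2) / 2) := by gcongr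
      _ = _ := by ring
  have h1 := intervalIntegral.norm_integral_le_of_norm_le (zero_le_one)
    (Filter.Eventually.of_forall hb) (((hsq 1).add (hsq 2)).const_mul _)
  refine h1.trans ?_
  rw [intervalIntegral.integral_const_mul, intervalIntegral.integral_add (hsq 1) (hsq 2)]
  have h2 := integral_norm_floorSum_sq_le hc.le M (η 1)
  have h3 := integral_norm_floorSum_sq_le hc.le M (η 2)
  have h4 : (M : ℝ) ^ ((6 + 3 * c) / 5) = P * M := by
    rw [hP, ← Real.rpow_add_one hM0.ne']
    ring_nf
  rw [h4]
  have hCP : 0 ≤ C * P / 2 := by positivity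
  calc _ ≤ C * P / 2 * (2 * (2 * M + 1) + 2 * (2 * M + 1)) := by gcongr
    _ ≤ C * P / 2 * (12 * M) := by gcongr; linarith
    _ = _ := by ring

/-! ### Ramps and their cosine series -/

/-- The triangle wave: subtracting from the `B₂` series its translate by half a period cancels the
quadratic terms. -/
theorem hasSum_abs {x : ℝ} (hx : |x| ≤ 1 / 2) :
    HasSum (fun n : ℕ => (1 - (-1) ^ n) * Real.cos (2 * Real.pi * n * x) / (n : ℝ) ^ 2)
      (Real.pi ^ 2 * (1 / 4 - |x|)) := by
  have h1 := hasSum_cos_div_sq (abs_nonneg x) (by linarith)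
  have h2 := hasSum_cos_div_sq (x := |x| + 1 / 2) (by positivity) (by linarith)
  convert! h1.sub h2 using 1
  · ext n
    have h3 : Real.cos (2 * Real.pi * n * |x|) = Real.cos (2 * Real.pi * n * x) := by
      rw [← Real.cos_abs (2 * Real.pi * n * x), abs_mul,
        abs_of_nonneg (show 0 ≤ 2 * Real.pi * n by have := Real.pi_pos; positivity)]
    rw [show 2 * Real.pi * n * (|x| + 1 / 2) = 2 * Real.pi * n * |x| + n * Real.pi by ring,
      Real.cos_add_nat_mul_pi, h3]
    ring
  · ring

/-- The piecewise linear function which is `0` on `(-∞, -δ]` and `1` on `[0, ∞)`. -/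
noncomputable def ramp (δ x : ℝ) : ℝ := 1 / 2 + (|x + δ| - |x|) / (2 * δ)

theorem ramp_of_nonneg {δ x : ℝ} (hδ : 0 < δ) (hx : 0 ≤ x) : ramp δ x = 1 := by
  rw [ramp, abs_of_nonneg hx, abs_of_nonneg (by linarith)]
  field_simp
  ring

theorem ramp_of_le {δ x : ℝ} (hδ : 0 < δ) (hx : x ≤ -δ) : ramp δ x = 0 := by
  rw [ramp, abs_of_nonpos (by linarith), abs_of_nonpos (by linarith)]
  field_simp
  ring

theorem ramp_nonneg {δ : ℝ} (hδ : 0 < δ) (x : ℝ) : 0 ≤ ramp δ x := by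
  have h := abs_sub_abs_le_abs_sub x (x + δ)
  rw [sub_add_cancel_left, abs_neg, abs_of_pos hδ] at h
  have : -1 / 2 ≤ (|x + δ| - |x|) / (2 * δ) := by
    rw [le_div_iff₀ (by positivity)]
    linarith
  rw [ramp]
  linarith

theorem ramp_le_one {δ : ℝ} (hδ : 0 < δ) (x : ℝ) : ramp δ x ≤ 1 := by
  have h := abs_sub_abs_le_abs_sub (x + δ) x
  rw [add_sub_cancel_left, abs_of_pos hδ] at h
  have : (|x + δ| - |x|) / (2 * δ) ≤ 1 / 2 := by
    rw [div_le_iff₀ (by positivity)]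
    linarith
  rw [ramp]
  linarith

theorem hasSum_ramp {δ x : ℝ} (hδ : 0 < δ) (hδ1 : δ ≤ 1 / 4) (hx : |x| ≤ 1 / 4) :
    HasSum (fun n : ℕ => 1 / (2 * δ * Real.pi ^ 2) * ((1 - (-1) ^ n) / (n : ℝ) ^ 2 *
      (Real.cos (2 * Real.pi * n * x) - Real.cos (2 * Real.pi * n * (x + δ))))) (ramp δ x - 1 / 2) := by
  have h1 := hasSum_abs (x := x) (by linarith)
  have h2 := hasSum_abs (x := x + δ) (by
    refine (abs_add_le _ _).trans ?_
    rw [abs_of_pos hδ]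
    linarith)
  convert! (h1.sub h2).mul_left (1 / (2 * δ * Real.pi ^ 2)) using 1
  · ext n
    ring
  · have := Real.pi_pos
    rw [ramp]
    field_simp
    ring

/-- Interpolation between `1 / n` and `1 / (δ n ^ 2)`. The result is absolutely summable in `n` at
the small cost `δ ^ (-ε)`. -/
theorem ramp_coeff_le {δ ε : ℝ} (hδ : 0 < δ) (h0 : 0 ≤ ε) (h1 : ε ≤ 1) (n : ℕ) :
    1 / (2 * δ * Real.pi ^ 2) * (|1 - (-1 : ℝ) ^ n| / (n : ℝ) ^ 2 * ‖1 - unitPhase (n * δ)‖) ≤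
      δ ^ (-ε) * (n : ℝ) ^ (-1 - ε) := by
  rcases Nat.eq_zero_or_pos n with rfl | hn
  · simp
    positivity
  have hn0 : (0 : ℝ) < n := by exact_mod_cast hn
  have hpi := Real.pi_gt_three
  have hsign : |1 - (-1 : ℝ) ^ n| ≤ 2 := by
    rcases neg_one_pow_eq_or ℝ n with h | h <;> rw [h] <;> norm_num
  have hA : ‖1 - unitPhase (n * δ)‖ ≤ 2 := by
    have := norm_unitPhase_sub_le_two 0 (n * δ)
    rwa [unitPhase_zero] at this
  have hB : ‖1 - unitPhase (n * δ)‖ ≤ 2 * Real.pi * (n * δ) := by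
    have := norm_unitPhase_sub_le 0 (n * δ)
    rwa [unitPhase_zero, zero_sub, abs_neg, abs_of_pos (by positivity)] at this
  have ha : 1 / (2 * δ * Real.pi ^ 2) * (|1 - (-1 : ℝ) ^ n| / (n : ℝ) ^ 2 * ‖1 - unitPhase (n * δ)‖) ≤
      1 / n := by
    calc _ ≤ 1 / (2 * δ * Real.pi ^ 2) * (2 / (n : ℝ) ^ 2 * (2 * Real.pi * (n * δ))) := by gcongr
      _ = 2 / Real.pi / n := by field_simp
      _ ≤ 1 / n := by
        gcongr
        rw [div_le_one (by linarith)]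
        linarith
  have hb : 1 / (2 * δ * Real.pi ^ 2) * (|1 - (-1 : ℝ) ^ n| / (n : ℝ) ^ 2 * ‖1 - unitPhase (n * δ)‖) ≤
      1 / (δ * (n : ℝ) ^ 2) := by
    calc _ ≤ 1 / (2 * δ * Real.pi ^ 2) * (2 / (n : ℝ) ^ 2 * 2) := by gcongr
      _ = 2 / Real.pi ^ 2 * (1 / (δ * (n : ℝ) ^ 2)) := by field_simp
      _ ≤ 1 * (1 / (δ * (n : ℝ) ^ 2)) := by
        gcongr
        rw [div_le_one (by positivity)]
        nlinarith
      _ = _ := one_mul _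
  refine (le_rpow_mul_rpow_of_le (by positivity) ha hb h0 h1).trans (le_of_eq ?_)
  rw [one_div, one_div, Real.inv_rpow hn0.le, Real.inv_rpow (by positivity),
    Real.mul_rpow hδ.le (by positivity), ← Real.rpow_natCast, ← Real.rpow_mul hn0.le,
    Real.rpow_neg hδ.le, mul_inv, mul_comm, mul_assoc, ← Real.rpow_neg hn0.le, ← Real.rpow_neg hn0.le,
    ← Real.rpow_add hn0]
  congr 2
  push_cast
  ring

/-- The weights `g` are signed so that a difference of two sphere sums can be treated as a single
sum. The restriction `|x i| ≤ 1/4` keeps `x i` and `x i + δ` inside one linear stretch of period for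
the triangle waves. -/
theorem abs_sum_mul_ramp_le {ι : Type*} (t : Finset ι) (g x : ι → ℝ) {δ ε B : ℝ} (hδ : 0 < δ)
    (hδ1 : δ ≤ 1 / 4) (hε : 0 < ε) (hε1 : ε ≤ 1) (hx : ∀ i ∈ t, |x i| ≤ 1 / 4)
    (hB : ∀ n : ℕ, ‖∑ i ∈ t, (g i : ℂ) * unitPhase (n * x i)‖ ≤ B) :
    |∑ i ∈ t, g i * ramp δ (x i)| ≤ B / 2 + δ ^ (-ε) * (∑' n : ℕ, (n : ℝ) ^ (-1 - ε)) * B := by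
  have hB0 : 0 ≤ B := (norm_nonneg _).trans (hB 0)
  have h1 := hasSum_sum (fun i hi => (hasSum_ramp hδ hδ1 (hx i hi)).mul_left (g i))
  have hsum : Summable (fun n : ℕ => (n : ℝ) ^ (-1 - ε)) := Real.summable_nat_rpow.2 (by linarith)
  have h2 := (hsum.hasSum.mul_left (δ ^ (-ε))).mul_right B
  have h3 : ∀ n : ℕ, ‖∑ i ∈ t, g i * (1 / (2 * δ * Real.pi ^ 2) * ((1 - (-1) ^ n) / (n : ℝ) ^ 2 *
      (Real.cos (2 * Real.pi * n * x i) - Real.cos (2 * Real.pi * n * (x i + δ)))))‖ ≤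
      δ ^ (-ε) * (n : ℝ) ^ (-1 - ε) * B := by
    intro n
    have e : ∑ i ∈ t, g i * (1 / (2 * δ * Real.pi ^ 2) * ((1 - (-1) ^ n) / (n : ℝ) ^ 2 *
        (Real.cos (2 * Real.pi * n * x i) - Real.cos (2 * Real.pi * n * (x i + δ))))) =
        1 / (2 * δ * Real.pi ^ 2) * ((1 - (-1) ^ n) / (n : ℝ) ^ 2 *
          ((1 - unitPhase (n * δ)) * ∑ i ∈ t, (g i : ℂ) * unitPhase (n * x i)).re) := by
      rw [Finset.mul_sum, Complex.re_sum, Finset.mul_sum, Finset.mul_sum]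
      refine Finset.sum_congr rfl fun i _ => ?_
      rw [show (1 - unitPhase (n * δ)) * ((g i : ℂ) * unitPhase (n * x i)) =
        (g i : ℂ) * (unitPhase (n * x i) - unitPhase (n * x i + n * δ)) by
          rw [unitPhase_add]; ring, Complex.re_ofReal_mul, Complex.sub_re, unitPhase_re, unitPhase_re,
        show 2 * Real.pi * (n * x i + n * δ) = 2 * Real.pi * n * (x i + δ) by ring,
        show 2 * Real.pi * (n * x i) = 2 * Real.pi * n * x i by ring]
      ring
    have hre := (Complex.abs_re_le_norm ((1 - unitPhase (n * δ)) *
      ∑ i ∈ t, (g i : ℂ) * unitPhase (n * x i)))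
    rw [norm_mul] at hre
    rw [e, Real.norm_eq_abs, abs_mul, abs_mul, abs_div (1 - (-1 : ℝ) ^ n),
      abs_of_nonneg (show (0 : ℝ) ≤ (n : ℝ) ^ 2 by positivity),
      abs_of_nonneg (show 0 ≤ 1 / (2 * δ * Real.pi ^ 2) by positivity)]
    calc _ ≤ 1 / (2 * δ * Real.pi ^ 2) * (|1 - (-1 : ℝ) ^ n| / (n : ℝ) ^ 2 *
          (‖1 - unitPhase (n * δ)‖ * B)) := by
          gcongr
          refine hre.trans ?_
          gcongr
          exact hB n
      _ = 1 / (2 * δ * Real.pi ^ 2) * (|1 - (-1 : ℝ) ^ n| / (n : ℝ) ^ 2 *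
          ‖1 - unitPhase (n * δ)‖) * B := by ring
      _ ≤ _ := mul_le_mul_of_nonneg_right (ramp_coeff_le hδ hε.le hε1 n) hB0
  have h4 := tsum_of_norm_bounded h2 h3
  rw [h1.tsum_eq] at h4
  have h5 : ∑ i ∈ t, g i * ramp δ (x i) = ∑ i ∈ t, g i * (ramp δ (x i) - 1 / 2) + (∑ i ∈ t, g i) / 2 := by
    rw [Finset.sum_div, ← Finset.sum_add_distrib]
    refine Finset.sum_congr rfl fun i _ => ?_
    ring
  have h6 : |∑ i ∈ t, g i| ≤ B := by
    have := hB 0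
    simp only [Nat.cast_zero, zero_mul, unitPhase_zero, mul_one] at this
    rwa [← Complex.ofReal_sum, Complex.norm_real] at this
  rw [h5]
  refine (abs_add_le _ _).trans ?_
  rw [abs_div, abs_two]
  rw [Real.norm_eq_abs] at h4
  linarith

theorem sphereSum_sub_eq {E : Type*} [NormedAddCommGroup E] [NormedSpace ℝ E] (c : ℝ) (M : ℕ)
    (w : (Fin 3 → ℤ) → E) (l k : ℤ) :
    sphereSum c M w l - sphereSum c M w k = ∑ m ∈ intCube M,
      ((if ∑ i, ⌊|(m i : ℝ)| ^ c⌋ = l then (1 : ℝ) else 0) -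
        (if ∑ i, ⌊|(m i : ℝ)| ^ c⌋ = k then 1 else 0)) • w m := by
  rw [sphereSum, sphereSum, Finset.sum_filter, Finset.sum_filter, ← Finset.sum_sub_distrib]
  refine Finset.sum_congr rfl fun m _ => ?_
  rw [sub_smul]
  congr 1 <;> split_ifs <;> simp

theorem exists_abs_sphereSum_ramp_sub_le {c : ℝ} (hc : 1 < c) (hc2 : c < 9 / 8) {ε : ℝ} (hε : 0 < ε)
    (hε1 : ε ≤ 1) :
    ∃ C : ℝ, 0 < C ∧ ∀ M : ℕ, 0 < M → ∀ (ξ : Fin 3 → ℝ) (A L δ : ℝ), 0 < δ → δ ≤ 1 / 4 →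
      (∀ m ∈ intCube M, |(∑ i, ξ i * m i - A) / L| ≤ 1 / 4) → ∀ (lam : ℤ) (j : ℕ),
      (j : ℝ) ≤ 2 * (M : ℝ) ^ (1 / 5 : ℝ) →
      |sphereSum c M (fun m => ramp δ ((∑ i, ξ i * m i - A) / L)) (lam + j) -
        sphereSum c M (fun m => ramp δ ((∑ i, ξ i * m i - A) / L)) lam| ≤
        C * δ ^ (-ε) * (M : ℝ) ^ ((6 + 3 * c) / 5) := by
  obtain ⟨C, hC, h⟩ := exists_norm_sphereSum_unitPhase_sub_le hc hc2
  set ζ : ℝ := ∑' n : ℕ, (n : ℝ) ^ (-1 - ε) with hζ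
  have hζ0 : 0 ≤ ζ := tsum_nonneg fun n => by positivity
  refine ⟨C * (1 + ζ), by positivity, ?_⟩
  intro M hM ξ A L δ hδ hδ1 hx lam j hj
  rw [sphereSum_sub_eq]
  simp only [smul_eq_mul]
  have key := abs_sum_mul_ramp_le (intCube M) (fun m =>
    (if ∑ i, ⌊|(m i : ℝ)| ^ c⌋ = lam + j then (1 : ℝ) else 0) -
        (if ∑ i, ⌊|(m i : ℝ)| ^ c⌋ = lam then 1 else 0)) (fun m => (∑ i, ξ i * m i - A) / L)
    (B := C * (M : ℝ) ^ ((6 + 3 * c) / 5)) hδ hδ1 hε hε1 hx ?_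
  · refine key.trans ?_
    have h1 : 1 ≤ δ ^ (-ε) :=
      Real.one_le_rpow_of_pos_of_le_one_of_nonpos hδ (by linarith) (by linarith)
    have h2 : 0 ≤ C * (M : ℝ) ^ ((6 + 3 * c) / 5) := by positivity
    rw [← hζ]
    nlinarith [mul_le_mul_of_nonneg_right h1 h2]
  · intro n
    have h1 := h M hM (fun i => n * ξ i / L) lam j hj
    refine le_trans (le_of_eq ?_) h1
    -- The offset `A` contributes only the unimodular constant `e(-nA/L)`, which is inserted here to
    -- match the two sums.
    rw [sphereSum_sub_eq, ← one_mul ‖∑ m ∈ intCube M, _ • _‖, ← norm_unitPhase (-(n * A / L)),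
      ← norm_mul, Finset.mul_sum]
    refine congrArg _ (Finset.sum_congr rfl fun m _ => ?_)
    rw [Complex.real_smul, mul_left_comm, ← unitPhase_add]
    congr 2
    have : ∑ i, n * ξ i / L * (m i : ℝ) = n / L * ∑ i, ξ i * m i := by
      rw [Finset.mul_sum]
      refine Finset.sum_congr rfl fun i _ => ?_
      ring
    rw [this]
    ring

/-! ### Volumes of thin convex shells -/

theorem convexOn_abs_rpow {c : ℝ} (hc : 1 ≤ c) : ConvexOn ℝ univ (fun x : ℝ => |x| ^ c) := by
  refine ⟨convex_univ, fun x _ y _ a b ha hb hab => ?_⟩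
  have h1 : |a • x + b • y| ≤ a • |x| + b • |y| := by
    simp only [smul_eq_mul]
    refine (abs_add_le _ _).trans ?_
    rw [abs_mul, abs_mul, abs_of_nonneg ha, abs_of_nonneg hb]
  exact (Real.rpow_le_rpow (abs_nonneg _) h1 (by linarith)).trans
    ((convexOn_rpow hc).2 (abs_nonneg x) (abs_nonneg y) ha hb hab)

section ConvexShell

variable {h : (Fin 2 → ℝ) → ℝ} {κ : ℝ}

/-- Strong midpoint convexity at the minimiser confines the sublevel set to a ball of radius `O(√(s
- h x₀))`; in dimension two its area is linear in `s - h x₀`. -/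
theorem volume_real_sublevel_le (hκ : 0 < κ)
    (hmid : ∀ x y, h x ≤ 2 → h y ≤ 2 →
      h ((1 / 2 : ℝ) • x + (1 / 2 : ℝ) • y) ≤ (h x + h y) / 2 - κ * ‖x - y‖ ^ 2)
    {x₀ : Fin 2 → ℝ} (hx₀ : ∀ y, h x₀ ≤ h y) {s : ℝ} (hs : h x₀ ≤ s) (hs2 : s ≤ 2) :
    volume {y | h y ≤ s} ≤ ENNReal.ofReal (2 * (s - h x₀) / κ) := by
  have hsub : {y | h y ≤ s} ⊆ Metric.closedBall x₀ (√((s - h x₀) / (2 * κ))) := by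
    intro y hy
    have hy : h y ≤ s := hy
    have h1 := hmid y x₀ (hy.trans hs2) (hs.trans hs2)
    have h2 := hx₀ ((1 / 2 : ℝ) • y + (1 / 2 : ℝ) • x₀)
    rw [Metric.mem_closedBall, dist_eq_norm]
    refine Real.le_sqrt_of_sq_le ?_
    rw [le_div_iff₀ (by positivity)]
    linarith
  refine (measure_mono hsub).trans ?_
  rw [Real.volume_pi_closedBall _ (Real.sqrt_nonneg _), Fintype.card_fin, mul_pow,
    Real.sq_sqrt (by have : 0 ≤ s - h x₀ := by linarith
                     positivity)]
  refine ENNReal.ofReal_le_ofReal (le_of_eq ?_)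
  field_simp

/-- If the minimum of `h` exceeds `1 - w`, the whole sublevel set has area `O(w)`. Otherwise
convexity places `{h ≤ 1 + w}` inside a homothetic copy of `{h ≤ 1}`, and the gain in area is the
dilation excess times the area `O(1 - h x₀)`. The bound thus stays uniform for slices close to
tangency. -/
theorem volume_convex_shell_le (hκ : 0 < κ) (hconv : ConvexOn ℝ univ h) (hcont : Continuous h)
    (hcoer : ∀ y, 1 ≤ ‖y‖ → ‖y‖ ≤ h y)
    (hmid : ∀ x y, h x ≤ 2 → h y ≤ 2 →
      h ((1 / 2 : ℝ) • x + (1 / 2 : ℝ) • y) ≤ (h x + h y) / 2 - κ * ‖x - y‖ ^ 2)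
    {w : ℝ} (hw : 0 < w) (hw1 : w ≤ 1) :
    volume {y | 1 < h y ∧ h y ≤ 1 + w} ≤ ENNReal.ofReal (6 * w / κ) := by
  obtain ⟨x₀, hx₀⟩ : ∃ x₀, ∀ y, h x₀ ≤ h y := by
    refine hcont.exists_forall_le' 0 ?_
    have h1 := (tendsto_norm_cocompact_atTop (E := Fin 2 → ℝ)).eventually_ge_atTop (max 1 (h 0))
    filter_upwards [h1] with y hy
    exact (le_max_right _ _).trans (hy.trans (hcoer y ((le_max_left _ _).trans hy)))
  rcases lt_or_ge (1 + w) (h x₀) with h1 | h1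
  · have : {y | 1 < h y ∧ h y ≤ 1 + w} = ∅ := by
      ext y
      simp only [mem_ofPred_eq, mem_empty_iff_false, iff_false, not_and, not_le]
      exact fun _ => h1.trans_le (hx₀ y)
    rw [this, measure_empty]
    exact zero_le
  have hV := volume_real_sublevel_le hκ hmid hx₀ h1 (by linarith)
  rcases lt_or_ge (1 - w) (h x₀) with h2 | h2
  · refine (measure_mono (fun y hy => hy.2)).trans (hV.trans (ENNReal.ofReal_le_ofReal ?_))
    exact div_le_div_of_nonneg_right (by linarith) hκ.le
  have hV1 := volume_real_sublevel_le hκ hmid hx₀ (s := 1) (by linarith) (by norm_num)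
  have hd : 0 < 1 - h x₀ := by linarith
  -- Chosen so that moving from `y` towards `x₀` by the factor `1 / (1 + τ)` lowers the bound `1 +
  -- w` exactly to `1`.
  set τ : ℝ := w / (1 - h x₀) with hτ
  have hτ0 : 0 < τ := by positivity
  have hτ1 : τ ≤ 1 := by rw [hτ, div_le_one hd]; linarith
  have hτd : τ * (1 - h x₀) = w := by rw [hτ]; field_simp
  clear_value τ
  have hsub : {y | h y ≤ 1 + w} ⊆ AffineMap.homothety x₀ (1 + τ) '' {y | h y ≤ 1} := by
    intro y hy
    have hy : h y ≤ 1 + w := hy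
    refine ⟨(τ / (1 + τ)) • x₀ + (1 / (1 + τ)) • y, ?_, ?_⟩
    · have h3 := hconv.2 (mem_univ x₀) (mem_univ y)
        (show 0 ≤ τ / (1 + τ) by positivity) (show 0 ≤ 1 / (1 + τ) by positivity)
        (by field_simp; ring)
      refine h3.trans ?_
      simp only [smul_eq_mul]
      rw [div_mul_eq_mul_div, div_mul_eq_mul_div, ← add_div, div_le_one (by positivity)]
      linarith
    · rw [AffineMap.homothety_apply]
      ext i
      simp only [vsub_eq_sub, vadd_eq_add, Pi.add_apply, Pi.smul_apply, Pi.sub_apply, smul_eq_mul]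
      field_simp
      ring
  have hV2 : volume {y | h y ≤ 1 + w} ≤ ENNReal.ofReal ((1 + τ) ^ 2) * volume {y | h y ≤ 1} := by
    refine (measure_mono hsub).trans ?_
    rw [Measure.addHaar_image_homothety, Module.finrank_fin_fun, abs_of_nonneg (by positivity)]
  have hfin : volume {y | h y ≤ 1} ≠ ∞ := (hV1.trans_lt ENNReal.ofReal_lt_top).ne
  have hfin2 : volume {y | h y ≤ 1 + w} ≠ ∞ := (hV.trans_lt ENNReal.ofReal_lt_top).ne
  have hset : {y | 1 < h y ∧ h y ≤ 1 + w} = {y | h y ≤ 1 + w} \ {y | h y ≤ 1} := by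
    ext y
    simp only [mem_ofPred_eq, mem_sdiff, not_le]
    exact and_comm
  have hmeas : NullMeasurableSet {y | h y ≤ 1} volume :=
    (measurableSet_le hcont.measurable measurable_const).nullMeasurableSet
  have hss : {y | h y ≤ 1} ⊆ {y | h y ≤ 1 + w} := fun y (hy : h y ≤ 1) =>
    show h y ≤ 1 + w by linarith
  rw [hset, measure_sdiff hss hmeas hfin]
  refine tsub_le_iff_right.2 (hV2.trans ?_)
  rw [show (1 + τ) ^ 2 = (2 * τ + τ ^ 2) + 1 by ring, ENNReal.ofReal_add (by positivity) zero_le_one,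
    add_mul, ENNReal.ofReal_one, one_mul]
  refine add_le_add ?_ le_rfl
  calc ENNReal.ofReal (2 * τ + τ ^ 2) * volume {y | h y ≤ 1}
      ≤ ENNReal.ofReal (3 * τ) * ENNReal.ofReal (2 * (1 - h x₀) / κ) := by
        gcongr
        nlinarith
    _ = ENNReal.ofReal (6 * w / κ) := by
        rw [← ENNReal.ofReal_mul (by positivity), ← hτd]
        congr 1
        ring

end ConvexShell

/-- The term with `u` and `η` is convex, and `∑ |y j| ^ c` alone supplies the strong convexity;
hence the constant does not depend on the slicing plane. -/
theorem exists_volume_slice_shell_le {c : ℝ} (hc : 1 < c) (hc2 : c < 2) :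
    ∃ K : ℝ, 0 < K ∧ ∀ (u : ℝ) (η : Fin 2 → ℝ) (w : ℝ), 0 < w → w ≤ 1 →
      volume {y : Fin 2 → ℝ | 1 < |u - ∑ j, η j * y j| ^ c + ∑ j, |y j| ^ c ∧
        |u - ∑ j, η j * y j| ^ c + ∑ j, |y j| ^ c ≤ 1 + w} ≤ ENNReal.ofReal (K * w) := by
  set κ : ℝ := c * (c - 1) / 8 * 2 ^ (c - 2) with hκ
  have hc0 : 0 < c - 1 := by linarith
  have hκ0 : 0 < κ := by positivity
  refine ⟨6 / κ, by positivity, fun u η w hw hw1 => ?_⟩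
  rw [div_mul_eq_mul_div]
  set l : (Fin 2 → ℝ) → ℝ := fun y => |u - ∑ j, η j * y j| ^ c with hl
  have hlconv : ConvexOn ℝ univ l := by
    refine ⟨convex_univ, fun x _ y _ a b ha hb hab => ?_⟩
    have h1 := (convexOn_abs_rpow hc.le).2 (mem_univ (u - ∑ j, η j * x j))
      (mem_univ (u - ∑ j, η j * y j)) ha hb hab
    refine le_trans (le_of_eq ?_) h1
    simp only [hl, smul_eq_mul, Fin.sum_univ_two, Pi.add_apply, Pi.smul_apply]
    congr 2
    linear_combination -u * hab
  have hsconv : ∀ j, ConvexOn ℝ univ (fun y : Fin 2 → ℝ => |y j| ^ c) := by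
    intro j
    refine ⟨convex_univ, fun x _ y _ a b ha hb hab => ?_⟩
    exact (convexOn_abs_rpow hc.le).2 (mem_univ (x j)) (mem_univ (y j)) ha hb hab
  have hl0 : ∀ y, 0 ≤ l y := fun y => by simp only [hl]; positivity
  refine volume_convex_shell_le (h := fun y => l y + ∑ j, |y j| ^ c) hκ0 ?_ ?_ ?_ ?_ hw hw1
  · simp only [Fin.sum_univ_two]
    exact hlconv.add ((hsconv 0).add (hsconv 1))
  · have h0 : 0 ≤ c := by linarith
    refine Continuous.add ?_ (continuous_finsetSum _ fun j _ => ?_)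
    · exact Continuous.rpow_const (by fun_prop) fun _ => Or.inr h0
    · exact Continuous.rpow_const (by fun_prop) fun _ => Or.inr h0
  · intro y hy
    obtain ⟨j, hj⟩ : ∃ j, ‖y‖ = |y j| := by
      obtain ⟨j, hj⟩ := (IsGreatest.pi_norm y).1
      exact ⟨j, hj.symm⟩
    have h1 : |y j| ≤ |y j| ^ c := by
      rw [hj] at hy
      calc |y j| = |y j| ^ (1 : ℝ) := (Real.rpow_one _).symm
        _ ≤ _ := Real.rpow_le_rpow_of_exponent_le hy hc.le
    have h2 := Finset.single_le_sum (f := fun j => |y j| ^ c) (fun j _ => by positivity)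
      (Finset.mem_univ j)
    have := hl0 y
    rw [hj]
    linarith
  · intro x y hx hy
    have hbd : ∀ z : Fin 2 → ℝ, l z + ∑ j, |z j| ^ c ≤ 2 → ∀ j, |z j| ≤ 2 := by
      intro z hz j
      by_contra! h
      have h2 := Finset.single_le_sum (f := fun j => |z j| ^ c) (fun j _ => by positivity)
        (Finset.mem_univ j)
      have h3 : |z j| ≤ |z j| ^ c := by
        calc |z j| = |z j| ^ (1 : ℝ) := (Real.rpow_one _).symm
          _ ≤ _ := Real.rpow_le_rpow_of_exponent_le (by linarith) hc.le
      have := hl0 z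
      linarith
    have h1 := hlconv.2 (mem_univ x) (mem_univ y) (show (0 : ℝ) ≤ 1 / 2 by norm_num)
      (show (0 : ℝ) ≤ 1 / 2 by norm_num) (by norm_num)
    simp only [smul_eq_mul] at h1
    have h2 : ∀ j, |((1 / 2 : ℝ) • x + (1 / 2 : ℝ) • y) j| ^ c ≤
        (|x j| ^ c + |y j| ^ c) / 2 - κ * (x j - y j) ^ 2 := by
      intro j
      have := abs_rpow_midpoint_le (R := 2) hc hc2 (hbd x hx j) (hbd y hy j)
      refine le_trans (le_of_eq ?_) this
      simp only [Pi.add_apply, Pi.smul_apply, smul_eq_mul]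
      congr 2
      ring
    have h3 := Finset.sum_le_sum fun j (_ : j ∈ Finset.univ) => h2 j
    obtain ⟨j, hj⟩ : ∃ j, ‖x - y‖ ^ 2 = (x j - y j) ^ 2 := by
      obtain ⟨j, hj⟩ := (IsGreatest.pi_norm (x - y)).1
      exact ⟨j, by rw [← hj]; simp only [Real.norm_eq_abs, sq_abs, Pi.sub_apply]⟩
    have h4 := Finset.single_le_sum (f := fun j => (x j - y j) ^ 2) (fun j _ => by positivity)
      (Finset.mem_univ j)
    rw [hj]
    have h5 := mul_le_mul_of_nonneg_left h4 hκ0.le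
    simp only [Fin.sum_univ_two] at h3 h5 ⊢
    linarith

/-- The part of the shell `1 < ∑ |x_i| ^ c ≤ 1 + w` between two parallel planes. -/
theorem exists_volume_slab_shell_le {c : ℝ} (hc : 1 < c) (hc2 : c < 2) :
    ∃ K : ℝ, 0 < K ∧ ∀ (ξ : Fin 3 → ℝ), ∑ i, ξ i ^ 2 = 1 → ∀ (w t s : ℝ), 0 < w → w ≤ 1 → 0 ≤ s →
      volume {x : Fin 3 → ℝ | 1 < ∑ i, |x i| ^ c ∧ ∑ i, |x i| ^ c ≤ 1 + w ∧
        t ≤ ∑ i, x i * ξ i ∧ ∑ i, x i * ξ i ≤ t + s} ≤ ENNReal.ofReal (K * w * s) := by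
  obtain ⟨K, hK, hslice⟩ := exists_volume_slice_shell_le hc hc2
  refine ⟨2 * K, by positivity, fun ξ hξ w t s hw hw1 hs => ?_⟩
  -- Solving for a coordinate with `|ξ i| ≥ 1/2` keeps the Jacobian bounded by `2`.
  obtain ⟨i, hi⟩ : ∃ i, 1 / 2 ≤ |ξ i| := by
    by_contra! h
    have h1 : ∀ i, ξ i ^ 2 ≤ 1 / 4 := fun i => by
      rw [← sq_abs]
      have := h i
      have := abs_nonneg (ξ i)
      nlinarith
    rw [Fin.sum_univ_three] at hξ
    linarith [h1 0, h1 1, h1 2]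
  have hξi : ξ i ≠ 0 := by
    intro h
    rw [h, abs_zero] at hi
    norm_num at hi
  set η : Fin 2 → ℝ := fun j => ξ (i.succAbove j) / ξ i with hη
  set B : Set (ℝ × (Fin 2 → ℝ)) := {q | 1 < |q.1| ^ c + ∑ j, |q.2 j| ^ c ∧
    |q.1| ^ c + ∑ j, |q.2 j| ^ c ≤ 1 + w ∧ t ≤ (q.1 + ∑ j, η j * q.2 j) * ξ i ∧
    (q.1 + ∑ j, η j * q.2 j) * ξ i ≤ t + s} with hB
  have hBm : MeasurableSet B := by
    have m1 : Measurable fun q : ℝ × (Fin 2 → ℝ) => |q.1| ^ c + ∑ j, |q.2 j| ^ c := by fun_prop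
    have m2 : Measurable fun q : ℝ × (Fin 2 → ℝ) => (q.1 + ∑ j, η j * q.2 j) * ξ i := by fun_prop
    exact (measurableSet_lt measurable_const m1).inter ((measurableSet_le m1 measurable_const).inter
      ((measurableSet_le measurable_const m2).inter (measurableSet_le m2 measurable_const)))
  -- A volume-preserving shear that makes the planes orthogonal to `ξ` the level sets of the first
  -- coordinate.
  set φ : ℝ × (Fin 2 → ℝ) → ℝ × (Fin 2 → ℝ) := fun q => (q.1 - ∑ j, η j * q.2 j, q.2) with hφ
  have hφm : Measurable φ := by fun_prop
  have h1 : volume {x : Fin 3 → ℝ | 1 < ∑ i, |x i| ^ c ∧ ∑ i, |x i| ^ c ≤ 1 + w ∧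
        t ≤ ∑ i, x i * ξ i ∧ ∑ i, x i * ξ i ≤ t + s} = (volume.prod volume) B := by
    have := (volume_preserving_piFinSuccAbove (fun _ : Fin 3 => ℝ) i).measure_preimage_equiv B
    rw [Measure.volume_eq_prod] at this
    rw [← this]
    congr 1
    ext x
    have e1 : ∑ k, |x k| ^ c = |x i| ^ c + ∑ j, |x (i.succAbove j)| ^ c := Fin.sum_univ_succAbove _ i
    have e2 : ∑ k, x k * ξ k = (x i + ∑ j, η j * x (i.succAbove j)) * ξ i := by
      rw [Fin.sum_univ_succAbove _ i, add_mul, Finset.sum_mul]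
      congr 1
      refine Finset.sum_congr rfl fun j _ => ?_
      simp only [hη]
      field_simp
    simp only [mem_ofPred_eq, e1, e2]
    rfl
  have h2 : (volume.prod volume) B = (volume.prod volume) (φ ⁻¹' B) := by
    rw [Measure.prod_apply_symm hBm, Measure.prod_apply_symm (hφm hBm)]
    refine lintegral_congr fun y => ?_
    have := measure_preimage_add_right (volume : Measure ℝ) (-∑ j, η j * y j) ((fun x => (x, y)) ⁻¹' B)
    rw [← this]
    simp only [hφ, ← sub_eq_add_neg]
    rfl
  have h3 : ∀ p : ℝ, volume (Prod.mk p ⁻¹' (φ ⁻¹' B)) ≤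
      ((fun p : ℝ => p * ξ i) ⁻¹' Icc t (t + s)).indicator (fun _ => ENNReal.ofReal (K * w)) p := by
    intro p
    by_cases hp : p ∈ (fun p : ℝ => p * ξ i) ⁻¹' Icc t (t + s)
    · rw [indicator_of_mem hp]
      refine (measure_mono ?_).trans (hslice p η w hw hw1)
      intro y hy
      exact ⟨hy.1, hy.2.1⟩
    · rw [indicator_of_notMem hp, nonpos_iff_eq_zero]
      convert! measure_empty (μ := (volume : Measure (Fin 2 → ℝ)))
      ext y
      simp only [mem_empty_iff_false, iff_false]
      intro hy
      refine hp ?_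
      have h4 := hy.2.2
      simp only [hφ, sub_add_cancel] at h4
      exact h4
  rw [h1, h2, Measure.prod_apply (hφm hBm)]
  refine (lintegral_mono h3).trans ?_
  rw [lintegral_indicator (measurableSet_Icc.preimage (by fun_prop)), setLIntegral_const,
    Real.volume_preimage_mul_right hξi, Real.volume_Icc, ← ENNReal.ofReal_mul (abs_nonneg _),
    ← ENNReal.ofReal_mul (by positivity)]
  refine ENNReal.ofReal_le_ofReal ?_
  have h4 : |(ξ i)⁻¹| ≤ 2 := by
    rw [abs_inv]
    exact inv_le_of_inv_le₀ (by norm_num) (by linarith)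
  rw [add_sub_cancel_left]
  calc K * w * (|(ξ i)⁻¹| * s) ≤ K * w * (2 * s) := by gcongr
    _ = _ := by ring

/-! ### Cones, strips and caps under `μ_c` -/

theorem cNorm_rpow {c : ℝ} (hc : 0 < c) (x : R3) : cNorm c x ^ c = ∑ i, |x i| ^ c := by
  rw [cNorm, ← Real.rpow_mul (Finset.sum_nonneg fun i _ => by positivity),
    one_div_mul_cancel hc.ne', Real.rpow_one]

theorem inner_R3 (x ξ : R3) : inner ℝ x ξ = ∑ i, x i * ξ i := by
  rw [PiLp.inner_apply]
  refine Finset.sum_congr rfl fun i _ => ?_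
  simp [mul_comm]

theorem sum_sq_eq_one {ξ : R3} (hξ : ξ ∈ Metric.sphere (0 : R3) 1) : ∑ i, ξ i ^ 2 = 1 := by
  have h1 : ‖ξ‖ = 1 := by simpa using hξ
  have h2 := EuclideanSpace.real_norm_sq_eq ξ
  rw [h1] at h2
  linarith

theorem abs_inner_le_of_forall_abs_le {x ξ : R3} (hξ : ξ ∈ Metric.sphere (0 : R3) 1) {r : ℝ}
    (hr : 0 ≤ r) (hx : ∀ i, |x i| ≤ r) : |inner ℝ x ξ| ≤ 2 * r := by
  have h1 : ‖ξ‖ = 1 := by simpa using hξ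
  have h2 : ‖x‖ ≤ 2 * r := by
    refine le_of_sq_le_sq ?_ (by positivity)
    rw [EuclideanSpace.real_norm_sq_eq]
    have h3 : ∀ i, x i ^ 2 ≤ r ^ 2 := fun i => sq_le_sq' (by linarith [(abs_le.1 (hx i)).1])
      (abs_le.1 (hx i)).2
    rw [Fin.sum_univ_three]
    nlinarith [h3 0, h3 1, h3 2]
  have h3 := abs_real_inner_le_norm x ξ
  rw [h1, mul_one] at h3
  linarith

theorem abs_apply_le_cNorm {c : ℝ} (hc : 0 < c) (x : R3) (i : Fin 3) : |x i| ≤ cNorm c x := by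
  have h1 : |x i| ^ c ≤ cNorm c x ^ c := by
    rw [cNorm_rpow hc]
    exact Finset.single_le_sum (f := fun i => |x i| ^ c) (fun j _ => by positivity)
      (Finset.mem_univ i)
  exact (Real.rpow_le_rpow_iff (abs_nonneg _) (cNorm_nonneg c x) hc).1 h1

theorem abs_inner_le_of_mem_cSphere {c : ℝ} (hc : 0 < c) {y ξ : R3}
    (hξ : ξ ∈ Metric.sphere (0 : R3) 1) (hy : y ∈ cSphere c) : |inner ℝ y ξ| ≤ 2 := by
  have := abs_inner_le_of_forall_abs_le hξ zero_le_one
    (fun i => (abs_apply_le_cNorm hc y i).trans (le_of_eq hy))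
  linarith

theorem volume_cone {c : ℝ} (hc : 1 ≤ c) {r₁ r₂ : ℝ} (h1 : 0 ≤ r₁) (h12 : r₁ ≤ r₂) {E : Set R3}
    (hE : MeasurableSet E) :
    volume {x : R3 | (r₁ < cNorm c x ∧ cNorm c x ≤ r₂) ∧ (cNorm c x)⁻¹ • x ∈ E} =
      ENNReal.ofReal ((r₂ ^ 3 - r₁ ^ 3) / 3) * muC c E := by
  have hm := measurable_cNorm c
  have hfin := isFiniteMeasure_muC hc
  have hr : radial (Ioc r₁ r₂) = ENNReal.ofReal ((r₂ ^ 3 - r₁ ^ 3) / 3) := by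
    have h3 := radial_Iic r₁ h1
    rw [← Iic_sdiff_Iic, measure_sdiff (Iic_subset_Iic.2 h12) measurableSet_Iic.nullMeasurableSet
      (by rw [h3]; exact ENNReal.ofReal_ne_top), h3, radial_Iic r₂ (h1.trans h12),
      ← ENNReal.ofReal_sub _ (by positivity), sub_div]
  rw [← hr, ← Measure.prod_prod, map_polar hc,
    Measure.map_apply (by fun_prop) (measurableSet_Ioc.prod hE)]
  rfl

theorem measurableSet_inner_preimage (c : ℝ) (ξ : R3) {I : Set ℝ} (hI : MeasurableSet I) :
    MeasurableSet {y : R3 | y ∈ cSphere c ∧ inner ℝ y ξ ∈ I} :=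
  (measurableSet_cSphere c).inter ((show Measurable fun y : R3 => inner ℝ y ξ by fun_prop) hI)

theorem measurableSet_sphCap (c a : ℝ) (ξ : R3) : MeasurableSet (sphCap c a ξ) :=
  measurableSet_inner_preimage c ξ measurableSet_Ici

/-- The cone over the strip between radii `1` and `1 + δ` has volume at least `δ` times the measure
of the strip. It lies in a shell of width `O(δ)` between planes at distance `O(δ)`, so its volume is
`O(δ ^ 2)`. -/
theorem exists_muC_strip_le {c : ℝ} (hc : 1 < c) (hc2 : c < 2) :
    ∃ K : ℝ, 0 < K ∧ ∀ ξ ∈ Metric.sphere (0 : R3) 1, ∀ a δ : ℝ, 0 < δ → δ ≤ 1 / 3 →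
      (muC c).real {y : R3 | y ∈ cSphere c ∧ inner ℝ y ξ ∈ Icc a (a + δ)} ≤ K * δ := by
  obtain ⟨K, hK, hslab⟩ := exists_volume_slab_shell_le hc hc2
  have hc0 : 0 < c := by linarith
  have hfin := isFiniteMeasure_muC hc.le
  refine ⟨15 * K, by positivity, fun ξ hξ a δ hδ hδ1 => ?_⟩
  set E : Set R3 := {y : R3 | y ∈ cSphere c ∧ inner ℝ y ξ ∈ Icc a (a + δ)} with hE
  have hEm : MeasurableSet E := measurableSet_inner_preimage c ξ measurableSet_Icc
  have h1 := volume_cone hc.le zero_le_one (show 1 ≤ 1 + δ by linarith) hEm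
  -- Scaling by at most `1 + δ` moves a height bounded by `2` by at most `2δ`, so heights in `[a, a
  -- + δ]` stay in `[a - 2δ, a + 3δ]`; and `(1 + δ) ^ c ≤ 1 + 3δ`.
  have h2 := hslab (fun i => ξ i) (sum_sq_eq_one hξ) (3 * δ) (a - 2 * δ) (5 * δ) (by positivity)
    (by linarith) (by positivity)
  have hsub : {x : R3 | (1 < cNorm c x ∧ cNorm c x ≤ 1 + δ) ∧ (cNorm c x)⁻¹ • x ∈ E} ⊆
      (MeasurableEquiv.toLp 2 (Fin 3 → ℝ)).symm ⁻¹' {x : Fin 3 → ℝ | 1 < ∑ i, |x i| ^ c ∧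
        ∑ i, |x i| ^ c ≤ 1 + 3 * δ ∧ a - 2 * δ ≤ ∑ i, x i * ξ i ∧
        ∑ i, x i * ξ i ≤ a - 2 * δ + 5 * δ} := by
    rintro x ⟨⟨hx1, hx2⟩, hx3, hx4⟩
    have hx0 : 0 < cNorm c x := by linarith
    have h3 : ((MeasurableEquiv.toLp 2 (Fin 3 → ℝ)).symm x) = fun i => x i := rfl
    rw [mem_preimage, mem_ofPred_eq, h3, ← cNorm_rpow hc0, ← inner_R3]
    have h4 := abs_le.1 (abs_inner_le_of_mem_cSphere hc0 hξ hx3)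
    set y := (cNorm c x)⁻¹ • x with hy
    have h5 : inner ℝ x ξ = cNorm c x * inner ℝ y ξ := by
      rw [hy, real_inner_smul_left, mul_inv_cancel_left₀ hx0.ne']
    rw [h5]
    refine ⟨Real.one_lt_rpow hx1 hc0, ?_, ?_, ?_⟩
    · calc cNorm c x ^ c ≤ (1 + δ) ^ c := by gcongr
        _ ≤ (1 + δ) ^ (2 : ℝ) := Real.rpow_le_rpow_of_exponent_le (by linarith) hc2.le
        _ ≤ 1 + 3 * δ := by
          rw [Real.rpow_two]
          nlinarith
    · nlinarith [hx4.1]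
    · nlinarith [hx4.2]
  have h3 := measure_mono (μ := volume) hsub
  rw [(EuclideanSpace.volume_preserving_symm_measurableEquiv_toLp (Fin 3)).measure_preimage_equiv,
    h1] at h3
  have h4 := h3.trans h2
  have h5 : ENNReal.ofReal (δ * (muC c).real E) ≤ ENNReal.ofReal (K * (3 * δ) * (5 * δ)) := by
    refine le_trans ?_ h4
    rw [ENNReal.ofReal_mul hδ.le, ofReal_measureReal]
    gcongr
    nlinarith [pow_pos hδ 3, pow_pos hδ 2]
  have h6 := (ENNReal.ofReal_le_ofReal_iff (by positivity)).1 h5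
  have h7 : δ * (muC c).real E ≤ δ * (15 * K * δ) := by linarith
  exact le_of_mul_le_mul_left h7 hδ

/-- The measure of a cap is a Lipschitz function of its height. -/
theorem exists_muC_sphCap_le_add {c : ℝ} (hc : 1 < c) (hc2 : c < 2) :
    ∃ K : ℝ, 0 < K ∧ ∀ ξ ∈ Metric.sphere (0 : R3) 1, ∀ a b : ℝ, a ≤ b →
      (muC c).real (sphCap c a ξ) ≤ (muC c).real (sphCap c b ξ) + K * (b - a) := by
  obtain ⟨K, hK, hstrip⟩ := exists_muC_strip_le hc hc2
  have hfin := isFiniteMeasure_muC hc.le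
  -- The second summand covers `b - a > 1/3`, where the total mass is at most `3 (b - a)` times
  -- itself.
  refine ⟨K + 3 * (muC c).real univ, by positivity, fun ξ hξ a b hab => ?_⟩
  rcases hab.eq_or_lt with rfl | hab
  · simp
  have hu : 0 ≤ (muC c).real univ := measureReal_nonneg
  have hb : 0 ≤ (muC c).real (sphCap c b ξ) := measureReal_nonneg
  rcases le_or_gt (b - a) (1 / 3) with h | h
  · have h1 : sphCap c a ξ ⊆ {y : R3 | y ∈ cSphere c ∧ inner ℝ y ξ ∈ Icc a (a + (b - a))} ∪
        sphCap c b ξ := by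
      rintro y ⟨hy1, hy2⟩
      rcases le_total b (inner ℝ y ξ) with h2 | h2
      · exact Or.inr ⟨hy1, h2⟩
      · exact Or.inl ⟨hy1, hy2, by linarith⟩
    have h2 := (measureReal_mono h1).trans (measureReal_union_le (μ := muC c) _ _)
    have h3 := hstrip ξ hξ a (b - a) (by linarith) h
    nlinarith
  · have h1 : (muC c).real (sphCap c a ξ) ≤ (muC c).real univ := measureReal_mono (subset_univ _)
    nlinarith

/-! ### Inequalities for powers -/

theorem rpow_sub_rpow_le {p a b R : ℝ} (hp : 1 ≤ p) (ha : 0 ≤ a) (hab : a ≤ b) (hb : b ≤ R) :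
    b ^ p - a ^ p ≤ p * R ^ (p - 1) * (b - a) := by
  rcases hab.eq_or_lt with rfl | hab
  · simp
  have hb0 : 0 < b := ha.trans_lt hab
  have h1 := one_add_mul_self_le_rpow_one_add (s := a / b - 1) (p := p)
    (by have : 0 ≤ a / b := by positivity
        linarith) hp
  rw [add_sub_cancel, Real.div_rpow ha hb0.le] at h1
  have h2 : 0 < b ^ p := by positivity
  rw [le_div_iff₀ h2] at h1
  have h3 : b ^ p = b ^ (p - 1) * b := by
    rw [← Real.rpow_add_one hb0.ne']; ring_nf
  have h4 : b ^ (p - 1) ≤ R ^ (p - 1) := Real.rpow_le_rpow hb0.le hb (by linarith)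
  have h5 : (1 + p * (a / b - 1)) * b ^ p = b ^ p - p * b ^ (p - 1) * (b - a) := by
    rw [h3]
    field_simp
    ring
  have h6 : p * b ^ (p - 1) * (b - a) ≤ p * R ^ (p - 1) * (b - a) := by
    have : 0 ≤ b - a := by linarith
    gcongr
  linarith

theorem abs_rpow_sub_rpow_le {p a b R : ℝ} (hp : 1 ≤ p) (ha : 0 ≤ a) (hb : 0 ≤ b) (haR : a ≤ R)
    (hbR : b ≤ R) : |b ^ p - a ^ p| ≤ p * R ^ (p - 1) * |b - a| := by
  rcases le_total a b with h | h
  · rw [abs_of_nonneg (sub_nonneg.2 (Real.rpow_le_rpow ha h (by linarith))),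
      abs_of_nonneg (sub_nonneg.2 h)]
    exact rpow_sub_rpow_le hp ha h hbR
  · rw [abs_sub_comm, abs_sub_comm b,
      abs_of_nonneg (sub_nonneg.2 (Real.rpow_le_rpow hb h (by linarith))),
      abs_of_nonneg (sub_nonneg.2 h)]
    exact rpow_sub_rpow_le hp hb h haR

/-- For `l ≥ 1`, the map `u ↦ u ^ (1 / c)` does not increase the distance to `l`. -/
theorem abs_rpow_one_div_sub_le {c l u : ℝ} (hc : 1 ≤ c) (hl : 1 ≤ l) (hu : 0 ≤ u) :
    |u ^ (1 / c) - l ^ (1 / c)| ≤ |u - l| := by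
  have hc0 : 0 < c := by linarith
  have key : ∀ a b : ℝ, 0 ≤ a → a ≤ b → 1 ≤ b → b ^ (1 / c) - a ^ (1 / c) ≤ b - a := by
    intro a b ha hab hb
    have hb0 : 0 < b := by linarith
    have h1 : a / b ≤ (a / b) ^ (1 / c) := by
      have h2 : a / b ≤ 1 := (div_le_one hb0).2 hab
      rcases ha.eq_or_lt with rfl | ha
      · simp only [zero_div]
        positivity
      · calc a / b = (a / b) ^ (1 : ℝ) := (Real.rpow_one _).symm
          _ ≤ _ := Real.rpow_le_rpow_of_exponent_ge (by positivity) h2 ((div_le_one hc0).2 hc)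
    rw [Real.div_rpow ha hb0.le] at h1
    have h3 : 0 < b ^ (1 / c) := by positivity
    rw [div_le_div_iff₀ hb0 h3] at h1
    have h4 : b ^ (1 / c) ≤ b := by
      calc b ^ (1 / c) ≤ b ^ (1 : ℝ) :=
            Real.rpow_le_rpow_of_exponent_le hb ((div_le_one hc0).2 hc)
        _ = b := Real.rpow_one _
    have h5 : 0 ≤ b - a := by linarith
    have h6 : b * (b ^ (1 / c) - a ^ (1 / c)) ≤ b * (b - a) := by
      nlinarith [mul_le_mul_of_nonneg_right h4 h5]
    exact le_of_mul_le_mul_left h6 hb0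
  rcases le_total u l with h | h
  · rw [abs_sub_comm, abs_sub_comm u, abs_of_nonneg (sub_nonneg.2 h),
      abs_of_nonneg (sub_nonneg.2 (Real.rpow_le_rpow hu h (by positivity)))]
    exact key u l hu h hl
  · rw [abs_of_nonneg (sub_nonneg.2 h),
      abs_of_nonneg (sub_nonneg.2 (Real.rpow_le_rpow (by linarith) h (by positivity)))]
    exact key l u (by linarith) h (hl.trans h)

/-! ### Lattice points in sectors of a shell -/

theorem volume_biUnion_unit_cubes (F : Finset (Fin 3 → ℤ)) :
    volume (⋃ m ∈ F, {x : R3 | ∀ i, ⌊x i⌋ = m i}) = F.card := by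
  have hQ : ∀ m : Fin 3 → ℤ, {x : R3 | ∀ i, ⌊x i⌋ = m i} =
      (MeasurableEquiv.toLp 2 (Fin 3 → ℝ)).symm ⁻¹'
        (univ.pi fun i => Ico (m i : ℝ) (m i + 1)) := by
    intro m
    ext x
    simp only [mem_ofPred_eq, Int.floor_eq_iff, mem_preimage, mem_pi, mem_univ, true_imp_iff, mem_Ico]
    rfl
  have hvol : ∀ m : Fin 3 → ℤ, volume {x : R3 | ∀ i, ⌊x i⌋ = m i} = 1 := by
    intro m
    rw [hQ, (EuclideanSpace.volume_preserving_symm_measurableEquiv_toLp (Fin 3)).measure_preimage_equiv,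
      volume_pi_pi]
    simp
  rw [measure_biUnion_finset]
  · simp [hvol]
  · intro m _ n _ hmn
    rw [Function.onFun, Set.disjoint_left]
    intro x hx hx'
    exact hmn (funext fun i => (hx i).symm.trans (hx' i))
  · intro m _
    rw [hQ]
    exact (MeasurableSet.univ_pi fun i => measurableSet_Ico).preimage (MeasurableEquiv.measurable _)

section Cone

variable {c l₁ l₂ N ρ B : ℝ} {ξ : R3}

/-- The shell sector `{l₁ < ∑ |x_i| ^ c ≤ l₂, x · ξ ≥ B}`. -/
def shellSector (c l₁ l₂ B : ℝ) (ξ : R3) : Set R3 :=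
  {x | (l₁ < ∑ i, |x i| ^ c ∧ ∑ i, |x i| ^ c ≤ l₂) ∧ B ≤ inner ℝ x ξ}

theorem rpow_one_div_lt_cNorm_iff (hc : 0 < c) (hl : 0 ≤ l₁) (x : R3) :
    l₁ ^ (1 / c) < cNorm c x ↔ l₁ < ∑ i, |x i| ^ c := by
  rw [← cNorm_rpow hc, ← Real.rpow_lt_rpow_iff (z := c) (by positivity) (cNorm_nonneg c x) hc,
    ← Real.rpow_mul hl, one_div_mul_cancel hc.ne', Real.rpow_one]

theorem cNorm_le_rpow_one_div_iff (hc : 0 < c) (hl : 0 ≤ l₂) (x : R3) :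
    cNorm c x ≤ l₂ ^ (1 / c) ↔ ∑ i, |x i| ^ c ≤ l₂ := by
  rw [← not_lt, rpow_one_div_lt_cNorm_iff hc hl, not_lt]

theorem volume_cone_eq (hc : 1 ≤ c) (h1 : 0 ≤ l₁) (h12 : l₁ ≤ l₂) (b : ℝ) :
    volume {x : R3 | (l₁ ^ (1 / c) < cNorm c x ∧ cNorm c x ≤ l₂ ^ (1 / c)) ∧
      (cNorm c x)⁻¹ • x ∈ sphCap c b ξ} =
    ENNReal.ofReal ((l₂ ^ (3 / c) - l₁ ^ (3 / c)) / 3 * (muC c).real (sphCap c b ξ)) := by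
  have hfin := isFiniteMeasure_muC hc
  have hc0 : 0 < c := by linarith
  have e : ∀ l : ℝ, 0 ≤ l → (l ^ (1 / c)) ^ 3 = l ^ (3 / c) := by
    intro l hl
    rw [← Real.rpow_natCast, ← Real.rpow_mul hl]
    congr 1
    push_cast
    ring
  have h3 : l₁ ^ (3 / c) ≤ l₂ ^ (3 / c) := Real.rpow_le_rpow h1 h12 (by positivity)
  rw [volume_cone hc (by positivity) (Real.rpow_le_rpow h1 h12 (by positivity))
    (measurableSet_sphCap c b ξ), e l₁ h1, e l₂ (h1.trans h12), ENNReal.ofReal_mul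
    (by linarith), ofReal_measureReal]

/-- For `x = r y` with `y` on the sphere, `|y · ξ| ≤ 2`, so replacing `r` by `N` changes `x · ξ` by
at most `2ρ`. The sector is thus contained in an exact cone over a slightly larger cap. -/
theorem volume_shellSector_le (hc : 1 ≤ c) (hξ : ξ ∈ Metric.sphere (0 : R3) 1) (h1 : 0 ≤ l₁)
    (h12 : l₁ ≤ l₂) (hN : 0 < N)
    (hρ : ∀ r, l₁ ^ (1 / c) < r → r ≤ l₂ ^ (1 / c) → |r - N| ≤ ρ) :
    volume (shellSector c l₁ l₂ B ξ) ≤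
      ENNReal.ofReal ((l₂ ^ (3 / c) - l₁ ^ (3 / c)) / 3 * (muC c).real (sphCap c ((B - 2 * ρ) / N) ξ)) := by
  have hc0 : 0 < c := by linarith
  rw [← volume_cone_eq hc h1 h12]
  refine measure_mono fun x hx => ?_
  have h3 := (rpow_one_div_lt_cNorm_iff hc0 h1 x).2 hx.1.1
  have h4 := (cNorm_le_rpow_one_div_iff hc0 (h1.trans h12) x).2 hx.1.2
  have h5 : 0 < cNorm c x := lt_of_le_of_lt (by positivity) h3
  have h6 := inv_cNorm_smul_mem hc0 h5
  refine ⟨⟨h3, h4⟩, h6, ?_⟩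
  have h7 := abs_inner_le_of_mem_cSphere hc0 hξ h6
  have h8 := hρ _ h3 h4
  have h9 : inner ℝ x ξ = cNorm c x * inner ℝ ((cNorm c x)⁻¹ • x) ξ := by
    rw [real_inner_smul_left, mul_inv_cancel_left₀ h5.ne']
  have h10 : |(cNorm c x - N) * inner ℝ ((cNorm c x)⁻¹ • x) ξ| ≤ ρ * 2 := by
    rw [abs_mul]
    exact mul_le_mul h8 h7 (abs_nonneg _) ((abs_nonneg _).trans h8)
  rw [div_le_iff₀ hN]
  have h11 : B ≤ inner ℝ x ξ := hx.2
  have h12 := (abs_le.1 h10).2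
  linarith

theorem le_volume_shellSector (hc : 1 ≤ c) (hξ : ξ ∈ Metric.sphere (0 : R3) 1) (h1 : 0 ≤ l₁)
    (h12 : l₁ ≤ l₂) (hN : 0 < N)
    (hρ : ∀ r, l₁ ^ (1 / c) < r → r ≤ l₂ ^ (1 / c) → |r - N| ≤ ρ) :
    ENNReal.ofReal ((l₂ ^ (3 / c) - l₁ ^ (3 / c)) / 3 * (muC c).real (sphCap c ((B + 2 * ρ) / N) ξ)) ≤
      volume (shellSector c l₁ l₂ B ξ) := by
  have hc0 : 0 < c := by linarith
  rw [← volume_cone_eq hc h1 h12]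
  refine measure_mono fun x hx => ?_
  obtain ⟨⟨h3, h4⟩, h6, h6'⟩ := hx
  refine ⟨⟨(rpow_one_div_lt_cNorm_iff hc0 h1 x).1 h3,
    (cNorm_le_rpow_one_div_iff hc0 (h1.trans h12) x).1 h4⟩, ?_⟩
  have h5 : 0 < cNorm c x := lt_of_le_of_lt (by positivity) h3
  have h7 := abs_inner_le_of_mem_cSphere hc0 hξ h6
  have h8 := hρ _ h3 h4
  have h9 : inner ℝ x ξ = cNorm c x * inner ℝ ((cNorm c x)⁻¹ • x) ξ := by
    rw [real_inner_smul_left, mul_inv_cancel_left₀ h5.ne']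
  have h10 : |(cNorm c x - N) * inner ℝ ((cNorm c x)⁻¹ • x) ξ| ≤ ρ * 2 := by
    rw [abs_mul]
    exact mul_le_mul h8 h7 (abs_nonneg _) ((abs_nonneg _).trans h8)
  rw [div_le_iff₀ hN] at h6'
  have h12 := (abs_le.1 h10).1
  linarith

end Cone

theorem mem_intCube_floor_iff {N : ℝ} (hN : 0 ≤ N) (m : Fin 3 → ℤ) :
    m ∈ intCube ⌊4 * N⌋₊ ↔ ∀ i, |(m i : ℝ)| ≤ 4 * N := by
  rw [intCube, Fintype.mem_piFinset]
  refine forall_congr' fun i => ?_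
  have h1 : |(m i : ℝ)| ≤ 4 * N ↔ (m i).natAbs ≤ ⌊4 * N⌋₊ := by
    rw [Nat.le_floor_iff (by positivity), Nat.cast_natAbs, Int.cast_abs]
  rw [h1, Finset.mem_Icc]
  omega

section Shell

variable {c : ℝ} {lam : ℕ}

theorem sum_floor_le (c : ℝ) (m : Fin 3 → ℤ) :
    ((∑ i, ⌊|(m i : ℝ)| ^ c⌋ : ℤ) : ℝ) ≤ ∑ i, |(m i : ℝ)| ^ c := by
  push_cast
  exact Finset.sum_le_sum fun i _ => Int.floor_le _

theorem lt_sum_floor_add (c : ℝ) (m : Fin 3 → ℤ) :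
    ∑ i, |(m i : ℝ)| ^ c < ((∑ i, ⌊|(m i : ℝ)| ^ c⌋ : ℤ) : ℝ) + 3 := by
  push_cast
  simp only [Fin.sum_univ_three]
  have := fun i => Int.lt_floor_add_one (|(m i : ℝ)| ^ c)
  linarith [this 0, this 1, this 2]

theorem abs_le_of_abs_rpow_le (hc : 1 ≤ c) {z : ℝ} (h : |z| ^ c ≤ 4 * lam) :
    |z| ≤ 4 * (lam : ℝ) ^ (1 / c) := by
  have hc0 : 0 < c := by linarith
  have h1 := Real.rpow_le_rpow (by positivity) h (show 0 ≤ 1 / c by positivity)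
  rw [← Real.rpow_mul (abs_nonneg _), mul_one_div_cancel hc0.ne', Real.rpow_one,
    Real.mul_rpow (by norm_num) (by positivity)] at h1
  have h2 : (4 : ℝ) ^ (1 / c) ≤ 4 ^ (1 : ℝ) :=
    Real.rpow_le_rpow_of_exponent_le (by norm_num) ((div_le_one hc0).2 hc)
  rw [Real.rpow_one] at h2
  refine h1.trans ?_
  gcongr

theorem abs_apply_rpow_le_sum (c : ℝ) (x : Fin 3 → ℝ) (i : Fin 3) : |x i| ^ c ≤ ∑ i, |x i| ^ c :=
  Finset.single_le_sum (f := fun i => |x i| ^ c) (fun _ _ => by positivity) (Finset.mem_univ i)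

/-- The distortion within one unit cube: each coordinate contributes at most `c (5N) ^ (c - 1) ≤ 10
N ^ (c - 1)`. -/
theorem abs_sum_rpow_sub_le (hc : 1 ≤ c) (hc2 : c ≤ 2) {N : ℝ} (hN : 0 < N) {x y : Fin 3 → ℝ}
    (hx : ∀ i, |x i| ≤ 5 * N) (hy : ∀ i, |y i| ≤ 5 * N) (hxy : ∀ i, |x i - y i| ≤ 1) :
    |∑ i, |x i| ^ c - ∑ i, |y i| ^ c| ≤ 30 * N ^ (c - 1) := by
  have h1 : ∀ i, |(|x i| ^ c - |y i| ^ c)| ≤ 10 * N ^ (c - 1) := by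
    intro i
    have h2 := abs_rpow_sub_rpow_le hc (abs_nonneg (y i)) (abs_nonneg (x i)) (hy i) (hx i)
    have h3 : |(|x i| - |y i|)| ≤ 1 := (abs_abs_sub_abs_le _ _).trans (hxy i)
    rw [Real.mul_rpow (by norm_num) hN.le] at h2
    have h4 : (5 : ℝ) ^ (c - 1) ≤ 5 ^ (1 : ℝ) :=
      Real.rpow_le_rpow_of_exponent_le (by norm_num) (by linarith)
    rw [Real.rpow_one] at h4
    calc _ ≤ _ := h2
      _ ≤ 2 * (5 * N ^ (c - 1)) * 1 := by gcongr
      _ = _ := by ring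
  rw [← Finset.sum_sub_distrib]
  refine (Finset.abs_sum_le_sum_abs _ _).trans ((Finset.sum_le_sum fun i _ => h1 i).trans ?_)
  simp
  linarith

/-- Integer points with `lam ≤ ∑ ⌊|m_i| ^ c⌋ < lam + W` and `m · ξ ≥ B`. -/
noncomputable def shellPoints (c : ℝ) (lam W : ℕ) (ξ : R3) (B : ℝ) : Finset (Fin 3 → ℤ) :=
  (intCube ⌊4 * (lam : ℝ) ^ (1 / c)⌋₊).filter fun m =>
    ((lam : ℤ) ≤ ∑ i, ⌊|(m i : ℝ)| ^ c⌋ ∧ ∑ i, ⌊|(m i : ℝ)| ^ c⌋ < (lam : ℤ) + W) ∧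
      B ≤ ∑ i, (m i : ℝ) * ξ i

theorem one_le_rpow_one_div (hc : 1 ≤ c) (hlam : 0 < lam) : 1 ≤ (lam : ℝ) ^ (1 / c) :=
  Real.one_le_rpow (by exact_mod_cast hlam) (by positivity)

theorem rpow_one_div_rpow (hc : 1 ≤ c) : ((lam : ℝ) ^ (1 / c)) ^ c = lam := by
  rw [← Real.rpow_mul (by positivity), one_div_mul_cancel (by linarith), Real.rpow_one]

theorem rpow_one_div_le_self (hc : 1 ≤ c) (hlam : 0 < lam) : (lam : ℝ) ^ (1 / c) ≤ lam := by
  have h1 := one_le_rpow_one_div hc hlam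
  calc (lam : ℝ) ^ (1 / c) = ((lam : ℝ) ^ (1 / c)) ^ (1 : ℝ) := (Real.rpow_one _).symm
    _ ≤ ((lam : ℝ) ^ (1 / c)) ^ c := Real.rpow_le_rpow_of_exponent_le h1 hc
    _ = lam := rpow_one_div_rpow hc

theorem abs_rpow_three_div_sub_le (hc : 1 ≤ c) (hc2 : c ≤ 2) (hlam : 0 < lam) {u v : ℝ} (hu : 0 ≤ u)
    (hv : 0 ≤ v) (hu' : u ≤ 43 * lam) (hv' : v ≤ 43 * lam) :
    |u ^ (3 / c) - v ^ (3 / c)| ≤ 3 * 43 ^ 2 * ((lam : ℝ) ^ (1 / c)) ^ (3 - c) * |u - v| := by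
  have hc0 : 0 < c := by linarith
  have hp1 : 1 ≤ 3 / c := by rw [le_div_iff₀ hc0]; linarith
  have hp3 : 3 / c ≤ 3 := by rw [div_le_iff₀ hc0]; linarith
  have h1 := abs_rpow_sub_rpow_le hp1 hv hu hv' hu'
  rw [Real.mul_rpow (by norm_num) (by positivity)] at h1
  have h2 : (43 : ℝ) ^ (3 / c - 1) ≤ 43 ^ (2 : ℝ) :=
    Real.rpow_le_rpow_of_exponent_le (by norm_num) (by linarith)
  rw [Real.rpow_two] at h2
  have h3 : ((lam : ℝ) ^ (1 / c)) ^ (3 - c) = (lam : ℝ) ^ (3 / c - 1) := by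
    rw [← Real.rpow_mul (by positivity)]
    congr 1
    field_simp
  rw [h3]
  calc _ ≤ _ := h1
    _ ≤ 3 * (43 ^ 2 * (lam : ℝ) ^ (3 / c - 1)) * |u - v| := by gcongr
    _ = _ := by ring

theorem shell_error_mul (N : ℝ) (hN : 0 < N) : N ^ (3 - c) * (40 * N ^ (c - 1)) = 40 * N ^ 2 := by
  rw [mul_left_comm, ← Real.rpow_add hN, show 3 - c + (c - 1) = ((2 : ℕ) : ℝ) by push_cast; ring,
    Real.rpow_natCast]

/-- The unit cubes at the counted points fill part of a slightly enlarged shell sector. Its extra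
width `O(N ^ (c - 1))` costs volume `O(N ^ 2)`, with `2 · 43 ^ 2 · 40 ≤ 150000`, and the heights
move by at most `2 + 2(W + E) ≤ 100 N ^ (1/5)`. -/
theorem card_shellPoints_le (hc : 1 < c) (hc2 : c < 9 / 8) (hlam : 0 < lam) {W : ℕ}
    (hW : (W : ℝ) ≤ 2 * ((lam : ℝ) ^ (1 / c)) ^ (1 / 5 : ℝ)) {ξ : R3}
    (hξ : ξ ∈ Metric.sphere (0 : R3) 1) (B : ℝ) :
    ((shellPoints c lam W ξ B).card : ℝ) ≤
      ((((lam : ℝ) + W) ^ (3 / c) - (lam : ℝ) ^ (3 / c)) / 3 + 150000 * ((lam : ℝ) ^ (1 / c)) ^ 2) *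
        (muC c).real (sphCap c
          ((B - 100 * ((lam : ℝ) ^ (1 / c)) ^ (1 / 5 : ℝ)) / (lam : ℝ) ^ (1 / c)) ξ) := by
  have hc0 : 0 < c := by linarith
  have hfin := isFiniteMeasure_muC hc.le
  set N : ℝ := (lam : ℝ) ^ (1 / c) with hNdef
  have hN1 : 1 ≤ N := one_le_rpow_one_div hc.le hlam
  have hN0 : 0 < N := by linarith
  have hNl : N ≤ lam := rpow_one_div_le_self hc.le hlam
  have hl1 : (1 : ℝ) ≤ lam := by exact_mod_cast hlam
  have hN5 : N ^ (1 / 5 : ℝ) ≤ N := by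
    calc _ ≤ N ^ (1 : ℝ) := Real.rpow_le_rpow_of_exponent_le hN1 (by norm_num)
      _ = N := Real.rpow_one _
  have hN51 : 1 ≤ N ^ (1 / 5 : ℝ) := Real.one_le_rpow hN1 (by norm_num)
  have hNc : N ^ (c - 1) ≤ N ^ (1 / 5 : ℝ) := Real.rpow_le_rpow_of_exponent_le hN1 (by linarith)
  have hNc1 : 1 ≤ N ^ (c - 1) := Real.one_le_rpow hN1 (by linarith)
  -- `30 N ^ (c - 1)` for moving inside a unit cube, and at most `3` for the three integer parts.
  set E : ℝ := 40 * N ^ (c - 1) with hE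
  have hE0 : 0 < E := by positivity
  have hW0 : (0 : ℝ) ≤ W := W.cast_nonneg
  set l₁ : ℝ := max (lam - E) 0 with hl₁
  set l₂ : ℝ := lam + W + E with hl₂
  have h10 : 0 ≤ l₁ := le_max_right _ _
  have h1lam : l₁ ≤ lam := max_le (by linarith) (by positivity)
  have h1E : lam - l₁ ≤ E := by linarith [le_max_left (lam - E) 0]
  have h12 : l₁ ≤ l₂ := by linarith
  have hρ : ∀ r, l₁ ^ (1 / c) < r → r ≤ l₂ ^ (1 / c) → |r - N| ≤ W + E := by
    intro r hr1 hr2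
    have a1 := abs_le.1 (abs_rpow_one_div_sub_le hc.le hl1 h10)
    have a2 := abs_le.1 (abs_rpow_one_div_sub_le hc.le hl1 (h10.trans h12))
    rw [abs_of_nonpos (by linarith), ← hNdef] at a1
    rw [abs_of_nonneg (by linarith), ← hNdef] at a2
    exact abs_le.2 ⟨by linarith [a1.1], by linarith [a2.2]⟩
  -- The origin is set aside because the inner radius may be cut off at `0`, where the strict
  -- inequality fails.
  have hsub : (⋃ m ∈ shellPoints c lam W ξ B, {x : R3 | ∀ i, ⌊x i⌋ = m i}) ⊆
      shellSector c l₁ l₂ (B - 2) ξ ∪ {0} := by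
    refine iUnion₂_subset fun m hm x hx => ?_
    by_cases hx0 : x = 0
    · exact Or.inr hx0
    left
    rw [shellPoints, Finset.mem_filter, mem_intCube_floor_iff hN0.le] at hm
    obtain ⟨hm1, ⟨hm2, hm3⟩, hm4⟩ := hm
    have hd : ∀ i, |x i - m i| ≤ 1 := by
      intro i
      have := hx i
      rw [Int.floor_eq_iff] at this
      exact abs_le.2 ⟨by linarith, by linarith⟩
    have hx5 : ∀ i, |x i| ≤ 5 * N := by
      intro i
      have a1 := abs_sub_abs_le_abs_sub (x i) (m i)
      linarith [hd i, hm1 i]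
    have hm5 : ∀ i, |(m i : ℝ)| ≤ 5 * N := fun i => (hm1 i).trans (by linarith)
    have hf := abs_le.1 (abs_sum_rpow_sub_le (c := c) hc.le (by linarith) hN0 hx5 hm5 hd)
    have hm2' : (lam : ℝ) ≤ ((∑ i, ⌊|(m i : ℝ)| ^ c⌋ : ℤ) : ℝ) := by exact_mod_cast hm2
    have hm3' : ((∑ i, ⌊|(m i : ℝ)| ^ c⌋ : ℤ) : ℝ) < lam + W := by exact_mod_cast hm3
    have a1 := sum_floor_le c m
    have a2 := lt_sum_floor_add c m
    have hpos : 0 < ∑ i, |x i| ^ c := by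
      rw [← cNorm_rpow hc0]
      exact Real.rpow_pos_of_pos (cNorm_pos hx0) _
    refine ⟨⟨max_lt (by linarith [hf.1]) hpos, by linarith [hf.2]⟩, ?_⟩
    have hin := abs_le.1 (abs_inner_le_of_forall_abs_le (x := x - WithLp.toLp 2 (fun i => (m i : ℝ)))
      hξ zero_le_one hd)
    have hin' : inner ℝ (WithLp.toLp 2 (fun i => (m i : ℝ)) : R3) ξ = ∑ i, (m i : ℝ) * ξ i :=
      inner_R3 _ _
    rw [inner_sub_left, hin'] at hin
    linarith [hin.1]
  have hvol : volume (⋃ m ∈ shellPoints c lam W ξ B, {x : R3 | ∀ i, ⌊x i⌋ = m i}) ≤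
      ENNReal.ofReal ((l₂ ^ (3 / c) - l₁ ^ (3 / c)) / 3 *
        (muC c).real (sphCap c ((B - 2 - 2 * (W + E)) / N) ξ)) := by
    refine (measure_mono hsub).trans ((measure_union_le _ _).trans ?_)
    rw [measure_singleton, add_zero]
    exact volume_shellSector_le hc.le hξ h10 h12 hN0 hρ
  have h3c : l₁ ^ (3 / c) ≤ l₂ ^ (3 / c) := Real.rpow_le_rpow h10 h12 (by positivity)
  rw [volume_biUnion_unit_cubes, ← ENNReal.ofReal_natCast, ENNReal.ofReal_le_ofReal_iff
    (mul_nonneg (by linarith) measureReal_nonneg)] at hvol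
  refine hvol.trans (mul_le_mul ?_ ?_ measureReal_nonneg ?_)
  · have b1 := (abs_le.1 (abs_rpow_three_div_sub_le (lam := lam) (u := l₂) (v := lam + W) hc.le
      (by linarith) hlam (by linarith) (by linarith) (by linarith) (by linarith))).2
    have b2 := (abs_le.1 (abs_rpow_three_div_sub_le (lam := lam) (u := lam) (v := l₁) hc.le
      (by linarith) hlam (by linarith) h10 (by linarith) (by linarith))).2
    rw [abs_of_nonneg (by linarith), ← hNdef] at b1 b2
    have b3 := shell_error_mul (c := c) N hN0
    rw [← hE] at b3
    have hpow : 0 ≤ N ^ (3 - c) := by positivity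
    have b4 : N ^ (3 - c) * (l₂ - (lam + W)) = 40 * N ^ 2 := by
      rw [← b3, hl₂]; ring
    have b5 : N ^ (3 - c) * (lam - l₁) ≤ 40 * N ^ 2 := by
      rw [← b3]; gcongr
    have b6 : 0 ≤ N ^ 2 := by positivity
    nlinarith
  · refine measureReal_mono fun y hy => ⟨hy.1, le_trans (div_le_div_of_nonneg_right ?_ hN0.le) hy.2⟩
    linarith
  · have b1 : (lam : ℝ) ^ (3 / c) ≤ ((lam : ℝ) + W) ^ (3 / c) :=
      Real.rpow_le_rpow (by linarith) (by linarith) (by positivity)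
    have b2 : 0 ≤ N ^ 2 := by positivity
    linarith

/-- Here the unit cubes cover a slightly shrunken sector: the integer part of each of its points is
one of the counted points. -/
theorem le_card_shellPoints (hc : 1 < c) (hc2 : c < 9 / 8) (hlam : 0 < lam) {W : ℕ}
    (hW : (W : ℝ) ≤ 2 * ((lam : ℝ) ^ (1 / c)) ^ (1 / 5 : ℝ)) {ξ : R3}
    (hξ : ξ ∈ Metric.sphere (0 : R3) 1) (B : ℝ) :
    ((((lam : ℝ) + W) ^ (3 / c) - (lam : ℝ) ^ (3 / c)) / 3 - 150000 * ((lam : ℝ) ^ (1 / c)) ^ 2) *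
        (muC c).real (sphCap c
          ((B + 100 * ((lam : ℝ) ^ (1 / c)) ^ (1 / 5 : ℝ)) / (lam : ℝ) ^ (1 / c)) ξ) ≤
      ((shellPoints c lam W ξ B).card : ℝ) := by
  have hc0 : 0 < c := by linarith
  have hfin := isFiniteMeasure_muC hc.le
  set N : ℝ := (lam : ℝ) ^ (1 / c) with hNdef
  have hN1 : 1 ≤ N := one_le_rpow_one_div hc.le hlam
  have hN0 : 0 < N := by linarith
  have hNl : N ≤ lam := rpow_one_div_le_self hc.le hlam
  have hl1 : (1 : ℝ) ≤ lam := by exact_mod_cast hlam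
  have hN5 : N ^ (1 / 5 : ℝ) ≤ N := by
    calc _ ≤ N ^ (1 : ℝ) := Real.rpow_le_rpow_of_exponent_le hN1 (by norm_num)
      _ = N := Real.rpow_one _
  have hN51 : 1 ≤ N ^ (1 / 5 : ℝ) := Real.one_le_rpow hN1 (by norm_num)
  have hNc : N ^ (c - 1) ≤ N ^ (1 / 5 : ℝ) := Real.rpow_le_rpow_of_exponent_le hN1 (by linarith)
  have hNc1 : 1 ≤ N ^ (c - 1) := Real.one_le_rpow hN1 (by linarith)
  set E : ℝ := 40 * N ^ (c - 1) with hE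
  have hE0 : 0 < E := by positivity
  have hW0 : (0 : ℝ) ≤ W := W.cast_nonneg
  have b3 := shell_error_mul (c := c) N hN0
  rw [← hE] at b3
  have hpow : 0 ≤ N ^ (3 - c) := by positivity
  have b6 : 0 ≤ N ^ 2 := by positivity
  -- If the shrunken shell is empty then `W < 2E`, and the first factor on the left is already
  -- nonpositive.
  rcases lt_or_ge ((lam : ℝ) + W - E) (lam + E) with hlt | h12
  · refine le_trans (mul_nonpos_of_nonpos_of_nonneg ?_ measureReal_nonneg) (Nat.cast_nonneg _)
    have b1 := (abs_le.1 (abs_rpow_three_div_sub_le (lam := lam) (u := lam + W) (v := lam) hc.le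
      (by linarith) hlam (by linarith) (by linarith) (by linarith) (by linarith))).2
    rw [abs_of_nonneg (by linarith), ← hNdef, add_sub_cancel_left] at b1
    have b4 : N ^ (3 - c) * W ≤ N ^ (3 - c) * (2 * E) := by
      gcongr
      linarith
    nlinarith
  set l₁ : ℝ := lam + E with hl₁
  set l₂ : ℝ := lam + W - E with hl₂
  have h10 : 0 ≤ l₁ := by positivity
  have hρ : ∀ r, l₁ ^ (1 / c) < r → r ≤ l₂ ^ (1 / c) → |r - N| ≤ W + E := by
    intro r hr1 hr2
    have a1 := abs_le.1 (abs_rpow_one_div_sub_le hc.le hl1 h10)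
    have a2 := abs_le.1 (abs_rpow_one_div_sub_le hc.le hl1 (h10.trans h12))
    rw [abs_of_nonneg (by linarith), ← hNdef] at a1
    rw [abs_of_nonneg (by linarith), ← hNdef] at a2
    exact abs_le.2 ⟨by linarith [a1.1], by linarith [a2.2]⟩
  have hsub : shellSector c l₁ l₂ (B + 2) ξ ⊆
      ⋃ m ∈ shellPoints c lam W ξ B, {x : R3 | ∀ i, ⌊x i⌋ = m i} := by
    rintro x ⟨⟨hx1, hx2⟩, hx3⟩
    refine mem_iUnion₂.2 ⟨fun i => ⌊x i⌋, ?_, fun i => rfl⟩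
    have hd : ∀ i, |x i - (⌊x i⌋ : ℝ)| ≤ 1 := fun i =>
      abs_le.2 ⟨by linarith [Int.floor_le (x i)], by linarith [Int.lt_floor_add_one (x i)]⟩
    have hx4 : ∀ i, |x i| ≤ 4 * N := fun i => abs_le_of_abs_rpow_le hc.le
      ((abs_apply_rpow_le_sum c (fun i => x i) i).trans (hx2.trans (by linarith)))
    have hm5 : ∀ i, |(⌊x i⌋ : ℝ)| ≤ 5 * N := by
      intro i
      have a1 := abs_sub_abs_le_abs_sub (⌊x i⌋ : ℝ) (x i)
      rw [abs_sub_comm (⌊x i⌋ : ℝ)] at a1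
      linarith [hd i, hx4 i]
    have hf := abs_le.1 (abs_sum_rpow_sub_le (c := c) hc.le (by linarith) hN0
      (fun i => (hx4 i).trans (by linarith)) hm5 hd)
    have a1 := sum_floor_le c (fun i => ⌊x i⌋)
    have a2 := lt_sum_floor_add c (fun i => ⌊x i⌋)
    rw [shellPoints, Finset.mem_filter, mem_intCube_floor_iff hN0.le]
    refine ⟨fun i => abs_le_of_abs_rpow_le hc.le
      ((abs_apply_rpow_le_sum c (fun i => (⌊x i⌋ : ℝ)) i).trans ?_), ⟨?_, ?_⟩, ?_⟩
    · linarith [hf.1]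
    · have : (lam : ℝ) ≤ ((∑ i, ⌊|((⌊x i⌋ : ℤ) : ℝ)| ^ c⌋ : ℤ) : ℝ) := by linarith [hf.2]
      exact_mod_cast this
    · have : ((∑ i, ⌊|((⌊x i⌋ : ℤ) : ℝ)| ^ c⌋ : ℤ) : ℝ) < lam + W := by linarith [hf.1]
      exact_mod_cast this
    · have hin := abs_le.1 (abs_inner_le_of_forall_abs_le
        (x := x - WithLp.toLp 2 (fun i => (⌊x i⌋ : ℝ))) hξ zero_le_one hd)
      have hin' : inner ℝ (WithLp.toLp 2 (fun i => (⌊x i⌋ : ℝ)) : R3) ξ = ∑ i, (⌊x i⌋ : ℝ) * ξ i :=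
        inner_R3 _ _
      rw [inner_sub_left, hin'] at hin
      linarith [hin.2]
  have hvol := (le_volume_shellSector (B := B + 2) hc.le hξ h10 h12 hN0 hρ).trans (measure_mono hsub)
  rw [volume_biUnion_unit_cubes, ← ENNReal.ofReal_natCast, ENNReal.ofReal_le_ofReal_iff
    (by positivity)] at hvol
  refine le_trans ?_ hvol
  have h3c : l₁ ^ (3 / c) ≤ l₂ ^ (3 / c) := Real.rpow_le_rpow h10 h12 (by positivity)
  have hG : (muC c).real (sphCap c ((B + 100 * N ^ (1 / 5 : ℝ)) / N) ξ) ≤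
      (muC c).real (sphCap c ((B + 2 + 2 * (W + E)) / N) ξ) := by
    refine measureReal_mono fun y hy => ⟨hy.1, le_trans (div_le_div_of_nonneg_right ?_ hN0.le) hy.2⟩
    linarith
  have hX : (((lam : ℝ) + W) ^ (3 / c) - (lam : ℝ) ^ (3 / c)) / 3 - 150000 * N ^ 2 ≤
      (l₂ ^ (3 / c) - l₁ ^ (3 / c)) / 3 := by
    have b1 := (abs_le.1 (abs_rpow_three_div_sub_le (lam := lam) (u := lam + W) (v := l₂) hc.le
      (by linarith) hlam (by linarith) (by linarith) (by linarith) (by linarith))).2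
    have b2 := (abs_le.1 (abs_rpow_three_div_sub_le (lam := lam) (u := l₁) (v := lam) hc.le
      (by linarith) hlam h10 (by linarith) (by linarith) (by linarith))).2
    rw [abs_of_nonneg (by linarith), ← hNdef] at b1 b2
    have b4 : N ^ (3 - c) * (lam + W - l₂) = 40 * N ^ 2 := by
      rw [← b3, hl₂]; ring
    have b5 : N ^ (3 - c) * (l₁ - lam) = 40 * N ^ 2 := by
      rw [← b3, hl₁]; ring
    nlinarith
  exact (mul_le_mul_of_nonneg_right hX measureReal_nonneg).trans
    (mul_le_mul_of_nonneg_left hG (by linarith))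

end Shell

/-! ### One sphere against the average of its neighbours -/

/-- Points of the arithmetic sphere with `m · ξ ≥ B`, as a finite set. -/
noncomputable def spherePoints (c : ℝ) (lam : ℕ) (ξ : R3) (B : ℝ) : Finset (Fin 3 → ℤ) :=
  (intCube ⌊4 * (lam : ℝ) ^ (1 / c)⌋₊).filter fun m =>
    ∑ i, ⌊|(m i : ℝ)| ^ c⌋ = (lam : ℤ) ∧ B ≤ ∑ i, (m i : ℝ) * ξ i

section Comparison

variable {c : ℝ} {lam : ℕ}

theorem sum_range_sphereSum (c : ℝ) (M : ℕ) (w : (Fin 3 → ℤ) → ℝ) (lam : ℤ) (W : ℕ) :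
    ∑ j ∈ Finset.range W, sphereSum c M w (lam + j) =
      ∑ m ∈ (intCube M).filter (fun m => lam ≤ ∑ i, ⌊|(m i : ℝ)| ^ c⌋ ∧
        ∑ i, ⌊|(m i : ℝ)| ^ c⌋ < lam + W), w m := by
  simp only [sphereSum, Finset.sum_filter]
  rw [Finset.sum_comm]
  refine Finset.sum_congr rfl fun m _ => ?_
  split_ifs with h
  · obtain ⟨h1, h2⟩ := h
    rw [Finset.sum_eq_single_of_mem (∑ i, ⌊|(m i : ℝ)| ^ c⌋ - lam).toNat]
    · rw [if_pos (by omega)]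
    · rw [Finset.mem_range]
      omega
    · intro j _ hj
      rw [if_neg (by omega)]
  · refine Finset.sum_eq_zero fun j hj => ?_
    rw [Finset.mem_range] at hj
    rw [if_neg (by omega)]

/-- The ramp majorises the indicator of heights `≥ A` and is majorised by that of heights `≥ A -
δL`, so smoothing costs only a shift of the threshold. -/
theorem sum_ramp_bounds (s : Finset (Fin 3 → ℤ)) (ξ : R3) {δ L : ℝ} (hδ : 0 < δ) (hL : 0 < L)
    (A : ℝ) :
    ((s.filter fun m => A ≤ ∑ i, (m i : ℝ) * ξ i).card : ℝ) ≤
        ∑ m ∈ s, ramp δ ((∑ i, ξ i * m i - A) / L) ∧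
      ∑ m ∈ s, ramp δ ((∑ i, ξ i * m i - A) / L) ≤
        (s.filter fun m => A - δ * L ≤ ∑ i, (m i : ℝ) * ξ i).card := by
  have hcomm : ∀ m : Fin 3 → ℤ, ∑ i, (m i : ℝ) * ξ i = ∑ i, ξ i * m i := fun m =>
    Finset.sum_congr rfl fun i _ => mul_comm _ _
  simp only [Finset.card_filter, hcomm]
  push_cast
  constructor <;> refine Finset.sum_le_sum fun m _ => ?_
  · split_ifs with h
    · rw [ramp_of_nonneg hδ (div_nonneg (by linarith) hL.le)]
    · exact ramp_nonneg hδ _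
  · split_ifs with h
    · exact ramp_le_one hδ _
    · rw [ramp_of_le hδ ((div_le_iff₀ hL).2 (by linarith))]

/-- Comparison of one arithmetic sphere with the average over `W` consecutive ones. -/
theorem card_spherePoints_compare (c : ℝ) (lam W : ℕ) (ξ : R3) {δ L R : ℝ} (hδ : 0 < δ) (hL : 0 < L)
    (A : ℝ)
    (h : ∀ j < W, |sphereSum c ⌊4 * (lam : ℝ) ^ (1 / c)⌋₊
          (fun m => ramp δ ((∑ i, ξ i * m i - A) / L)) ((lam : ℤ) + (j : ℕ)) -
        sphereSum c ⌊4 * (lam : ℝ) ^ (1 / c)⌋₊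
          (fun m => ramp δ ((∑ i, ξ i * m i - A) / L)) lam| ≤ R) :
    (W : ℝ) * (spherePoints c lam ξ A).card ≤ (shellPoints c lam W ξ (A - δ * L)).card + W * R ∧
      ((shellPoints c lam W ξ A).card : ℝ) ≤
        W * (spherePoints c lam ξ (A - δ * L)).card + W * R := by
  obtain ⟨h1, h2⟩ := sum_ramp_bounds ((intCube ⌊4 * (lam : ℝ) ^ (1 / c)⌋₊).filter fun m =>
    ∑ i, ⌊|(m i : ℝ)| ^ c⌋ = (lam : ℤ)) ξ hδ hL A
  obtain ⟨h3, h4⟩ := sum_ramp_bounds ((intCube ⌊4 * (lam : ℝ) ^ (1 / c)⌋₊).filter fun m =>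
    (lam : ℤ) ≤ ∑ i, ⌊|(m i : ℝ)| ^ c⌋ ∧ ∑ i, ⌊|(m i : ℝ)| ^ c⌋ < (lam : ℤ) + W) ξ hδ hL A
  rw [← sum_range_sphereSum] at h3 h4
  rw [Finset.filter_filter, ← sphereSum] at h1
  rw [Finset.filter_filter, ← sphereSum] at h2
  rw [Finset.filter_filter] at h3 h4
  simp only [spherePoints, shellPoints]
  set S : ℤ → ℝ := sphereSum c ⌊4 * (lam : ℝ) ^ (1 / c)⌋₊
    (fun m => ramp δ ((∑ i, ξ i * m i - A) / L))
  have h5 : |∑ j ∈ Finset.range W, S ((lam : ℤ) + (j : ℕ)) - W * S lam| ≤ W * R := by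
    have h6 : ∑ j ∈ Finset.range W, S ((lam : ℤ) + (j : ℕ)) - W * S lam =
        ∑ j ∈ Finset.range W, (S ((lam : ℤ) + (j : ℕ)) - S lam) := by
      simp [Finset.sum_sub_distrib]
    rw [h6]
    refine (Finset.abs_sum_le_sum_abs _ _).trans ((Finset.sum_le_sum fun j hj =>
      h j (Finset.mem_range.1 hj)).trans ?_)
    simp
  have hW : (0 : ℝ) ≤ W := W.cast_nonneg
  have h7 := mul_le_mul_of_nonneg_left h1 hW
  have h8 := mul_le_mul_of_nonneg_left h2 hW
  have h9 := abs_le.1 h5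
  exact ⟨by linarith [h9.1], by linarith [h9.2]⟩

theorem abs_apply_le_of_sum_floor_eq (hc : 1 ≤ c) (hlam : 0 < lam) {m : Fin 3 → ℤ}
    (hm : ∑ i, ⌊|(m i : ℝ)| ^ c⌋ = (lam : ℤ)) (i : Fin 3) :
    |(m i : ℝ)| ≤ 2 * (lam : ℝ) ^ (1 / c) := by
  have hc0 : 0 < c := by linarith
  have h1 : ⌊|(m i : ℝ)| ^ c⌋ ≤ (lam : ℤ) := hm ▸ Finset.single_le_sum
    (f := fun i => ⌊|(m i : ℝ)| ^ c⌋) (fun j _ => Int.floor_nonneg.2 (by positivity))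
    (Finset.mem_univ i)
  have hl : (1 : ℝ) ≤ lam := by exact_mod_cast hlam
  have h2 : |(m i : ℝ)| ^ c ≤ 2 * lam := by
    have h3 : ((⌊|(m i : ℝ)| ^ c⌋ : ℤ) : ℝ) ≤ lam := by exact_mod_cast h1
    linarith [Int.lt_floor_add_one (|(m i : ℝ)| ^ c)]
  refine (Real.rpow_le_rpow_iff (abs_nonneg _) (by positivity) hc0).1 ?_
  rw [Real.mul_rpow (by norm_num) (by positivity), rpow_one_div_rpow hc]
  have h4 : (2 : ℝ) ^ (1 : ℝ) ≤ 2 ^ c := Real.rpow_le_rpow_of_exponent_le (by norm_num) hc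
  rw [Real.rpow_one] at h4
  exact h2.trans (by gcongr)

theorem abs_inner_le_of_sum_floor_eq (hc : 1 ≤ c) (hlam : 0 < lam) {m : Fin 3 → ℤ}
    (hm : ∑ i, ⌊|(m i : ℝ)| ^ c⌋ = (lam : ℤ)) {ξ : R3} (hξ : ξ ∈ Metric.sphere (0 : R3) 1) :
    |∑ i, (m i : ℝ) * ξ i| ≤ 4 * (lam : ℝ) ^ (1 / c) := by
  have h := abs_inner_le_of_forall_abs_le (x := WithLp.toLp 2 (fun i => (m i : ℝ))) hξ
    (by positivity) (abs_apply_le_of_sum_floor_eq hc hlam hm)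
  rw [inner_R3] at h
  simp only at h
  linarith

theorem mem_spherePoints_iff (hc : 1 ≤ c) (hlam : 0 < lam) (ξ : R3) (B : ℝ) (m : Fin 3 → ℤ) :
    m ∈ spherePoints c lam ξ B ↔ m ∈ arithSphere c lam ∧ B ≤ ∑ i, (m i : ℝ) * ξ i := by
  rw [spherePoints, Finset.mem_filter, mem_intCube_floor_iff (by positivity)]
  refine ⟨fun h => h.2, fun h => ⟨fun i => ?_, h⟩⟩
  have h1 := abs_apply_le_of_sum_floor_eq hc hlam h.1 i
  have h2 : 0 ≤ (lam : ℝ) ^ (1 / c) := by positivity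
  linarith

theorem rC_eq_card (hc : 1 ≤ c) (hlam : 0 < lam) {ξ : R3} (hξ : ξ ∈ Metric.sphere (0 : R3) 1) :
    rC c lam = (spherePoints c lam ξ (-4 * (lam : ℝ) ^ (1 / c))).card := by
  rw [rC, ← Set.ncard_coe_finset]
  congr 1
  ext m
  rw [Finset.mem_coe, mem_spherePoints_iff hc hlam]
  refine ⟨fun h => ⟨h, ?_⟩, fun h => h.1⟩
  have := (abs_le.1 (abs_inner_le_of_sum_floor_eq hc hlam h hξ)).1
  linarith

theorem spherePoints_eq_empty (hc : 1 ≤ c) (hlam : 0 < lam) {ξ : R3}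
    (hξ : ξ ∈ Metric.sphere (0 : R3) 1) {a : ℝ} (ha : 4 < a) :
    spherePoints c lam ξ (a * (lam : ℝ) ^ (1 / c)) = ∅ := by
  refine Finset.eq_empty_of_forall_notMem fun m hm => ?_
  rw [mem_spherePoints_iff hc hlam] at hm
  have h1 := (abs_le.1 (abs_inner_le_of_sum_floor_eq hc hlam hm.1 hξ)).2
  have h2 := one_le_rpow_one_div hc hlam
  have h3 := hm.2
  nlinarith

theorem ncard_projSphere_inter_solidCap (hc : 1 ≤ c) (hlam : 0 < lam) {ξ : R3}
    (hξ : ξ ∈ Metric.sphere (0 : R3) 1) (a : ℝ) :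
    (projSphere c lam ∩ solidCap a ξ).ncard =
      (spherePoints c lam ξ (a * (lam : ℝ) ^ (1 / c))).card := by
  have hN := one_le_rpow_one_div hc hlam
  have hN0 : 0 < (lam : ℝ) ^ (1 / c) := by linarith
  have hinv : (lam : ℝ) ^ (-(1 / c)) = ((lam : ℝ) ^ (1 / c))⁻¹ := Real.rpow_neg (by positivity) _
  set f : (Fin 3 → ℤ) → R3 := fun m =>
    ((lam : ℝ) ^ (-(1 / c))) • (WithLp.toLp 2 (fun i => (m i : ℝ)) : R3) with hf
  have hfin : ∀ m, inner ℝ (f m) ξ = ((lam : ℝ) ^ (1 / c))⁻¹ * ∑ i, (m i : ℝ) * ξ i := by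
    intro m
    rw [hf]
    simp only
    rw [inner_smul_left, inner_R3, hinv]
    simp
  have hinj : Function.Injective f := by
    intro m m' h
    have h1 := smul_right_injective R3 (by rw [hinv]; positivity : (lam : ℝ) ^ (-(1 / c)) ≠ 0) h
    ext i
    have h2 := congrArg (fun x : R3 => x i) h1
    simpa using h2
  rw [← Set.ncard_coe_finset, ← Set.ncard_image_of_injective _ hinj]
  congr 1
  ext x
  constructor
  · rintro ⟨⟨m, hm, rfl⟩, hx, -⟩
    refine ⟨m, ?_, rfl⟩
    rw [Finset.mem_coe, mem_spherePoints_iff hc hlam]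
    refine ⟨hm, ?_⟩
    have h1 : a ≤ inner ℝ (f m) ξ := hx
    rw [hfin, inv_mul_eq_div, le_div_iff₀ hN0] at h1
    exact h1
  · rintro ⟨m, hm, rfl⟩
    rw [Finset.mem_coe, mem_spherePoints_iff hc hlam] at hm
    refine ⟨⟨m, hm.1, rfl⟩, ?_, ?_⟩
    · rw [hfin, inv_mul_eq_div, le_div_iff₀ hN0]
      exact hm.2
    -- The upper cutoff `100` never matters, since scaled points have height at most `4`.
    · have h1 := (abs_le.1 (abs_inner_le_of_sum_floor_eq hc hlam hm.1 hξ)).2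
      rw [hfin, inv_mul_eq_div, div_le_iff₀ hN0]
      linarith

end Comparison

/-! ### Assembling the estimates -/

/-- The normalisation `L = 160N` puts all heights in the range of the cosine series: `|ξ · m| ≤ 8N`
on the cube, and `(8 + 24) / 160 ≤ 1/4`. -/
theorem abs_ramp_arg_le {c : ℝ} {lam : ℕ} (hc : 1 ≤ c) (hlam : 0 < lam) {ξ : R3}
    (hξ : ξ ∈ Metric.sphere (0 : R3) 1) {A : ℝ} (hA : |A| ≤ 24 * (lam : ℝ) ^ (1 / c))
    {m : Fin 3 → ℤ} (hm : m ∈ intCube ⌊4 * (lam : ℝ) ^ (1 / c)⌋₊) :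
    |(∑ i, ξ i * m i - A) / (160 * (lam : ℝ) ^ (1 / c))| ≤ 1 / 4 := by
  have hN := one_le_rpow_one_div hc hlam
  set N : ℝ := (lam : ℝ) ^ (1 / c)
  have hN0 : 0 < N := by linarith
  rw [mem_intCube_floor_iff hN0.le] at hm
  have h := abs_inner_le_of_forall_abs_le (x := WithLp.toLp 2 (fun i => (m i : ℝ))) hξ
    (by positivity) hm
  rw [inner_R3] at h
  simp only [mul_comm (m _ : ℝ)] at h
  rw [abs_div, abs_of_pos (show 0 < 160 * N by positivity), div_le_iff₀ (by positivity)]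
  linarith [abs_sub (∑ i, ξ i * m i) A]

set_option maxHeartbeats 1000000 in
/-- The number of lattice points of the arithmetic sphere in a half space is the measure of the
corresponding cap times a quantity that does not depend on the half space, up to a small error. -/
theorem exists_card_spherePoints_approx {c : ℝ} (hc : 1 < c) (hc2 : c < 9 / 8) {ε : ℝ}
    (hε : 0 < ε) (hε1 : ε ≤ 1) :
    ∃ C : ℝ, 0 < C ∧ ∀ lam : ℕ, 0 < lam → ∃ X : ℝ, ∀ ξ ∈ Metric.sphere (0 : R3) 1,
      ∀ a : ℝ, |a| ≤ 4 →
      |((spherePoints c lam ξ (a * (lam : ℝ) ^ (1 / c))).card : ℝ) -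
          (muC c).real (sphCap c a ξ) * X| ≤
        C * ((lam : ℝ) ^ (1 / c)) ^ ((6 + 3 * c) / 5 + c * ε) := by
  have hfin := isFiniteMeasure_muC hc.le
  obtain ⟨C₁, hC₁, hramp⟩ := exists_abs_sphereSum_ramp_sub_le hc hc2 hε hε1
  obtain ⟨K, hK, hcap⟩ := exists_muC_sphCap_le_add hc (by linarith)
  set μ : ℝ := (muC c).real univ
  have hμ : 0 ≤ μ := measureReal_nonneg
  refine ⟨120 * K * 1849 + 150000 * μ + 128 * C₁, by positivity, fun lam hlam => ?_⟩
  have hN1 := one_le_rpow_one_div hc.le hlam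
  have hup := fun (W : ℕ) hW (ξ : R3) => card_shellPoints_le (c := c) (lam := lam) (W := W)
    (ξ := ξ) hc hc2 hlam hW
  have hlo := fun (W : ℕ) hW (ξ : R3) => le_card_shellPoints (c := c) (lam := lam) (W := W)
    (ξ := ξ) hc hc2 hlam hW
  have hsph := fun (W : ℕ) (ξ : R3) (δ L R : ℝ) => card_spherePoints_compare c lam W ξ
    (δ := δ) (L := L) (R := R)
  have harg := fun (ξ : R3) hξ A hA => fun m hm => abs_ramp_arg_le (c := c) (lam := lam) hc.le hlam
    (ξ := ξ) hξ (A := A) hA (m := m) hm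
  have hX3 := fun (W : ℕ) => abs_rpow_three_div_sub_le (c := c) (lam := lam) hc.le (by linarith)
    hlam (u := lam + W) (v := lam) (by positivity) (by positivity)
  have hNl : (lam : ℝ) ^ (1 / c) ≤ lam := rpow_one_div_le_self hc.le hlam
  set N : ℝ := (lam : ℝ) ^ (1 / c)
  have hN0 : 0 < N := by linarith
  have hN51 : 1 ≤ N ^ (1 / 5 : ℝ) := Real.one_le_rpow hN1 (by norm_num)
  have hN5 : N ^ (1 / 5 : ℝ) ≤ N := by
    calc _ ≤ N ^ (1 : ℝ) := Real.rpow_le_rpow_of_exponent_le hN1 (by norm_num)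
      _ = N := Real.rpow_one _
  set W : ℕ := ⌈N ^ (1 / 5 : ℝ)⌉₊
  have hW1 : N ^ (1 / 5 : ℝ) ≤ W := Nat.le_ceil _
  have hW2 : (W : ℝ) ≤ 2 * N ^ (1 / 5 : ℝ) := by
    linarith [Nat.ceil_lt_add_one (show 0 ≤ N ^ (1 / 5 : ℝ) by positivity)]
  have hW0 : (0 : ℝ) < W := by linarith
  set M : ℕ := ⌊4 * N⌋₊
  have hM1 : N ≤ M := by linarith [Nat.sub_one_lt_floor (4 * N)]
  have hM4 : (M : ℝ) ≤ 4 * N := Nat.floor_le (by positivity)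
  have hM0 : 0 < M := by exact_mod_cast hN0.trans_le hM1
  -- The scale at which `d N ^ (3 - c) = N ^ ((6 + 3c)/5)`, so that the smoothing error matches the
  -- error of the circle method.
  set d : ℝ := N ^ (-((9 - 8 * c) / 5)) with hd
  have hd0 : 0 < d := by positivity
  have hd1 : d ≤ 1 := Real.rpow_le_one_of_one_le_of_nonpos hN1 (by linarith)
  set T : ℝ := (6 + 3 * c) / 5 with hT
  set P : ℝ := N ^ (T + c * ε) with hP
  have hTP : N ^ T ≤ P := Real.rpow_le_rpow_of_exponent_le hN1 (by nlinarith)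
  have h95 : N ^ (9 / 5 : ℝ) ≤ P := Real.rpow_le_rpow_of_exponent_le hN1 (by
    rw [hT]; nlinarith)
  have hT2 : T ≤ 2 := by rw [hT]; linarith
  set R : ℝ := C₁ * (d / 8) ^ (-ε) * (M : ℝ) ^ T with hR
  have hRP : R ≤ 128 * C₁ * P := by
    have h1 : (d / 8) ^ (-ε) = d ^ (-ε) * 8 ^ ε := by
      rw [Real.div_rpow hd0.le (by norm_num), Real.rpow_neg (show (0 : ℝ) ≤ 8 by norm_num),
        div_inv_eq_mul]
    have h2 : d ^ (-ε) ≤ N ^ (c * ε) := by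
      rw [hd, ← Real.rpow_mul hN0.le]
      exact Real.rpow_le_rpow_of_exponent_le hN1 (by nlinarith)
    have h3 : (8 : ℝ) ^ ε ≤ 8 ^ (1 : ℝ) := Real.rpow_le_rpow_of_exponent_le (by norm_num) hε1
    have h4 : (M : ℝ) ^ T ≤ 16 * N ^ T := by
      refine (Real.rpow_le_rpow (by positivity) hM4 (by rw [hT]; linarith)).trans ?_
      rw [Real.mul_rpow (by norm_num) hN0.le]
      have : (4 : ℝ) ^ T ≤ 4 ^ (2 : ℝ) := Real.rpow_le_rpow_of_exponent_le (by norm_num) hT2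
      rw [Real.rpow_two] at this
      gcongr
      linarith
    rw [Real.rpow_one] at h3
    rw [hR, h1]
    calc C₁ * (d ^ (-ε) * 8 ^ ε) * (M : ℝ) ^ T ≤ C₁ * (N ^ (c * ε) * 8) * (16 * N ^ T) := by gcongr
      _ = 128 * C₁ * (N ^ T * N ^ (c * ε)) := by ring
      _ = _ := by rw [← Real.rpow_add hN0]
  have hN4d : 100 * N ^ (1 / 5 : ℝ) ≤ 100 * d * N := by
    have h1 : d * N = N ^ (-((9 - 8 * c) / 5) + 1) := by rw [Real.rpow_add_one hN0.ne']
    rw [mul_assoc, h1]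
    gcongr
    linarith
  have hdiff : ∀ ξ ∈ Metric.sphere (0 : R3) 1, ∀ a : ℝ, |a| ≤ 4 → ∀ j < W, ∀ t : ℝ, |t| ≤ 20 →
      |sphereSum c M (fun m => ramp (d / 8) ((∑ i, ξ i * m i - (a * N + t * N)) / (160 * N)))
          ((lam : ℤ) + (j : ℕ)) -
        sphereSum c M (fun m => ramp (d / 8) ((∑ i, ξ i * m i - (a * N + t * N)) / (160 * N))) lam|
        ≤ R := by
    intro ξ hξ a ha j hj t ht
    refine hramp M hM0 ξ _ _ _ (by positivity) (by linarith) (harg ξ hξ _ ?_) _ _ ?_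
    · rw [← add_mul, abs_mul, abs_of_pos hN0]
      have := abs_add_le a t
      gcongr
      linarith
    · have h1 : (j : ℝ) ≤ W := by exact_mod_cast hj.le
      refine h1.trans (hW2.trans ?_)
      gcongr
  set Y : ℝ := ((lam : ℝ) + W) ^ (3 / c) - (lam : ℝ) ^ (3 / c) with hY
  have hY0 : 0 ≤ Y := sub_nonneg.2 (Real.rpow_le_rpow (by positivity) (by linarith) (by positivity))
  -- The average over the `W` spheres of the volume per unit of `μ_c`; it depends neither on `ξ` nor
  -- on `a`.
  set X : ℝ := Y / (3 * W) with hX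
  have hX0 : 0 ≤ X := by positivity
  have hYX : Y / 3 = W * X := by rw [hX]; field_simp
  have hXd : d * X ≤ 1849 * P := by
    have hW43 : (lam : ℝ) + W ≤ 43 * lam := by linarith
    have h1 := (abs_le.1 (hX3 W hW43 (by linarith))).2
    rw [add_sub_cancel_left, abs_of_pos hW0] at h1
    have h2 : X ≤ 1849 * N ^ (3 - c) := by
      rw [hX, div_le_iff₀ (by positivity)]
      linarith
    calc d * X ≤ d * (1849 * N ^ (3 - c)) := by gcongr
      _ = 1849 * (N ^ (-((9 - 8 * c) / 5)) * N ^ (3 - c)) := by ring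
      _ = 1849 * N ^ T := by
        rw [← Real.rpow_add hN0]
        congr 2
        rw [hT]
        ring
      _ ≤ _ := by gcongr
  have hW2N : N ^ 2 ≤ W * P := by
    calc N ^ 2 = N ^ (1 / 5 : ℝ) * N ^ (9 / 5 : ℝ) := by
          rw [← Real.rpow_add hN0, ← Real.rpow_two]
          norm_num
      _ ≤ W * P := by gcongr
  have hP0 : 0 < P := by positivity
  refine ⟨X, fun ξ hξ a ha => ?_⟩
  set G : ℝ → ℝ := fun b => (muC c).real (sphCap c b ξ) with hG
  have hG0 : ∀ b, 0 ≤ G b := fun b => measureReal_nonneg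
  have hGμ : ∀ b, G b ≤ μ := fun b => measureReal_mono (subset_univ _)
  have hGanti : ∀ {b b' : ℝ}, b ≤ b' → G b' ≤ G b := fun hb =>
    measureReal_mono fun y hy => ⟨hy.1, hb.trans hy.2⟩
  have hGlip : ∀ {b b' : ℝ}, b ≤ b' → G b ≤ G b' + K * (b' - b) := fun hb => hcap ξ hξ _ _ hb
  have hstep : d / 8 * (160 * N) = 20 * d * N := by ring
  have hup' := (hsph W ξ (d / 8) (160 * N) R (by positivity) (by positivity)
    (a * N) (fun j hj => by simpa using hdiff ξ hξ a ha j hj 0 (by norm_num))).1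
  -- For the lower bound the threshold is raised by the ramp width `20 d N` first, so that the loss
  -- brings it back to `a N`.
  have hlo' := (hsph W ξ (d / 8) (160 * N) R (by positivity) (by positivity)
    (a * N + 20 * d * N) (fun j hj => hdiff ξ hξ a ha j hj (20 * d) (by
      rw [abs_of_pos (by positivity)]; linarith))).2
  rw [hstep] at hup' hlo'
  rw [add_sub_cancel_right] at hlo'
  have hup2 := hup W hW2 ξ hξ (a * N - 20 * d * N)
  have hlo2 := hlo W hW2 ξ hξ (a * N + 20 * d * N)
  rw [← hY, hYX] at hup2 hlo2
  set g₁ : ℝ := G ((a * N - 20 * d * N - 100 * N ^ (1 / 5 : ℝ)) / N) with hg₁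
  set g₂ : ℝ := G ((a * N + 20 * d * N + 100 * N ^ (1 / 5 : ℝ)) / N) with hg₂
  -- The height shift `120 d` is `20 d` from the ramp plus `100 d` from `100 N ^ (1/5) ≤ 100 d N`.
  have e1 : g₁ ≤ G a + K * (120 * d) := by
    have h1 : a - 120 * d ≤ (a * N - 20 * d * N - 100 * N ^ (1 / 5 : ℝ)) / N := by
      rw [le_div_iff₀ hN0]
      linarith
    have h2 := hGlip (show a - 120 * d ≤ a by linarith)
    rw [sub_sub_cancel] at h2
    exact (hGanti h1).trans h2
  have e2 : G a ≤ g₂ + K * (120 * d) := by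
    have h1 : (a * N + 20 * d * N + 100 * N ^ (1 / 5 : ℝ)) / N ≤ a + 120 * d := by
      rw [div_le_iff₀ hN0]
      linarith
    have h2 := hGlip (show a ≤ a + 120 * d by linarith)
    rw [add_sub_cancel_left] at h2
    exact h2.trans (by linarith [hGanti h1])
  set k : ℝ := ((spherePoints c lam ξ (a * N)).card : ℝ) with hk
  have hupF : W * k ≤ (W * X + 150000 * N ^ 2) * g₁ + W * R := hup'.trans (by gcongr)
  have hloF : (W * X - 150000 * N ^ 2) * g₂ ≤ W * k + W * R := hlo2.trans hlo'
  have f1 : X * g₁ ≤ G a * X + 120 * K * (1849 * P) := by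
    calc X * g₁ ≤ X * (G a + K * (120 * d)) := by gcongr
      _ = G a * X + 120 * K * (d * X) := by ring
      _ ≤ _ := by gcongr
  have f2 : G a * X ≤ X * g₂ + 120 * K * (1849 * P) := by
    calc G a * X ≤ (g₂ + K * (120 * d)) * X := by gcongr
      _ = X * g₂ + 120 * K * (d * X) := by ring
      _ ≤ _ := by gcongr
  have f3 : ∀ b, 150000 * N ^ 2 * G b ≤ W * (150000 * μ * P) := by
    intro b
    calc 150000 * N ^ 2 * G b ≤ 150000 * (W * P) * μ := by
          have := hGμ b
          have := hG0 b
          gcongr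
      _ = _ := by ring
  refine abs_le.2 ⟨?_, ?_⟩
  · have : W * (G a * X) ≤ W * (k + (120 * K * 1849 + 150000 * μ + 128 * C₁) * P) := by
      calc W * (G a * X) ≤ W * (X * g₂ + 120 * K * (1849 * P)) := by gcongr
        _ = (W * X - 150000 * N ^ 2) * g₂ + 150000 * N ^ 2 * g₂ + W * (120 * K * (1849 * P)) := by
          ring
        _ ≤ W * k + W * (128 * C₁ * P) + W * (150000 * μ * P) + W * (120 * K * (1849 * P)) := by
          have := f3 ((a * N + 20 * d * N + 100 * N ^ (1 / 5 : ℝ)) / N)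
          have := mul_le_mul_of_nonneg_left hRP hW0.le
          linarith
        _ = _ := by ring
    have := le_of_mul_le_mul_left this hW0
    change _ ≤ k - G a * X
    linarith
  · have : W * k ≤ W * (G a * X + (120 * K * 1849 + 150000 * μ + 128 * C₁) * P) := by
      calc W * k ≤ W * (X * g₁) + 150000 * N ^ 2 * g₁ + W * R := by linarith
        _ ≤ W * (G a * X + 120 * K * (1849 * P)) + W * (150000 * μ * P) + W * (128 * C₁ * P) := by
          have := f3 ((a * N - 20 * d * N - 100 * N ^ (1 / 5 : ℝ)) / N)
          have := mul_le_mul_of_nonneg_left hRP hW0.le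
          have := mul_le_mul_of_nonneg_left f1 hW0.le
          linarith
        _ = _ := by ring
    have := le_of_mul_le_mul_left this hW0
    change k - G a * X ≤ _
    linarith

/-- For `a ≤ 4` both the cap count and `r_c(lam)` are approximated with the same `X`, and the main
terms cancel because `ν_c = μ_c / S`. For `a > 4` both parts of the discrepancy vanish. -/
theorem theorem1p10 (c : ℝ) (hc : 1 < c) (hc' : c < 9 / 8) (ε : ℝ) (hε : 0 < ε) :
    ∃ C : ℝ, 0 < C ∧ ∀ lam : ℕ, 0 < lam → ∀ ξ : R3, ξ ∈ Metric.sphere (0 : R3) 1 →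
      discr c lam ξ ≤
        ENNReal.ofReal (C * (lam : ℝ) ^ (3 / c - 1 - (9 - 8 * c) / (5 * c) + ε)) := by
  have hc0 : 0 < c := by linarith
  have hfin := isFiniteMeasure_muC hc.le
  -- The approximation requires `ε ≤ 1`; passing to `min ε 1` only strengthens the estimate.
  obtain ⟨C, hC, h⟩ := exists_card_spherePoints_approx hc hc' (lt_min hε one_pos) (min_le_right ε 1)
  set S : ℝ := (muC c).real (cSphere c) with hS
  have hS0 : 0 < S := by
    rw [hS, measureReal_def, muC_cSphere hc.le]
    have h1 := Real.Gamma_pos_of_pos (show 0 < 1 / c by positivity)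
    have h3 := Real.Gamma_pos_of_pos (show 0 < 3 / c by positivity)
    rw [ENNReal.toReal_ofReal (by positivity)]
    positivity
  have hν : ∀ E, (nuC c).real E = (muC c).real E / S := by
    intro E
    rw [nuC, measureReal_ennreal_smul_apply, ENNReal.toReal_inv, ← measureReal_def, ← hS,
      inv_mul_eq_div]
  refine ⟨2 * C, by positivity, fun lam hlam ξ hξ => iSup₂_le fun a ha => ?_⟩
  refine ENNReal.ofReal_le_ofReal ?_
  obtain ⟨X, hX⟩ := h lam hlam
  have hN1 := one_le_rpow_one_div hc.le hlam
  have hpow : ((lam : ℝ) ^ (1 / c)) ^ ((6 + 3 * c) / 5 + c * min ε 1) ≤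
      (lam : ℝ) ^ (3 / c - 1 - (9 - 8 * c) / (5 * c) + ε) := by
    have h1 : 3 / c - 1 - (9 - 8 * c) / (5 * c) + ε = 1 / c * ((6 + 3 * c) / 5 + c * ε) := by
      field_simp
      ring
    rw [h1, Real.rpow_mul (by positivity)]
    refine Real.rpow_le_rpow_of_exponent_le hN1 ?_
    gcongr
    exact min_le_left _ _
  rw [discrAt, ncard_projSphere_inter_solidCap hc.le hlam hξ, hν]
  rcases lt_or_ge 4 a with ha4 | ha4
  · have h1 : sphCap c a ξ = ∅ := by
      refine eq_empty_of_forall_notMem fun y hy => ?_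
      have := (abs_le.1 (abs_inner_le_of_mem_cSphere hc0 hξ hy.1)).2
      linarith [hy.2]
    rw [spherePoints_eq_empty hc.le hlam hξ ha4, h1]
    simp
    positivity
  have hcap4 : sphCap c (-4) ξ = cSphere c := by
    refine Subset.antisymm (fun y hy => hy.1) fun y hy => ⟨hy, ?_⟩
    linarith [(abs_le.1 (abs_inner_le_of_mem_cSphere hc0 hξ hy)).1]
  have h1 := hX ξ hξ a (by rw [abs_of_pos ha]; exact ha4)
  have h2 := hX ξ hξ (-4) (by norm_num)
  rw [hcap4, ← hS, ← rC_eq_card hc.le hlam hξ] at h2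
  set g : ℝ := (muC c).real (sphCap c a ξ)
  have hg0 : 0 ≤ g / S := div_nonneg measureReal_nonneg hS0.le
  have hg1 : g / S ≤ 1 := (div_le_one hS0).2 (measureReal_mono fun y hy => hy.1)
  set k : ℝ := ((spherePoints c lam ξ (a * (lam : ℝ) ^ (1 / c))).card : ℝ)
  have h3 : k - rC c lam * (g / S) = (k - g * X) - g / S * (rC c lam - S * X) := by
    field_simp
    ring
  rw [h3]
  refine (abs_sub _ _).trans ?_
  rw [abs_mul, abs_of_nonneg hg0]
  have h4 := mul_le_mul hg1 h2 (abs_nonneg _) zero_le_one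
  have h5 := mul_le_mul_of_nonneg_left hpow hC.le
  linarith
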